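/- Let $n\ge 2$. For a measurable $E\subset\mathbb{R}^n$ let $P(E)=\sup\{\int_E \operatorname{div}\xi : \xi\in C^1_c(\mathbb{R}^n;\mathbb{R}^n),\ \|\xi\|_\infty\le 1\}$ be its perimeter in $\mathbb{R}^n$, $\partial^*E$ its reduced boundary, and $d_E=\operatorname{dist}(\cdot,\partial E)$ (with $d_E=\infty$ if $\partial E=\emptyset$). All sets $E_0$ and $E_k$ below are represented so that $\partial E=\overline{\partial^*E}$. Let $E_0\subset\mathbb{R}^n$ be bounded, measurable and strictly mean convex in the variational sense: there is $\delta>0$ such that $P(E_0)\le P(F)$ for every measurable $F$ with $E_0\subset F\subset\{x:\operatorname{dist}(x,E_0)<\delta\}$. For $h>0$ let $E_1,E_2,\dots$ be obtained from $E_0$ by the implicit time discretization, i.e. $E_k$ is a minimizer, among measurable sets $E$, of $$P(E)+\frac1h\int_{E\Delta E_{k-1}}d_{E_{k-1}}\,dx ,$$ and let $u_h=h\sum_{k\ge0}\chi_{E_k}$ be the discrete arrival time. Let $h_j>0$, $h_j\to0$, let $u_{h_j}$ be such arrival times (for any choice of the minimizers), and let $u:\mathbb{R}^n\to[0,\infty)$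 be such that $u_{h_j}\to u$ uniformly on $\mathbb{R}^n$ and $Du_{h_j}\rightharpoonup Du$ weakly as $\mathbb{R}^n$-valued measures (tested against $C_c(\mathbb{R}^n)$). Then $u\in BV(\mathbb{R}^n)$, $u_{h_j}\in BV(\mathbb{R}^n)$ for all large $j$, and $$|Du_{h_j}|\rightharpoonup|Du|\quad\text{weakly as measures (tested against } C_c(\mathbb{R}^n)).$$ Moreover $$\int_{\mathbb{R}^n}|Du_{h_j}|\to\int_{\mathbb{R}^n}|Du| \qquad\text{and}\qquad u_{h_j}\to u \text{ in } L^1(\mathbb{R}^n),$$ that is, $u_{h_j}$ converges to $u$ strictly in $BV$. (In the weak convergence hypothesis, the gradient measure of a function whose distributional gradient is not a finite measure is read as $0$; by the conclusion this can concern only finitely many $j$.) -/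

import Mathlib

open MeasureTheory Filter Topology Set
open scoped ENNReal NNReal symmDiff

noncomputable section

namespace ATW

/-- The Euclidean space `ℝⁿ`. -/
abbrev Eucl (n : ℕ) : Type := EuclideanSpace ℝ (Fin n)

variable {n : ℕ}

/-- The divergence `∑ i, ∂ᵢ ξᵢ` of a vector field. -/
def divergence (ξ : Eucl n → Eucl n) (x : Eucl n) : ℝ :=
  ∑ i : Fin n, (fderiv ℝ ξ x (EuclideanSpace.single i 1)) i

/-- The De Giorgi perimeter `P(E) = sup {∫_E div ξ : ξ ∈ C¹_c(ℝⁿ; ℝⁿ), ‖ξ‖_∞ ≤ 1}`. -/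
def perimeter (E : Set (Eucl n)) : ℝ≥0∞ :=
  ⨆ (ξ : Eucl n → Eucl n) (_ : ContDiff ℝ 1 ξ) (_ : HasCompactSupport ξ) (_ : ∀ x, ‖ξ x‖ ≤ 1),
    ENNReal.ofReal (∫ x in E, divergence ξ x)

/-- `D` is a finite vector-valued measure which is the distributional gradient of the locally
integrable function `u`: `∫ u ∇φ dx = - ∫ φ dD` for all `φ ∈ C¹_c(ℝⁿ)`. -/
structure IsDistribGradient (u : Eucl n → ℝ) (D : VectorMeasure (Eucl n) (Eucl n)) : Prop where
  locallyIntegrable : LocallyIntegrable u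
  finite : IsFiniteMeasure D.variation
  integral_eq : ∀ φ : Eucl n → ℝ, ContDiff ℝ 1 φ → HasCompactSupport φ →
    ∫ x, u x • gradient φ x = - ∫ᵛ x, φ x ∂•D

/-- `u ∈ BV(ℝⁿ)`: `u` is integrable and its distributional gradient is a finite vector measure. -/
def IsBV (u : Eucl n → ℝ) : Prop :=
  Integrable u ∧ ∃ D : VectorMeasure (Eucl n) (Eucl n), IsDistribGradient u D

open Classical in
/-- The gradient measure `Du` (unique when it exists; `0` if it does not exist as a finite
vector measure). The measure `|Du|` is `(gradMeasure u).variation`. -/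
def gradMeasure (u : Eucl n → ℝ) : VectorMeasure (Eucl n) (Eucl n) :=
  if h : ∃ D : VectorMeasure (Eucl n) (Eucl n), IsDistribGradient u D then h.choose else 0

/-- De Giorgi's reduced boundary `∂*F`: the points `x` of the support of `|Dχ_F|` at which
`Dχ_F(B_r(x)) / |Dχ_F|(B_r(x))` converges, as `r ↓ 0`, to a unit vector. -/
def reducedBoundary (F : Set (Eucl n)) : Set (Eucl n) :=
  {x | (∀ r > 0, 0 < (gradMeasure (F.indicator 1)).variation (Metric.ball x r)) ∧
    ∃ ν : Eucl n, ‖ν‖ = 1 ∧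
      Tendsto (fun r : ℝ => ((gradMeasure (F.indicator 1)).variation.real (Metric.ball x r))⁻¹ •
        gradMeasure (F.indicator 1) (Metric.ball x r)) (𝓝[>] 0) (𝓝 ν)}

/-- `F` is the representative of its Lebesgue class whose topological boundary is the closure of
the reduced boundary. -/
def IsNormalized (F : Set (Eucl n)) : Prop :=
  frontier F = closure (reducedBoundary F)

/-- `E` is outward minimizing in `Ω`: `E ⊆ Ω` and `P(E) ≤ P(F)` whenever `E ⊆ F ⊆ Ω`.
The perimeter is that in the whole space. -/
structure IsOutwardMinimizing (Ω E : Set (Eucl n)) : Prop where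
  measurable : NullMeasurableSet E
  subset : E ⊆ Ω
  perimeter_le : ∀ F : Set (Eucl n), NullMeasurableSet F → E ⊆ F → F ⊆ Ω →
    perimeter E ≤ perimeter F

/-- Strict mean convexity in the variational sense: `E` is outward minimizing in its open
`δ`-neighbourhood `{x | dist(x, E) < δ}` for some `δ > 0`. -/
def IsStrictlyMeanConvex (E : Set (Eucl n)) : Prop :=
  ∃ δ : ℝ, 0 < δ ∧ IsOutwardMinimizing (Metric.thickening δ E) E

/-- The functional `P(E) + (1/h) ∫_{E Δ F} dist(x, ∂F) dx`
(the distance to an empty boundary is `∞`). -/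
def functional (h : ℝ) (E F : Set (Eucl n)) : ℝ≥0∞ :=
  perimeter E + (∫⁻ x in E ∆ F, Metric.infEDist x (frontier F)) / ENNReal.ofReal h

/-- `E 0 = E₀, E 1, E 2, …` are obtained by the implicit time discretization with step size `h`:
each `E (k + 1)` minimizes `functional h · (E k)` among all measurable sets, and every `E k` is
the representative with `∂E = closure ∂*E`. -/
structure IsScheme (h : ℝ) (E₀ : Set (Eucl n)) (E : ℕ → Set (Eucl n)) : Prop where
  init : E 0 = E₀
  measurable : ∀ k, NullMeasurableSet (E k)
  normalized : ∀ k, IsNormalized (E k)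
  minimizer : ∀ k, ∀ G : Set (Eucl n), NullMeasurableSet G →
    functional h (E (k + 1)) (E k) ≤ functional h G (E k)

/-- The arrival time `u_h = h ∑_{k ≥ 0} χ_{E_k}`, as a function with values in `[0, ∞]`. -/
def arrivalTime (h : ℝ) (E : ℕ → Set (Eucl n)) (x : Eucl n) : ℝ≥0∞ :=
  ENNReal.ofReal h * ∑' k, (E k).indicator 1 x

/-- Uniform convergence of `[0, ∞]`-valued functions to a function with finite values. -/
def UniformlyConverges (v : ℕ → Eucl n → ℝ≥0∞) (u : Eucl n → ℝ≥0) : Prop :=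
  ∀ ε : ℝ≥0, 0 < ε → ∀ᶠ j in atTop, ∀ x, v j x ≤ u x + ε ∧ (u x : ℝ≥0∞) ≤ v j x + ε

end ATW

end

noncomputable section

namespace ATW

variable {n : ℕ}

/-! ### Calculus of the divergence -/

/-! Lower semicontinuity gives `tv U u ≤ liminf tv U (u_h)` on every open `U`, so everything reduces
to showing that no total mass is lost in the limit. That follows from a minimality property of the
arrival times: among functions which lie above `u_h` and vanish off `E₀`, `u_h` itself has the least
total variation (`isTvMinimal_arrivalTime`). If `u_h ≤ u + ε`, then `(u + ε) χ_{E₀}` is a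
competitor, and `tv u_h ≤ tv u + ε P(E₀)` (`IsTvMinimal.tv_le_add`). Hence the masses converge, and
with the lower semicontinuity on open sets a portmanteau argument gives `|Du_h| ⇀ |Du|`. The `L¹`
convergence is immediate, since everything lives on the bounded set `E₀`.

The minimality comes from mean convexity being inherited by every step. If `F = E_k` is outward
minimizing in the `δ`-neighbourhood `Ω` of `E₀`, then `E_{k+1} ⊆ F` up to null sets and `E_{k+1}` is
again outward minimizing in `Ω`. Both facts rest on submodularity of the perimeter, `P(E ∩ F) + P(E
∪ F) ≤ P(E) + P(F)`. So `u_h` has nested superlevel sets, each outward minimizing, and the coarea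
inequality compares them with the superlevel sets of a competitor.

Two points need more than submodularity. A minimizer could a priori leave `Ω`; a De Giorgi density
estimate excludes this for time steps below a threshold depending only on `E₀` and `δ`. Moreover the
penalty vanishes on `∂F`, which may have positive volume, so submodularity only gives `E \ F ⊆ ∂F`
almost everywhere; the same density estimate at a density point of `E \ F` contradicts the
normalization of `F`. Finally, finiteness of the arrival time forces extinction after finitely many
steps, so `u_h` is almost everywhere a finite sum.

The perimeter theory is developed from the supremum definition: mollification, cutting along level
sets, coarea, submodularity, isoperimetry, and the identity of `|Du|` with the total variation on
open sets. -/

lemma sum_coord_smul_single (x : Eucl n) : ∑ i, x i • EuclideanSpace.single i (1 : ℝ) = x := by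
  ext j
  simp [Finset.sum_apply, Pi.single_apply]

lemma continuous_divergence {ξ : Eucl n → Eucl n} (hξ : ContDiff ℝ 1 ξ) :
    Continuous (divergence ξ) := by
  have := hξ.continuous_fderiv (by simp)
  unfold divergence
  fun_prop

lemma divergence_eq_zero_of_notMem_tsupport {ξ : Eucl n → Eucl n} {x : Eucl n}
    (hx : x ∉ tsupport ξ) : divergence ξ x = 0 := by
  have : fderiv ℝ ξ x = 0 := by
    by_contra h
    exact hx (support_fderiv_subset ℝ h)
  simp [divergence, this]

lemma hasCompactSupport_divergence {ξ : Eucl n → Eucl n} (hc : HasCompactSupport ξ) :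
    HasCompactSupport (divergence ξ) :=
  HasCompactSupport.intro hc fun _ hx => divergence_eq_zero_of_notMem_tsupport hx

lemma integrable_divergence {ξ : Eucl n → Eucl n} (hξ : ContDiff ℝ 1 ξ)
    (hc : HasCompactSupport ξ) : Integrable (divergence ξ) :=
  (continuous_divergence hξ).integrable_of_hasCompactSupport (hasCompactSupport_divergence hc)

lemma exists_bound_divergence {ξ : Eucl n → Eucl n} (hξ : ContDiff ℝ 1 ξ)
    (hc : HasCompactSupport ξ) : ∃ C, ∀ x, ‖divergence ξ x‖ ≤ C :=
  (continuous_divergence hξ).bounded_above_of_compact_support (hasCompactSupport_divergence hc)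

lemma divergence_smul {ψ : Eucl n → ℝ} {ξ : Eucl n → Eucl n} (hψ : ContDiff ℝ 1 ψ)
    (hξ : ContDiff ℝ 1 ξ) (x : Eucl n) :
    divergence (fun y => ψ y • ξ y) x = ψ x * divergence ξ x + fderiv ℝ ψ x (ξ x) := by
  have h1 : fderiv ℝ ψ x (ξ x) = ∑ i, ξ x i * fderiv ℝ ψ x (EuclideanSpace.single i 1) := by
    conv_lhs => rw [← sum_coord_smul_single (ξ x)]
    simp
  rw [h1]
  unfold divergence
  rw [fderiv_fun_smul ((hψ.differentiable (by simp)) x) ((hξ.differentiable (by simp)) x),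
    Finset.mul_sum, ← Finset.sum_add_distrib]
  refine Finset.sum_congr rfl fun i _ => ?_
  simp
  ring

lemma divergence_add {ξ η : Eucl n → Eucl n} (hξ : ContDiff ℝ 1 ξ) (hη : ContDiff ℝ 1 η)
    (x : Eucl n) : divergence (fun y => ξ y + η y) x = divergence ξ x + divergence η x := by
  unfold divergence
  rw [fderiv_fun_add ((hξ.differentiable (by simp)) x) ((hη.differentiable (by simp)) x),
    ← Finset.sum_add_distrib]
  simp

lemma divergence_const_smul (c : ℝ) {ξ : Eucl n → Eucl n} (hξ : ContDiff ℝ 1 ξ)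
    (x : Eucl n) : divergence (fun y => c • ξ y) x = c * divergence ξ x := by
  rw [divergence_smul contDiff_const hξ]
  simp

lemma integral_divergence_eq_zero {ξ : Eucl n → Eucl n} (hξ : ContDiff ℝ 1 ξ)
    (hc : HasCompactSupport ξ) : ∫ x, divergence ξ x = 0 := by
  have hcoord : ∀ i, ContDiff ℝ 1 fun x => ξ x i := fun i => by fun_prop
  have hfd : ∀ i x, (fderiv ℝ ξ x (EuclideanSpace.single i 1)) i =
      fderiv ℝ (fun y => ξ y i) x (EuclideanSpace.single i 1) := by
    intro i x
    have := ((EuclideanSpace.proj i : Eucl n →L[ℝ] ℝ).hasFDerivAt.comp x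
      ((hξ.differentiable (by simp)) x).hasFDerivAt).fderiv
    change fderiv ℝ (fun y => ξ y i) x = _ at this
    rw [this]; rfl
  have hcs : ∀ i, HasCompactSupport fun x => ξ x i := fun i =>
    hc.comp_left (g := fun v : Eucl n => v i) (by simp)
  have hint : ∀ i, Integrable fun x =>
      fderiv ℝ (fun y => ξ y i) x (EuclideanSpace.single i 1) := by
    intro i
    refine Continuous.integrable_of_hasCompactSupport ?_ ?_
    · have := (hcoord i).continuous_fderiv (by simp)
      fun_prop
    · exact ((hcs i).fderiv ℝ).comp_left (g := fun L => L (EuclideanSpace.single i 1)) (by simp)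
  unfold divergence
  simp_rw [hfd]
  rw [integral_finsetSum _ fun i _ => hint i]
  refine Finset.sum_eq_zero fun i _ => ?_
  have := integral_mul_fderiv_eq_neg_fderiv_mul_of_integrable (μ := (volume : Measure (Eucl n)))
    (f := fun _ : Eucl n => (1 : ℝ)) (g := fun y => ξ y i) (v := EuclideanSpace.single i 1)
    (by simp) (by simpa using hint i)
    (by simpa using ((hcoord i).continuous.integrable_of_hasCompactSupport (hcs i)))
    (fun _ _ => differentiableAt_const _) (fun x _ => (hcoord i).differentiable (by simp) x)
  simpa using this

lemma integral_mul_divergence {f : Eucl n → ℝ} {ξ : Eucl n → Eucl n} (hf : ContDiff ℝ 1 f)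
    (hξ : ContDiff ℝ 1 ξ) (hc : HasCompactSupport ξ) :
    ∫ x, f x * divergence ξ x = - ∫ x, fderiv ℝ f x (ξ x) := by
  have h0 := integral_divergence_eq_zero (hf.smul hξ) (hc.smul_left (f := f))
  have h1 : ∀ x, divergence (f • ξ) x = f x * divergence ξ x + fderiv ℝ f x (ξ x) :=
    fun x => divergence_smul hf hξ x
  simp_rw [h1] at h0
  rw [integral_add] at h0
  · linarith
  · refine Continuous.integrable_of_hasCompactSupport ?_ ?_
    · exact hf.continuous.mul (continuous_divergence hξ)
    · exact (hasCompactSupport_divergence hc).mul_left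
  · refine Continuous.integrable_of_hasCompactSupport ?_ ?_
    · exact (hf.continuous_fderiv (by simp)).clm_apply hξ.continuous
    · exact HasCompactSupport.intro hc fun x hx => by simp [image_eq_zero_of_notMem_tsupport hx]

/-! ### The total variation -/

/-- The total variation of `v` in `U`: the supremum of `∫ v div ξ` over the fields
`ξ ∈ C¹_c(U; ℝⁿ)` with `‖ξ‖_∞ ≤ 1`. -/
def tv (U : Set (Eucl n)) (v : Eucl n → ℝ) : ℝ≥0∞ :=
  ⨆ (ξ : Eucl n → Eucl n) (_ : ContDiff ℝ 1 ξ) (_ : HasCompactSupport ξ) (_ : ∀ x, ‖ξ x‖ ≤ 1)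
    (_ : tsupport ξ ⊆ U), ENNReal.ofReal (∫ x, v x * divergence ξ x)

lemma ofReal_integral_le_tv {U : Set (Eucl n)} (v : Eucl n → ℝ) {ξ : Eucl n → Eucl n}
    (h1 : ContDiff ℝ 1 ξ) (h2 : HasCompactSupport ξ) (h3 : ∀ x, ‖ξ x‖ ≤ 1) (h4 : tsupport ξ ⊆ U) :
    ENNReal.ofReal (∫ x, v x * divergence ξ x) ≤ tv U v :=
  le_iSup_of_le ξ <| le_iSup_of_le h1 <| le_iSup_of_le h2 <| le_iSup_of_le h3 <|
    le_iSup_of_le h4 le_rfl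

lemma tv_le_iff {U : Set (Eucl n)} {v : Eucl n → ℝ} {C : ℝ≥0∞} : tv U v ≤ C ↔
    ∀ ξ : Eucl n → Eucl n, ContDiff ℝ 1 ξ → HasCompactSupport ξ → (∀ x, ‖ξ x‖ ≤ 1) →
      tsupport ξ ⊆ U → ENNReal.ofReal (∫ x, v x * divergence ξ x) ≤ C := by
  simp [tv, iSup_le_iff]

lemma tv_congr_ae {U : Set (Eucl n)} {v w : Eucl n → ℝ} (h : v =ᵐ[volume] w) :
    tv U v = tv U w := by
  have : ∀ ξ : Eucl n → Eucl n, ∫ x, v x * divergence ξ x = ∫ x, w x * divergence ξ x :=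
    fun ξ => integral_congr_ae (by filter_upwards [h] with x hx; rw [hx])
  simp [tv, this]

lemma integral_indicator_mul {E : Set (Eucl n)} (hE : NullMeasurableSet E) (g : Eucl n → ℝ) :
    ∫ x, E.indicator 1 x * g x = ∫ x in E, g x := by
  rw [← integral_indicator₀ hE]
  congr 1
  ext x
  by_cases hx : x ∈ E <;> simp [hx]

lemma perimeter_eq_tv {E : Set (Eucl n)} (hE : NullMeasurableSet E) :
    perimeter E = tv univ (E.indicator 1) := by
  simp [perimeter, tv, integral_indicator_mul hE]

lemma perimeter_congr_ae {E F : Set (Eucl n)} (h : E =ᵐ[volume] F) :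
    perimeter E = perimeter F := by
  have : ∀ ξ : Eucl n → Eucl n, ∫ x in E, divergence ξ x = ∫ x in F, divergence ξ x :=
    fun ξ => setIntegral_congr_set h
  simp [perimeter, this]

lemma ofReal_integral_le_perimeter (E : Set (Eucl n)) {ξ : Eucl n → Eucl n}
    (h1 : ContDiff ℝ 1 ξ) (h2 : HasCompactSupport ξ) (h3 : ∀ x, ‖ξ x‖ ≤ 1) :
    ENNReal.ofReal (∫ x in E, divergence ξ x) ≤ perimeter E :=
  le_iSup_of_le ξ <| le_iSup_of_le h1 <| le_iSup_of_le h2 <| le_iSup_of_le h3 le_rfl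

lemma perimeter_le_iff {E : Set (Eucl n)} {C : ℝ≥0∞} : perimeter E ≤ C ↔
    ∀ ξ : Eucl n → Eucl n, ContDiff ℝ 1 ξ → HasCompactSupport ξ → (∀ x, ‖ξ x‖ ≤ 1) →
      ENNReal.ofReal (∫ x in E, divergence ξ x) ≤ C := by
  simp [perimeter, iSup_le_iff]

@[simp] lemma perimeter_empty : perimeter (∅ : Set (Eucl n)) = 0 := by
  simp [perimeter]

lemma perimeter_compl_le {E : Set (Eucl n)} (hE : NullMeasurableSet E) :
    perimeter Eᶜ ≤ perimeter E := by
  rw [perimeter_le_iff]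
  intro ξ h1 h2 h3
  have h := integral_add_compl₀ hE (integrable_divergence h1 h2)
  rw [integral_divergence_eq_zero h1 h2] at h
  refine le_trans (le_of_eq ?_) (ofReal_integral_le_perimeter E h1.neg (h2.comp_left
    (g := fun v => -v) (by simp)) (by simpa using h3))
  congr 1
  have h4 : ∀ x, divergence (fun x => -ξ x) x = - divergence ξ x := fun x => by
    simpa using divergence_const_smul (-1) h1 x
  simp_rw [h4]
  rw [integral_neg]
  linarith

lemma perimeter_compl {E : Set (Eucl n)} (hE : NullMeasurableSet E) :
    perimeter Eᶜ = perimeter E :=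
  le_antisymm (perimeter_compl_le hE) (by simpa using perimeter_compl_le hE.compl)

@[simp] lemma perimeter_univ : perimeter (univ : Set (Eucl n)) = 0 := by
  rw [← compl_empty, perimeter_compl nullMeasurableSet_empty, perimeter_empty]

lemma integrable_mul_divergence {v : Eucl n → ℝ} (hv : LocallyIntegrable v)
    {ξ : Eucl n → Eucl n} (h1 : ContDiff ℝ 1 ξ) (h2 : HasCompactSupport ξ) :
    Integrable fun x => v x * divergence ξ x :=
  hv.integrable_smul_right_of_hasCompactSupport (continuous_divergence h1)
    (hasCompactSupport_divergence h2)

lemma tv_add_le {U : Set (Eucl n)} {v w : Eucl n → ℝ} (hv : LocallyIntegrable v)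
    (hw : LocallyIntegrable w) : tv U (v + w) ≤ tv U v + tv U w := by
  refine tv_le_iff.2 fun ξ h1 h2 h3 h4 => ?_
  have : ∫ x, (v + w) x * divergence ξ x =
      (∫ x, v x * divergence ξ x) + ∫ x, w x * divergence ξ x := by
    rw [← integral_add (integrable_mul_divergence hv h1 h2) (integrable_mul_divergence hw h1 h2)]
    simp [add_mul]
  rw [this]
  exact ENNReal.ofReal_add_le.trans (add_le_add (ofReal_integral_le_tv v h1 h2 h3 h4)
    (ofReal_integral_le_tv w h1 h2 h3 h4))

lemma tv_zero (U : Set (Eucl n)) : tv U 0 = 0 := by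
  simp [tv]

lemma tv_const_mul_le {U : Set (Eucl n)} {c : ℝ} (hc : 0 ≤ c) (v : Eucl n → ℝ) :
    tv U (fun x => c * v x) ≤ ENNReal.ofReal c * tv U v := by
  refine tv_le_iff.2 fun ξ h1 h2 h3 h4 => ?_
  simp_rw [mul_assoc]
  rw [integral_const_mul, ENNReal.ofReal_mul hc]
  gcongr
  exact ofReal_integral_le_tv v h1 h2 h3 h4

lemma tv_sum_le {U : Set (Eucl n)} {ι : Type*} (s : Finset ι) (v : ι → Eucl n → ℝ)
    (hv : ∀ i ∈ s, LocallyIntegrable (v i)) :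
    tv U (∑ i ∈ s, v i) ≤ ∑ i ∈ s, tv U (v i) := by
  classical
  induction s using Finset.induction_on with
  | empty => simp [tv_zero]
  | insert a s ha ih =>
    rw [Finset.sum_insert ha, Finset.sum_insert ha]
    refine (tv_add_le (hv a (by simp)) ?_).trans
      (add_le_add le_rfl (ih fun i hi => hv i (by simp [hi])))
    exact locallyIntegrable_finsetSum' _ fun i hi => hv i (by simp [hi])

/-- Lower semicontinuity of the total variation. -/
lemma tv_le_liminf {U : Set (Eucl n)} {v : ℕ → Eucl n → ℝ} {w : Eucl n → ℝ}
    (h : ∀ ξ : Eucl n → Eucl n, ContDiff ℝ 1 ξ → HasCompactSupport ξ →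
      Tendsto (fun j => ∫ x, v j x * divergence ξ x) atTop (𝓝 (∫ x, w x * divergence ξ x))) :
    tv U w ≤ liminf (fun j => tv U (v j)) atTop := by
  refine tv_le_iff.2 fun ξ h1 h2 h3 h4 => ?_
  rw [← ((ENNReal.continuous_ofReal.tendsto _).comp (h ξ h1 h2)).liminf_eq]
  exact liminf_le_liminf (Eventually.of_forall fun j =>
    ofReal_integral_le_tv (v j) h1 h2 h3 h4)

lemma tendsto_integral_mul_divergence {v : ℕ → Eucl n → ℝ} {w : Eucl n → ℝ} {M : ℝ}
    (hm : ∀ j, AEStronglyMeasurable (v j)) (hb : ∀ j x, |v j x| ≤ M)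
    (hae : ∀ᵐ x, Tendsto (fun j => v j x) atTop (𝓝 (w x)))
    {ξ : Eucl n → Eucl n} (h1 : ContDiff ℝ 1 ξ) (h2 : HasCompactSupport ξ) :
    Tendsto (fun j => ∫ x, v j x * divergence ξ x) atTop (𝓝 (∫ x, w x * divergence ξ x)) := by
  refine tendsto_integral_of_dominated_convergence (fun x => M * ‖divergence ξ x‖)
    (fun j => (hm j).mul (continuous_divergence h1).aestronglyMeasurable)
    ((integrable_divergence h1 h2).norm.const_mul M) (fun j => Eventually.of_forall fun x => ?_) ?_
  · rw [norm_mul, Real.norm_eq_abs]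
    gcongr
    exact hb j x
  · filter_upwards [hae] with x hx
    exact hx.mul_const _

/-! ### Cutting a set along the level sets of a function -/

/-- The sum of two suprema is tested on pairs of fields. `ENNReal.ofReal` is additive only on
nonnegative numbers, so a field with negative integral is first replaced by zero, which does not
change the truncated value. -/
lemma perimeter_add_perimeter_le {A B : Set (Eucl n)} {C : ℝ≥0∞}
    (h : ∀ ξ η : Eucl n → Eucl n, ContDiff ℝ 1 ξ → HasCompactSupport ξ → (∀ x, ‖ξ x‖ ≤ 1) →
      ContDiff ℝ 1 η → HasCompactSupport η → (∀ x, ‖η x‖ ≤ 1) →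
      ENNReal.ofReal ((∫ x in A, divergence ξ x) + ∫ x in B, divergence η x) ≤ C) :
    perimeter A + perimeter B ≤ C := by
  let T := {ξ : Eucl n → Eucl n // ContDiff ℝ 1 ξ ∧ HasCompactSupport ξ ∧ ∀ x, ‖ξ x‖ ≤ 1}
  have hT : ∀ E : Set (Eucl n),
      perimeter E = ⨆ ξ : T, ENNReal.ofReal (∫ x in E, divergence ξ.1 x) := by
    intro E
    simp only [perimeter, T, iSup_subtype, iSup_and]
  let z : T := ⟨0, contDiff_const, HasCompactSupport.zero, by simp⟩
  have hz : ∀ E : Set (Eucl n), ∫ x in E, divergence z.1 x = 0 := by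
    intro E
    simp [z, divergence]
  have : Nonempty T := ⟨z⟩
  have hpos : ∀ ξ : T, ∃ ξ' : T, ENNReal.ofReal (∫ x in A, divergence ξ.1 x) =
      ENNReal.ofReal (∫ x in A, divergence ξ'.1 x) ∧ 0 ≤ ∫ x in A, divergence ξ'.1 x := by
    intro ξ
    rcases le_total 0 (∫ x in A, divergence ξ.1 x) with h0 | h0
    · exact ⟨ξ, rfl, h0⟩
    · exact ⟨z, by simp [hz, ENNReal.ofReal_of_nonpos h0], by simp [hz]⟩
  have hpos' : ∀ ξ : T, ∃ ξ' : T, ENNReal.ofReal (∫ x in B, divergence ξ.1 x) =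
      ENNReal.ofReal (∫ x in B, divergence ξ'.1 x) ∧ 0 ≤ ∫ x in B, divergence ξ'.1 x := by
    intro ξ
    rcases le_total 0 (∫ x in B, divergence ξ.1 x) with h0 | h0
    · exact ⟨ξ, rfl, h0⟩
    · exact ⟨z, by simp [hz, ENNReal.ofReal_of_nonpos h0], by simp [hz]⟩
  rw [hT, hT]
  refine ENNReal.iSup_add_iSup_le fun ξ η => ?_
  obtain ⟨ξ', h1, h2⟩ := hpos ξ
  obtain ⟨η', h3, h4⟩ := hpos' η
  rw [h1, h3, ← ENNReal.ofReal_add h2 h4]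
  exact h _ _ ξ'.2.1 ξ'.2.2.1 ξ'.2.2.2 η'.2.1 η'.2.2.1 η'.2.2.2

lemma deriv_smoothTransition_nonneg (y : ℝ) : 0 ≤ deriv Real.smoothTransition y :=
  Real.smoothTransition.monotone.deriv_nonneg

lemma deriv_smoothTransition_of_neg {y : ℝ} (hy : y < 0) : deriv Real.smoothTransition y = 0 := by
  have : Real.smoothTransition =ᶠ[𝓝 y] fun _ => 0 := by
    filter_upwards [gt_mem_nhds hy] with z hz using Real.smoothTransition.zero_of_nonpos hz.le
  rw [this.deriv_eq, deriv_const]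

lemma deriv_smoothTransition_of_one_lt {y : ℝ} (hy : 1 < y) :
    deriv Real.smoothTransition y = 0 := by
  have : Real.smoothTransition =ᶠ[𝓝 y] fun _ => 1 := by
    filter_upwards [lt_mem_nhds hy] with z hz using Real.smoothTransition.one_of_one_le hz.le
  rw [this.deriv_eq, deriv_const]

lemma contDiff_smoothTransition : ContDiff ℝ 1 Real.smoothTransition :=
  Real.smoothTransition.contDiff (n := 1)

lemma continuous_deriv_smoothTransition : Continuous (deriv Real.smoothTransition) :=
  contDiff_smoothTransition.continuous_deriv (by simp)

/-- In `t` the integrand is the derivative of `-smoothTransition ((k + 1) (s - t))`: an approximate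
Dirac mass of total one supported in `[s - 1/(k+1), s]`. If `s ≤ a` the support misses `(a, ∞)`. -/
lemma lintegral_deriv_smoothTransition_le (k : ℕ) (s a : ℝ) :
    ∫⁻ t in Ioi a, ENNReal.ofReal ((k + 1) * deriv Real.smoothTransition ((k + 1) * (s - t))) ≤
      (Ioi a).indicator 1 s := by
  set g : ℝ → ℝ := fun t => (k + 1) * deriv Real.smoothTransition ((k + 1) * (s - t)) with hg
  have hk : (0 : ℝ) < k + 1 := by positivity
  have hgn : ∀ t, 0 ≤ g t := fun t => mul_nonneg hk.le (deriv_smoothTransition_nonneg _)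
  by_cases hs : s ∈ Ioi a
  · have hcont : Continuous g := by
      have := continuous_deriv_smoothTransition
      fun_prop
    have hzero : ∀ t, t ∉ Ioc (s - 2) (s + 1) → g t = 0 := by
      intro t ht
      simp only [mem_Ioc, not_and_or, not_lt, not_le] at ht
      rcases ht with ht | ht
      · have : deriv Real.smoothTransition ((k + 1) * (s - t)) = 0 :=
          deriv_smoothTransition_of_one_lt (by nlinarith)
        simp [hg, this]
      · have : deriv Real.smoothTransition ((k + 1) * (s - t)) = 0 :=
          deriv_smoothTransition_of_neg (by nlinarith)
        simp [hg, this]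
    rw [indicator_of_mem hs, Pi.one_apply]
    calc ∫⁻ t in Ioi a, ENNReal.ofReal (g t) ≤ ∫⁻ t, ENNReal.ofReal (g t) :=
          setLIntegral_le_lintegral _ _
      _ = ∫⁻ t in Ioc (s - 2) (s + 1), ENNReal.ofReal (g t) := by
          rw [← lintegral_indicator measurableSet_Ioc]
          congr 1
          ext t
          by_cases ht : t ∈ Ioc (s - 2) (s + 1)
          · simp [ht]
          · rw [indicator_of_notMem ht, hzero t ht, ENNReal.ofReal_zero]
      _ = ENNReal.ofReal (∫ t in Ioc (s - 2) (s + 1), g t) := by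
          rw [ofReal_integral_eq_lintegral_ofReal]
          · exact (hcont.integrableOn_Icc (a := s - 2) (b := s + 1)).mono_set Ioc_subset_Icc_self
          · exact Eventually.of_forall hgn
      _ = 1 := by
          rw [← intervalIntegral.integral_of_le (by linarith)]
          have hd : ∀ t ∈ uIcc (s - 2) (s + 1),
              HasDerivAt (fun t => - Real.smoothTransition ((k + 1) * (s - t))) (g t) t := by
            intro t _
            have h1 : HasDerivAt (fun t : ℝ => ((k : ℝ) + 1) * (s - t)) (-(k + 1)) t := by
              simpa using ((hasDerivAt_id t).const_sub s).const_mul ((k : ℝ) + 1)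
            have h2 := ((contDiff_smoothTransition.differentiable (by simp)) _).hasDerivAt.comp t h1
            have h3 : HasDerivAt (fun t => - Real.smoothTransition ((k + 1) * (s - t)))
                (-(deriv Real.smoothTransition ((k + 1) * (s - t)) * -(k + 1))) t := h2.neg
            rwa [mul_neg, neg_neg, mul_comm] at h3
          rw [intervalIntegral.integral_eq_sub_of_hasDerivAt hd (hcont.intervalIntegrable _ _)]
          rw [Real.smoothTransition.zero_of_nonpos, Real.smoothTransition.one_of_one_le]
          · simp
          · nlinarith
          · nlinarith
  · rw [indicator_of_notMem hs, nonpos_iff_eq_zero]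
    rw [setLIntegral_congr_fun (g := fun _ => 0) measurableSet_Ioi, lintegral_zero]
    intro t ht
    have : deriv Real.smoothTransition ((k + 1) * (s - t)) = 0 :=
      deriv_smoothTransition_of_neg (by
        simp only [mem_Ioi, not_lt] at hs ht
        nlinarith)
    simp [this]

/-- Cutting a set along the superlevel sets of a function: on average the cut at level `t` costs
at most twice the integral of the gradient. -/
lemma exists_perimeter_cut_le {f : Eucl n → ℝ} (hf : ContDiff ℝ 1 f) (E : Set (Eucl n)) :
    ∃ G : ℝ → ℝ≥0∞, Measurable G ∧
      (∀ t, perimeter (E ∩ {x | t < f x}) + perimeter (E \ {x | t < f x}) ≤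
        perimeter E + G t) ∧
      ∀ a, ∫⁻ t in Ioi a, G t ≤ 2 * ∫⁻ x in E ∩ {x | a < f x}, ‖fderiv ℝ f x‖ₑ := by
  set p : ℕ → ℝ → Eucl n → ℝ := fun k t x =>
    (k + 1) * deriv Real.smoothTransition ((k + 1) * (f x - t)) with hp
  have hpn : ∀ k t x, 0 ≤ p k t x := fun k t x =>
    mul_nonneg (by positivity) (deriv_smoothTransition_nonneg _)
  have hfc := hf.continuous
  have hdfc := hf.continuous_fderiv (by simp)
  have hpc : ∀ k, Continuous fun z : ℝ × Eucl n => p k z.1 z.2 := by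
    intro k
    have := continuous_deriv_smoothTransition
    fun_prop
  have hjm : ∀ k, Measurable fun z : ℝ × Eucl n =>
      2 * (ENNReal.ofReal (p k z.1 z.2) * ‖fderiv ℝ f z.2‖ₑ) := by
    intro k
    have h1 := (hpc k).measurable.ennreal_ofReal
    have h2 : Measurable fun z : ℝ × Eucl n => ‖fderiv ℝ f z.2‖ₑ :=
      (hdfc.comp continuous_snd).measurable.enorm
    exact (h1.mul h2).const_mul 2
  set g : ℕ → ℝ → ℝ≥0∞ := fun k t =>
    ∫⁻ x in E, 2 * (ENNReal.ofReal (p k t x) * ‖fderiv ℝ f x‖ₑ) with hg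
  have hgm : ∀ k, Measurable (g k) := fun k => (hjm k).lintegral_prod_right
  -- The majorant is a liminf of integrals depending measurably on `t`, so measurability of the
  -- perimeter of the cut sets in `t` is never needed.
  refine ⟨fun t => liminf (fun k => g k t) atTop, Measurable.liminf hgm, fun t => ?_, fun a => ?_⟩
  · refine perimeter_add_perimeter_le fun ξ η hξ hξc hξ1 hη hηc hη1 => ?_
    set ψ : ℕ → Eucl n → ℝ := fun k x => Real.smoothTransition ((k + 1) * (f x - t)) with hψ
    have hψd : ∀ k, ContDiff ℝ 1 (ψ k) := fun k =>
      contDiff_smoothTransition.comp (contDiff_const.mul (hf.sub contDiff_const))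
    have hψ' : ∀ k x v, fderiv ℝ (ψ k) x v = p k t x * fderiv ℝ f x v := by
      intro k x v
      have h1 : HasFDerivAt (fun x => ((k : ℝ) + 1) * (f x - t)) (((k : ℝ) + 1) • fderiv ℝ f x) x :=
        (((hf.differentiable (by simp)) x).hasFDerivAt.sub_const t).const_mul _
      have h2 := ((contDiff_smoothTransition.differentiable (by simp)) _).hasDerivAt.comp_hasFDerivAt
        x h1
      change HasFDerivAt (ψ k) _ x at h2
      rw [h2.fderiv]
      simp [hp]
      ring
    have hψ0 : ∀ k x, 0 ≤ ψ k x := fun k x => Real.smoothTransition.nonneg _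
    have hψ1 : ∀ k x, ψ k x ≤ 1 := fun k x => Real.smoothTransition.le_one _
    -- The two fields are glued by a smooth approximation of the indicator of the superlevel set. A
    -- convex combination stays in the unit ball, so `ζ k` is admissible for `E`; its divergence
    -- differs from the glued divergences only by `p k t * fderiv ℝ f x (ξ x - η x)`, at most `2 p
    -- |∇f|` in size.
    set ζ : ℕ → Eucl n → Eucl n := fun k x => ψ k x • ξ x + (1 - ψ k x) • η x with hζ
    have hζd : ∀ k, ContDiff ℝ 1 (ζ k) := fun k =>
      ((hψd k).smul hξ).add ((contDiff_const.sub (hψd k)).smul hη)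
    have hζc : ∀ k, HasCompactSupport (ζ k) := fun k =>
      (hξc.smul_left (f := ψ k)).add (hηc.smul_left (f := fun x => 1 - ψ k x))
    have hζ1 : ∀ k x, ‖ζ k x‖ ≤ 1 := by
      intro k x
      refine (norm_add_le _ _).trans ?_
      rw [norm_smul, norm_smul, Real.norm_of_nonneg (hψ0 k x),
        Real.norm_of_nonneg (by linarith [hψ1 k x])]
      nlinarith [hψ0 k x, hψ1 k x, hξ1 x, hη1 x]
    have hdiv : ∀ k x, ψ k x * divergence ξ x + (1 - ψ k x) * divergence η x =
        divergence (ζ k) x - p k t x * fderiv ℝ f x (ξ x - η x) := by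
      intro k x
      have h1 : ContDiff ℝ 1 fun y => 1 - ψ k y := contDiff_const.sub (hψd k)
      have h2 := divergence_add (ξ := fun y => ψ k y • ξ y) (η := fun y => (1 - ψ k y) • η y)
        ((hψd k).smul hξ) (h1.smul hη) x
      rw [divergence_smul (hψd k) hξ, divergence_smul h1 hη, hψ', fderiv_const_sub, neg_apply,
        hψ'] at h2
      rw [map_sub]
      change _ = divergence (fun y => ψ k y • ξ y + (1 - ψ k y) • η y) x - _
      rw [h2]
      ring
    have hlim : Tendsto
        (fun k => ∫ x in E, ψ k x * divergence ξ x + (1 - ψ k x) * divergence η x) atTop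
        (𝓝 ((∫ x in E ∩ {x | t < f x}, divergence ξ x) +
          ∫ x in E \ {x | t < f x}, divergence η x)) := by
      have hmeas : MeasurableSet {x | t < f x} := measurableSet_lt measurable_const hfc.measurable
      have hone : ∀ x, t < f x → Tendsto (fun k => ψ k x) atTop (𝓝 1) := by
        intro x hx
        obtain ⟨N, hN⟩ := exists_nat_gt (1 / (f x - t))
        refine tendsto_const_nhds.congr' ?_
        filter_upwards [eventually_ge_atTop N] with k hk
        refine (Real.smoothTransition.one_of_one_le ?_).symm
        have h3 : (N : ℝ) ≤ k := by exact_mod_cast hk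
        rw [div_lt_iff₀ (by linarith)] at hN
        nlinarith
      have heq : (∫ x in E ∩ {x | t < f x}, divergence ξ x) +
          ∫ x in E \ {x | t < f x}, divergence η x =
          ∫ x in E, ({x | t < f x}.indicator (divergence ξ) x +
            {x | t < f x}ᶜ.indicator (divergence η) x) := by
        rw [integral_add, setIntegral_indicator hmeas, setIntegral_indicator hmeas.compl]
        · rfl
        · exact ((integrable_divergence hξ hξc).indicator hmeas).integrableOn
        · exact ((integrable_divergence hη hηc).indicator hmeas.compl).integrableOn
      rw [heq]
      refine tendsto_integral_of_dominated_convergence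
        (fun x => ‖divergence ξ x‖ + ‖divergence η x‖) (fun k => ?_) ?_ (fun k => ?_) ?_
      · refine Continuous.aestronglyMeasurable ?_
        have h1 := (hψd k).continuous
        have h2 := continuous_divergence hξ
        have h3 := continuous_divergence hη
        fun_prop
      · exact ((integrable_divergence hξ hξc).norm.add
          (integrable_divergence hη hηc).norm).integrableOn
      · refine Eventually.of_forall fun x => (norm_add_le _ _).trans ?_
        rw [norm_mul, norm_mul, Real.norm_of_nonneg (hψ0 k x),
          Real.norm_of_nonneg (by linarith [hψ1 k x] : 0 ≤ 1 - ψ k x)]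
        nlinarith [hψ0 k x, hψ1 k x, norm_nonneg (divergence ξ x), norm_nonneg (divergence η x)]
      · refine Eventually.of_forall fun x => ?_
        by_cases hx : t < f x
        · have h1 := hone x hx
          have h2 := (h1.mul_const (divergence ξ x)).add
            ((tendsto_const_nhds (x := (1 : ℝ)).sub h1).mul_const (divergence η x))
          simpa [hx] using h2
        · have h1 : ∀ k, ψ k x = 0 := by
            intro k
            refine Real.smoothTransition.zero_of_nonpos ?_
            have : (0 : ℝ) < k + 1 := by positivity
            nlinarith [not_lt.1 hx]
          simp [hx, h1]
    have hbound : ∀ k, ENNReal.ofReal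
        (∫ x in E, ψ k x * divergence ξ x + (1 - ψ k x) * divergence η x) ≤
        perimeter E + g k t := by
      intro k
      simp_rw [hdiv k]
      have hcint : Integrable fun x => p k t x * fderiv ℝ f x (ξ x - η x) := by
        refine Continuous.integrable_of_hasCompactSupport ?_ ?_
        · have h1 : Continuous (p k t) := (hpc k).comp (Continuous.prodMk_right t)
          exact h1.mul (hdfc.clm_apply (hξ.continuous.sub hη.continuous))
        · have : HasCompactSupport fun x => ξ x - η x := hξc.sub hηc
          refine HasCompactSupport.intro this fun x hx => ?_
          have h0 : (fun x => ξ x - η x) x = 0 := 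
            image_eq_zero_of_notMem_tsupport (f := fun x => ξ x - η x) hx
          dsimp only at h0
          rw [h0, map_zero, mul_zero]
      rw [integral_sub (integrable_divergence (hζd k) (hζc k)).integrableOn hcint.integrableOn,
        sub_eq_add_neg]
      refine ENNReal.ofReal_add_le.trans (add_le_add
        (ofReal_integral_le_perimeter E (hζd k) (hζc k) (hζ1 k)) ?_)
      calc ENNReal.ofReal (-∫ x in E, p k t x * fderiv ℝ f x (ξ x - η x))
          ≤ ‖∫ x in E, p k t x * fderiv ℝ f x (ξ x - η x)‖ₑ := by
            rw [← ofReal_norm]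
            exact ENNReal.ofReal_le_ofReal (neg_le_abs _)
        _ ≤ ∫⁻ x in E, ‖p k t x * fderiv ℝ f x (ξ x - η x)‖ₑ :=
            enorm_integral_le_lintegral_enorm _
        _ ≤ g k t := by
            refine lintegral_mono fun x => ?_
            rw [enorm_mul, Real.enorm_of_nonneg (hpn k t x), mul_left_comm]
            gcongr
            rw [mul_comm]
            refine (ContinuousLinearMap.le_opENorm _ _).trans ?_
            gcongr
            rw [← ofReal_norm]
            refine (ENNReal.ofReal_le_ofReal ((norm_sub_le _ _).trans
              (by linarith [hξ1 x, hη1 x] : _ ≤ (2 : ℝ)))).trans (by simp)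
    by_cases hP : perimeter E = ∞
    · simp [hP]
    rw [← tsub_le_iff_left]
    have h1 := ((ENNReal.continuous_ofReal.tendsto _).comp hlim)
    have h2 := ENNReal.Tendsto.sub h1 (tendsto_const_nhds (x := perimeter E)) (Or.inr hP)
    rw [← h2.liminf_eq]
    refine liminf_le_liminf (Eventually.of_forall fun k => ?_)
    rw [tsub_le_iff_left]
    exact hbound k
  · have hmeas : MeasurableSet {x | a < f x} := measurableSet_lt measurable_const hfc.measurable
    -- Fatou, then Tonelli: for fixed `x` the integral of `p k t x` over `t > a` is at most one, and
    -- vanishes unless `a < f x`.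
    refine (lintegral_liminf_le hgm).trans ?_
    refine liminf_le_of_le (by isBoundedDefault) fun b hb => ?_
    obtain ⟨k, hk⟩ := hb.exists
    refine hk.trans ?_
    rw [hg]
    dsimp only
    rw [lintegral_lintegral_swap (hjm k).aemeasurable]
    rw [inter_comm, ← Measure.restrict_restrict hmeas, ← lintegral_const_mul' _ _ (by simp),
      ← lintegral_indicator hmeas]
    refine lintegral_mono fun x => ?_
    have hm : Measurable fun t => ENNReal.ofReal (p k t x) :=
      ((hpc k).comp (Continuous.prodMk_left x)).measurable.ennreal_ofReal
    rw [lintegral_const_mul _ (hm.mul_const _), lintegral_mul_const _ hm]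
    have h3 := lintegral_deriv_smoothTransition_le k (f x) a
    by_cases hx : a < f x
    · simp only [indicator, mem_ofPred_eq, hx, if_true, mem_Ioi, Pi.one_apply] at h3 ⊢
      gcongr
      calc _ ≤ 1 * ‖fderiv ℝ f x‖ₑ := by gcongr
        _ = _ := one_mul _
    · simp only [indicator, mem_ofPred_eq, hx, if_false, mem_Ioi] at h3 ⊢
      rw [nonpos_iff_eq_zero] at h3
      change 2 * ((∫⁻ t in Ioi a, ENNReal.ofReal ((k + 1) *
        deriv Real.smoothTransition ((k + 1) * (f x - t)))) * _) ≤ 0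
      rw [h3]
      simp

/-! ### Smooth approximation and the coarea inequality -/

lemma hasCompactSupport_of_norm_lt {F : Type*} [Zero F] {f : Eucl n → F} {R : ℝ}
    (h : ∀ x, R < ‖x‖ → f x = 0) : HasCompactSupport f :=
  HasCompactSupport.intro (isCompact_closedBall (0 : Eucl n) R) fun x hx => h x (by simpa using hx)

lemma norm_gradient (w : Eucl n → ℝ) (x : Eucl n) : ‖gradient w x‖ = ‖fderiv ℝ w x‖ := by
  simp [gradient]

lemma contDiff_gradient {w : Eucl n → ℝ} (hw : ContDiff ℝ 2 w) : ContDiff ℝ 1 (gradient w) := by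
  have : ContDiff ℝ 1 (fderiv ℝ w) := hw.fderiv_right (by norm_num)
  exact (InnerProductSpace.toDual ℝ (Eucl n)).symm.toContinuousLinearEquiv.contDiff.comp this

lemma fderiv_apply_gradient (w : Eucl n → ℝ) (x : Eucl n) :
    fderiv ℝ w x (gradient w x) = ‖fderiv ℝ w x‖ ^ 2 := by
  have h : fderiv ℝ w x = InnerProductSpace.toDual ℝ (Eucl n) (gradient w x) := by
    simp [gradient]
  conv_lhs => rw [h]
  rw [InnerProductSpace.toDual_apply_apply, real_inner_self_eq_norm_sq, norm_gradient]

/-- For smooth functions the total variation dominates the integral of the gradient. -/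
lemma lintegral_fderiv_le_tv {w : Eucl n → ℝ} (hw : ContDiff ℝ 2 w) (hc : HasCompactSupport w) :
    ∫⁻ x, ‖fderiv ℝ w x‖ₑ ≤ tv univ w := by
  have hg := contDiff_gradient hw
  have hw1 : ContDiff ℝ 1 w := hw.of_le (by norm_num)
  have hdc := hw1.continuous_fderiv (by simp)
  -- Regularized length of the gradient: `-∇w / s k` is a `C¹` field of norm at most one, even at
  -- critical points, and tests the total variation almost optimally.
  set s : ℕ → Eucl n → ℝ := fun k x => √(‖gradient w x‖ ^ 2 + (1 / ((k : ℝ) + 1)) ^ 2) with hs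
  have hk : ∀ k : ℕ, (0 : ℝ) < 1 / ((k : ℝ) + 1) := fun k => by positivity
  have hspos : ∀ k x, 0 < s k x := fun k x => Real.sqrt_pos.2 (by have := hk k; positivity)
  have hsge : ∀ k x, ‖fderiv ℝ w x‖ ≤ s k x := by
    intro k x
    rw [← norm_gradient]
    exact Real.le_sqrt_of_sq_le (by have := hk k; nlinarith)
  have hsd : ∀ k, ContDiff ℝ 1 (s k) := fun k =>
    ((hg.norm_sq ℝ).add contDiff_const).sqrt fun x => by have := hk k; positivity
  have hlim : ∀ x, Tendsto (fun k => s k x) atTop (𝓝 ‖fderiv ℝ w x‖) := by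
    intro x
    have h1 := (tendsto_one_div_add_atTop_nhds_zero_nat (𝕜 := ℝ)).pow 2
    have h2 := ((Real.continuous_sqrt.tendsto _).comp
      (h1.const_add (‖gradient w x‖ ^ 2)))
    simpa [hs, norm_gradient, Function.comp_def] using h2
  set q : ℕ → Eucl n → ℝ := fun k x => (s k x)⁻¹ * ‖fderiv ℝ w x‖ ^ 2 with hq
  have hqlim : ∀ x, Tendsto (fun k => q k x) atTop (𝓝 ‖fderiv ℝ w x‖) := by
    intro x
    by_cases h0 : ‖fderiv ℝ w x‖ = 0
    · simp [hq, h0]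
    · have := ((hlim x).inv₀ h0).mul_const (‖fderiv ℝ w x‖ ^ 2)
      rw [show ‖fderiv ℝ w x‖⁻¹ * ‖fderiv ℝ w x‖ ^ 2 = ‖fderiv ℝ w x‖ by field_simp] at this
      exact this
  have hqc : ∀ k, Continuous (q k) := fun k =>
    (((hsd k).continuous).inv₀ fun x => (hspos k x).ne').mul (hdc.norm.pow 2)
  have hqn : ∀ k x, 0 ≤ q k x := fun k x =>
    mul_nonneg (inv_nonneg.2 (hspos k x).le) (sq_nonneg _)
  have hqcs : ∀ k, HasCompactSupport (q k) := fun k =>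
    HasCompactSupport.intro (hc.fderiv ℝ) fun x hx => by
      simp [hq, image_eq_zero_of_notMem_tsupport hx]
  have hbound : ∀ k, ∫⁻ x, ENNReal.ofReal (q k x) ≤ tv univ w := by
    intro k
    have hcs : HasCompactSupport fun x => -((s k x)⁻¹ • gradient w x) :=
      HasCompactSupport.intro (hc.fderiv ℝ) fun x hx => by
        simp [gradient, image_eq_zero_of_notMem_tsupport hx]
    have hcd : ContDiff ℝ 1 fun x => -((s k x)⁻¹ • gradient w x) :=
      (((hsd k).inv fun x => (hspos k x).ne').smul hg).neg
    have h := ofReal_integral_le_tv (U := univ) w hcd hcs (fun x => ?_) (subset_univ _)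
    · rw [integral_mul_divergence hw1 hcd hcs] at h
      rw [← ofReal_integral_eq_lintegral_ofReal
        ((hqc k).integrable_of_hasCompactSupport (hqcs k)) (Eventually.of_forall (hqn k))]
      convert h using 2
      rw [← integral_neg]
      congr 1
      ext x
      simp [hq, fderiv_apply_gradient]
    · rw [norm_neg, norm_smul, norm_inv, Real.norm_of_nonneg (hspos k x).le, norm_gradient]
      exact inv_mul_le_one_of_le₀ (hsge k x) (hspos k x).le
  calc ∫⁻ x, ‖fderiv ℝ w x‖ₑ
      = ∫⁻ x, liminf (fun k => ENNReal.ofReal (q k x)) atTop := by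
        congr 1
        ext x
        rw [(ENNReal.tendsto_ofReal (hqlim x)).liminf_eq, ofReal_norm]
    _ ≤ liminf (fun k => ∫⁻ x, ENNReal.ofReal (q k x)) atTop :=
        lintegral_liminf_le fun k => (hqc k).measurable.ennreal_ofReal
    _ ≤ tv univ w := liminf_le_of_le (by isBoundedDefault) fun b hb => by
        obtain ⟨k, hk⟩ := hb.exists
        exact hk.trans (hbound k)

lemma divergence_comp_add_right {ξ : Eucl n → Eucl n} (t x : Eucl n) :
    divergence (fun y => ξ (y + t)) x = divergence ξ (x + t) := by
  simp [divergence, fderiv_comp_add_right]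

/-- A mollification is an average of translates. Moving the translation to the test field keeps the
field admissible, so each translate contributes at most `tv univ v`. -/
lemma tv_convolution_le {φ v : Eucl n → ℝ} (hφ : Integrable φ) (hφ0 : ∀ x, 0 ≤ φ x)
    (hφ1 : ∫ x, φ x = 1) (hv : Integrable v) :
    tv univ (convolution φ v (ContinuousLinearMap.lsmul ℝ ℝ) volume) ≤ tv univ v := by
  by_cases hT : tv univ v = ∞
  · simp [hT]
  refine tv_le_iff.2 fun ξ h1 h2 h3 _ => ?_
  rw [ENNReal.ofReal_le_iff_le_toReal hT]
  obtain ⟨C, hC⟩ := exists_bound_divergence h1 h2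
  have hprod : Integrable (fun p : Eucl n × Eucl n =>
      φ p.2 * v (p.1 - p.2) * divergence ξ p.1) (volume.prod volume) := by
    have := hφ.convolution_integrand (ContinuousLinearMap.lsmul ℝ ℝ) hv
    refine Integrable.mul_bdd (c := C) this ?_ (Eventually.of_forall fun p => hC p.1)
    exact ((continuous_divergence h1).comp continuous_fst).aestronglyMeasurable
  have hinner : ∀ t, ∫ x, φ t * v (x - t) * divergence ξ x =
      φ t * ∫ x, v x * divergence (fun y => ξ (y + t)) x := by
    intro t
    simp_rw [mul_assoc]
    rw [integral_const_mul, ← integral_add_right_eq_self _ t]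
    simp [divergence_comp_add_right]
  have hle : ∀ t, ∫ x, v x * divergence (fun y => ξ (y + t)) x ≤ (tv univ v).toReal := by
    intro t
    rw [← ENNReal.ofReal_le_iff_le_toReal hT]
    refine ofReal_integral_le_tv v (h1.comp (contDiff_id.add contDiff_const)) ?_
      (fun x => h3 _) (subset_univ _)
    exact h2.comp_homeomorph (Homeomorph.addRight t)
  calc ∫ x, convolution φ v (ContinuousLinearMap.lsmul ℝ ℝ) volume x * divergence ξ x
      = ∫ x, ∫ t, φ t * v (x - t) * divergence ξ x := by
        congr 1
        ext x
        rw [convolution_def, ← integral_mul_const]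
        simp
    _ = ∫ t, ∫ x, φ t * v (x - t) * divergence ξ x := integral_integral_swap hprod
    _ ≤ ∫ t, φ t * (tv univ v).toReal := by
        refine integral_mono hprod.integral_prod_right (hφ.mul_const _) fun t => ?_
        dsimp only
        rw [hinner]
        exact mul_le_mul_of_nonneg_left (hle t) (hφ0 t)
    _ = (tv univ v).toReal := by rw [integral_mul_const, hφ1, one_mul]

/-- Approximation by smooth functions without increase of the total variation. -/
lemma exists_smooth_approx {v : Eucl n → ℝ} (hv : Integrable v) {R : ℝ}
    (hR : ∀ x, R < ‖x‖ → v x = 0) :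
    ∃ w : ℕ → Eucl n → ℝ, (∀ j, ContDiff ℝ 2 (w j)) ∧ (∀ j x, R + 1 < ‖x‖ → w j x = 0) ∧
      (∀ᵐ x, Tendsto (fun j => w j x) atTop (𝓝 (v x))) ∧
      (∀ j, ∫⁻ x, ‖fderiv ℝ (w j) x‖ₑ ≤ tv univ v) ∧
      ∀ M, (∀ x, |v x| ≤ M) → ∀ j x, |w j x| ≤ M := by
  let φ : ℕ → ContDiffBump (0 : Eucl n) := fun j =>
    { rIn := 1 / (2 * ((j : ℝ) + 1))
      rOut := 1 / ((j : ℝ) + 1)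
      rIn_pos := by positivity
      rIn_lt_rOut := by
        refine one_div_lt_one_div_of_lt (by positivity) ?_
        have : (0 : ℝ) < j + 1 := by positivity
        linarith }
  have hout : ∀ j, (φ j).rOut ≤ 1 := by
    intro j
    change 1 / ((j : ℝ) + 1) ≤ 1
    rw [div_le_one (by positivity)]
    simp
  set w : ℕ → Eucl n → ℝ := fun j =>
    convolution ((φ j).normed volume) v (ContinuousLinearMap.lsmul ℝ ℝ) volume with hw
  have hφi : ∀ j, Integrable ((φ j).normed volume) := fun j =>
    ((φ j).contDiff_normed (n := 1)).continuous.integrable_of_hasCompactSupport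
      (φ j).hasCompactSupport_normed
  have hw2 : ∀ j, ContDiff ℝ 2 (w j) := fun j =>
    HasCompactSupport.contDiff_convolution_left (n := 2) _ (φ j).hasCompactSupport_normed
      (φ j).contDiff_normed hv.locallyIntegrable
  have hwR : ∀ j x, R + 1 < ‖x‖ → w j x = 0 := by
    intro j x hx
    by_contra h0
    obtain ⟨a, ha, b, hb, rfl⟩ := support_convolution_subset _ (Function.mem_support.2 h0)
    rw [ContDiffBump.support_normed_eq, mem_ball_zero_iff] at ha
    have hb' : ‖b‖ ≤ R := by
      by_contra hlt
      exact hb (hR b (not_le.1 hlt))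
    linarith [norm_add_le a b, hout j]
  refine ⟨w, hw2, hwR, ?_, fun j => ?_, fun M hM j x => ?_⟩
  · refine ContDiffBump.ae_convolution_tendsto_right_of_locallyIntegrable (K := 2)
      tendsto_one_div_add_atTop_nhds_zero_nat (Eventually.of_forall fun j => le_of_eq ?_)
      hv.locallyIntegrable
    change 1 / ((j : ℝ) + 1) = 2 * (1 / (2 * ((j : ℝ) + 1)))
    field_simp
  · exact (lintegral_fderiv_le_tv (hw2 j) (hasCompactSupport_of_norm_lt (hwR j))).trans
      (tv_convolution_le (hφi j) (fun x => (φ j).nonneg_normed x) (φ j).integral_normed hv)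
  · change ‖w j x‖ ≤ M
    rw [hw]
    dsimp only
    rw [convolution_def]
    refine (norm_integral_le_of_norm_le ((hφi j).mul_const M)
      (Eventually.of_forall fun t => ?_)).trans ?_
    · rw [ContinuousLinearMap.lsmul_apply, norm_smul,
        Real.norm_of_nonneg ((φ j).nonneg_normed t)]
      exact mul_le_mul_of_nonneg_left (hM _) ((φ j).nonneg_normed t)
    · rw [integral_mul_const, (φ j).integral_normed, one_mul]

/-- The coarea inequality for `C¹` functions, with a measurable majorant. -/
lemma exists_perimeter_superlevel_le {f : Eucl n → ℝ} (hf : ContDiff ℝ 1 f) :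
    ∃ G : ℝ → ℝ≥0∞, Measurable G ∧ (∀ t, perimeter {x | t < f x} ≤ G t) ∧
      ∀ a, ∫⁻ t in Ioi a, G t ≤ ∫⁻ x in {x | a < f x}, ‖fderiv ℝ f x‖ₑ := by
  obtain ⟨G, hG, h1, h2⟩ := exists_perimeter_cut_le hf univ
  -- Cutting the whole space, of perimeter zero, yields the set and its complement with equal
  -- perimeters; this cancels the factor two of the cutting estimate.
  refine ⟨fun t => 2⁻¹ * G t, hG.const_mul _, fun t => ?_, fun a => ?_⟩
  · have hm : MeasurableSet {x | t < f x} := measurableSet_lt measurable_const hf.continuous.measurable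
    have h := h1 t
    rw [univ_inter, ← compl_eq_univ_sdiff, perimeter_compl hm.nullMeasurableSet, perimeter_univ,
      zero_add, ← two_mul] at h
    calc perimeter {x | t < f x} = 2⁻¹ * (2 * perimeter {x | t < f x}) := by
          rw [← mul_assoc, ENNReal.inv_mul_cancel (by simp) (by simp), one_mul]
      _ ≤ 2⁻¹ * G t := by gcongr
  · rw [lintegral_const_mul _ hG]
    calc 2⁻¹ * ∫⁻ t in Ioi a, G t ≤ 2⁻¹ * (2 * ∫⁻ x in univ ∩ {x | a < f x}, ‖fderiv ℝ f x‖ₑ) := by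
          gcongr; exact h2 a
      _ = _ := by rw [← mul_assoc, ENNReal.inv_mul_cancel (by simp) (by simp), one_mul, univ_inter]

lemma perimeter_le_liminf {E : ℕ → Set (Eucl n)} {F : Set (Eucl n)}
    (hE : ∀ j, NullMeasurableSet (E j)) (hF : NullMeasurableSet F)
    (h : ∀ᵐ x, ∀ᶠ j in atTop, (x ∈ E j ↔ x ∈ F)) :
    perimeter F ≤ liminf (fun j => perimeter (E j)) atTop := by
  rw [perimeter_eq_tv hF]
  simp_rw [perimeter_eq_tv (hE _)]
  refine tv_le_liminf fun ξ h1 h2 => tendsto_integral_mul_divergence (M := 1)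
    (fun j => (aestronglyMeasurable_const (b := (1 : ℝ))).indicator₀ (hE j)) ?_ ?_ h1 h2
  · intro j x
    by_cases hx : x ∈ E j <;> simp [hx]
  · filter_upwards [h] with x hx
    refine tendsto_const_nhds.congr' ?_
    filter_upwards [hx] with j hj
    by_cases hx : x ∈ F
    · simp [hx, hj.2 hx]
    · have : x ∉ E j := fun h => hx (hj.1 h)
      simp [hx, this]

/-- The coarea inequality for functions of bounded variation. -/
lemma lintegral_perimeter_superlevel_le {v : Eucl n → ℝ} (hv : Integrable v) {R : ℝ}
    (hR : ∀ x, R < ‖x‖ → v x = 0) :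
    ∫⁻ t in Ioi (0 : ℝ), perimeter {x | t < v x} ≤ tv univ v := by
  obtain ⟨w, hw, hwR, hae, hwtv, -⟩ := exists_smooth_approx hv hR
  have hw1 : ∀ j, ContDiff ℝ 1 (w j) := fun j => (hw j).of_le (by norm_num)
  choose G hG h1 h2 using fun j => exists_perimeter_superlevel_le (hw1 j)
  -- Only countably many level sets have positive volume. At every other level, pointwise almost
  -- everywhere convergence of `w j` makes the superlevel sets converge.
  have hnull : ∀ᵐ t : ℝ, volume {x | v x = t} = 0 := by
    have := (Measure.countable_meas_level_set_pos₀
      (μ := (volume : Measure (Eucl n))) hv.aestronglyMeasurable.aemeasurable.nullMeasurable)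
    have h0 := this.measure_zero volume
    rw [measure_eq_zero_iff_ae_notMem] at h0
    filter_upwards [h0] with t ht
    simpa using ht
  calc ∫⁻ t in Ioi (0 : ℝ), perimeter {x | t < v x}
      ≤ ∫⁻ t in Ioi (0 : ℝ), liminf (fun j => G j t) atTop := by
        refine lintegral_mono_ae ?_
        filter_upwards [ae_restrict_of_ae hnull] with t ht
        refine (perimeter_le_liminf (E := fun j => {x | t < w j x}) (fun j => ?_) ?_ ?_).trans
          (liminf_le_liminf (Eventually.of_forall fun j => h1 j t))
        · exact (measurableSet_lt measurable_const
            (hw j).continuous.measurable).nullMeasurableSet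
        · exact nullMeasurableSet_lt aemeasurable_const hv.aestronglyMeasurable.aemeasurable
        · rw [measure_eq_zero_iff_ae_notMem] at ht
          filter_upwards [hae, ht] with x hx hxt
          rcases lt_or_gt_of_ne (show v x ≠ t from hxt) with hlt | hlt
          · filter_upwards [hx.eventually_lt_const hlt] with j hj
            exact iff_of_false (not_lt.2 hj.le) (not_lt.2 hlt.le)
          · filter_upwards [hx.eventually_const_lt hlt] with j hj
            exact iff_of_true hj hlt
    _ ≤ liminf (fun j => ∫⁻ t in Ioi (0 : ℝ), G j t) atTop := lintegral_liminf_le hG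
    _ ≤ tv univ v := liminf_le_of_le (by isBoundedDefault) fun b hb => by
        obtain ⟨j, hj⟩ := hb.exists
        exact hj.trans ((h2 j 0).trans ((setLIntegral_le_lintegral _ _).trans (hwtv j)))

/-! ### Submodularity and isoperimetric inequalities -/

lemma integrable_indicator_of_subset_closedBall {E : Set (Eucl n)} (hE : NullMeasurableSet E)
    {R : ℝ} (hR : E ⊆ Metric.closedBall 0 R) : Integrable (E.indicator (1 : Eucl n → ℝ)) := by
  refine IntegrableOn.integrable_indicator₀ ?_ hE
  exact integrableOn_const ((measure_mono hR).trans_lt measure_closedBall_lt_top).ne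

lemma indicator_eq_zero_of_subset_closedBall {E : Set (Eucl n)}
    {R : ℝ} (hR : E ⊆ Metric.closedBall 0 R) (x : Eucl n) (hx : R < ‖x‖) :
    E.indicator (1 : Eucl n → ℝ) x = 0 :=
  indicator_of_notMem (fun h => by
    have := hR h
    rw [mem_closedBall_zero_iff] at this
    linarith) _

/-- Coarea for `χ_E + χ_F`: its superlevel sets are the union at levels in `(0, 1)` and the
intersection at levels in `(1, 2)`, while the total variation of the sum is at most the sum of the
perimeters. -/
lemma perimeter_inter_add_perimeter_union_le {E F : Set (Eucl n)} (hE : NullMeasurableSet E)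
    (hF : NullMeasurableSet F) {R : ℝ} (hER : E ⊆ Metric.closedBall 0 R)
    (hFR : F ⊆ Metric.closedBall 0 R) :
    perimeter (E ∩ F) + perimeter (E ∪ F) ≤ perimeter E + perimeter F := by
  have hEi := integrable_indicator_of_subset_closedBall hE hER
  have hFi := integrable_indicator_of_subset_closedBall hF hFR
  set v : Eucl n → ℝ := E.indicator 1 + F.indicator 1 with hv
  have hcoarea := lintegral_perimeter_superlevel_le (v := v) (hEi.add hFi) (R := R) fun x hx => by
    simp [hv, indicator_eq_zero_of_subset_closedBall hER x hx,
      indicator_eq_zero_of_subset_closedBall hFR x hx]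
  have hle : tv univ v ≤ perimeter E + perimeter F := by
    rw [perimeter_eq_tv hE, perimeter_eq_tv hF]
    exact tv_add_le hEi.locallyIntegrable hFi.locallyIntegrable
  refine le_trans ?_ (hcoarea.trans hle)
  have hvE : ∀ x, v x = E.indicator 1 x + F.indicator 1 x := fun x => rfl
  have h1 : ∀ t ∈ Ioo (0 : ℝ) 1, {x | t < v x} = E ∪ F := by
    intro t ht
    ext x
    rw [mem_ofPred_eq, hvE]
    by_cases h1 : x ∈ E <;> by_cases h2 : x ∈ F <;> simp [h1, h2] <;> linarith [ht.1, ht.2]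
  have h2 : ∀ t ∈ Ioo (1 : ℝ) 2, {x | t < v x} = E ∩ F := by
    intro t ht
    ext x
    rw [mem_ofPred_eq, hvE]
    by_cases h1 : x ∈ E <;> by_cases h2 : x ∈ F <;> simp [h1, h2] <;> linarith [ht.1, ht.2]
  calc perimeter (E ∩ F) + perimeter (E ∪ F)
      = (∫⁻ t in Ioo (1 : ℝ) 2, perimeter {x | t < v x}) +
        ∫⁻ t in Ioo (0 : ℝ) 1, perimeter {x | t < v x} := by
        have e1 : ∫⁻ t in Ioo (0 : ℝ) 1, perimeter {x | t < v x} = perimeter (E ∪ F) := by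
          rw [setLIntegral_congr_fun measurableSet_Ioo (g := fun _ => perimeter (E ∪ F))
            (fun t ht => by dsimp only; rw [h1 t ht])]
          simp
        have e2 : ∫⁻ t in Ioo (1 : ℝ) 2, perimeter {x | t < v x} = perimeter (E ∩ F) := by
          rw [setLIntegral_congr_fun measurableSet_Ioo (g := fun _ => perimeter (E ∩ F))
            (fun t ht => by dsimp only; rw [h2 t ht])]
          simp only [lintegral_const, Measure.restrict_apply_univ, Real.volume_Ioo]
          norm_num
        rw [e1, e2]
    _ = ∫⁻ t in Ioo (1 : ℝ) 2 ∪ Ioo 0 1, perimeter {x | t < v x} := by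
        rw [lintegral_union measurableSet_Ioo]
        rw [Set.disjoint_left]
        intro t h1 h2
        linarith [h1.1, h2.2]
    _ ≤ _ := lintegral_mono_set (by
        rintro t (ht | ht)
        · exact lt_trans one_pos ht.1
        · exact ht.1)

/-- The Sobolev inequality with exponent `n / (n - 1)` for mollifications of the indicator passes to
the limit by Fatou. Raising it to the power `n - 1` removes the fractional exponent. -/
lemma exists_isoperimetric_const (hn : 2 ≤ n) : ∃ C : ℝ≥0, ∀ (E : Set (Eucl n)) (R : ℝ),
    NullMeasurableSet E → E ⊆ Metric.closedBall 0 R →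
      volume E ^ (n - 1) ≤ C * perimeter E ^ n := by
  have hn0 : (0 : ℝ) < n := by positivity
  have hn1 : (1 : ℝ) < n := by exact_mod_cast hn
  set p : ℝ := n / (n - 1) with hp
  have hpq : (Module.finrank ℝ (Eucl n) : ℝ).HolderConjugate p := by
    rw [finrank_euclideanSpace_fin]
    exact Real.HolderConjugate.conjExponent hn1
  have hp0 : 0 < p := div_pos hn0 (by linarith)
  set C₀ := lintegralPowLePowLIntegralFDerivConst (volume : Measure (Eucl n)) p with hC₀
  refine ⟨C₀ ^ (n - 1), fun E R hE hR => ?_⟩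
  obtain ⟨w, hw, hwR, hae, hwtv, -⟩ := exists_smooth_approx
    (integrable_indicator_of_subset_closedBall hE hR) (indicator_eq_zero_of_subset_closedBall hR)
  have hkey : volume E ≤ C₀ * perimeter E ^ p := by
    calc volume E = ∫⁻ x, ‖E.indicator (1 : Eucl n → ℝ) x‖ₑ ^ p := by
          rw [← lintegral_indicator_one₀ hE]
          congr 1
          ext x
          by_cases hx : x ∈ E <;> simp [hx, hp0]
      _ = ∫⁻ x, liminf (fun j => ‖w j x‖ₑ ^ p) atTop := by
          refine lintegral_congr_ae ?_
          filter_upwards [hae] with x hx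
          exact (((ENNReal.continuous_rpow_const (y := p)).tendsto _).comp hx.enorm).liminf_eq.symm
      _ ≤ liminf (fun j => ∫⁻ x, ‖w j x‖ₑ ^ p) atTop :=
          lintegral_liminf_le fun j => (hw j).continuous.measurable.enorm.pow_const p
      _ ≤ C₀ * perimeter E ^ p := liminf_le_of_le (by isBoundedDefault) fun b hb => by
          obtain ⟨j, hj⟩ := hb.exists
          refine hj.trans ((lintegral_pow_le_pow_lintegral_fderiv volume
            ((hw j).of_le (by norm_num)) (hasCompactSupport_of_norm_lt (hwR j)) hpq).trans ?_)
          gcongr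
          rw [perimeter_eq_tv hE]
          exact hwtv j
  calc volume E ^ (n - 1) ≤ (C₀ * perimeter E ^ p) ^ (n - 1) := by gcongr
    _ = _ := by
      rw [mul_pow, ENNReal.coe_pow, ← ENNReal.rpow_mul_natCast, Nat.cast_sub (by omega), hp,
        Nat.cast_one, div_mul_cancel₀ _ (by linarith), ENNReal.rpow_natCast]

/-- A linear isoperimetric inequality for subsets of a ball. -/
lemma volume_le_mul_perimeter {E : Set (Eucl n)} {R : ℝ} (hR : 0 < R)
    (hER : E ⊆ Metric.ball 0 R) : n * volume E ≤ ENNReal.ofReal (2 * R) * perimeter E := by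
  let b : ContDiffBump (0 : Eucl n) :=
    { rIn := R, rOut := 2 * R, rIn_pos := hR, rIn_lt_rOut := by linarith }
  -- The radial field `x / (2R)`, cut off between radii `R` and `2R`, has norm at most one and
  -- divergence `n / (2R)` on the ball containing `E`.
  set ξ : Eucl n → Eucl n := fun x => (b x / (2 * R)) • x with hξ
  have hbd : ContDiff ℝ 1 fun x => b x / (2 * R) := b.contDiff.div_const _
  have h1 : ContDiff ℝ 1 ξ := hbd.smul contDiff_id
  have h2 : HasCompactSupport ξ := by
    refine HasCompactSupport.intro b.hasCompactSupport fun x hx => ?_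
    simp [hξ, image_eq_zero_of_notMem_tsupport hx]
  have h3 : ∀ x, ‖ξ x‖ ≤ 1 := by
    intro x
    by_cases hx : x ∈ Metric.ball (0 : Eucl n) (2 * R)
    · rw [mem_ball_zero_iff] at hx
      rw [hξ]
      dsimp only
      rw [norm_smul, norm_div, Real.norm_of_nonneg b.nonneg,
        Real.norm_of_nonneg (by positivity : 0 ≤ 2 * R), div_mul_eq_mul_div, div_le_one (by positivity)]
      calc b x * ‖x‖ ≤ 1 * ‖x‖ := by gcongr; exact b.le_one
        _ ≤ 2 * R := by linarith
    · have : b x = 0 := b.zero_of_le_dist (by simpa using hx)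
      simp [hξ, this]
  have hdiv : ∀ x ∈ Metric.ball (0 : Eucl n) R, divergence ξ x = n / (2 * R) := by
    intro x hx
    have : ξ =ᶠ[𝓝 x] fun y => (1 / (2 * R)) • y := by
      filter_upwards [Metric.isOpen_ball.mem_nhds hx] with y hy
      have : b y = 1 := b.one_of_mem_closedBall (Metric.ball_subset_closedBall hy)
      simp [hξ, this]
    unfold divergence
    rw [this.fderiv_eq]
    have : fderiv ℝ (fun y : Eucl n => (1 / (2 * R)) • y) x =
        (1 / (2 * R)) • ContinuousLinearMap.id ℝ (Eucl n) :=
      ((hasFDerivAt_id x).const_smul (1 / (2 * R))).fderiv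
    rw [this]
    simp
    ring
  have hmem := ofReal_integral_le_perimeter E h1 h2 h3
  have hint : ∫ x in E, divergence ξ x = n / (2 * R) * volume.real E := by
    have hEfin : volume E ≠ ∞ := ((measure_mono hER).trans_lt measure_ball_lt_top).ne
    have hae : ∀ᵐ x ∂(volume.restrict E), divergence ξ x = n / (2 * R) := by
      have h0 : ∀ᵐ x ∂(volume.restrict (Metric.ball (0 : Eucl n) R)),
          divergence ξ x = n / (2 * R) := by
        filter_upwards [ae_restrict_mem measurableSet_ball] with x hx using hdiv x hx
      exact ae_mono (Measure.restrict_mono hER le_rfl) h0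
    rw [integral_congr_ae hae, integral_const, smul_eq_mul, mul_comm,
      measureReal_restrict_apply_univ]
  rw [hint] at hmem
  have hEfin : volume E ≠ ∞ := ((measure_mono hER).trans_lt measure_ball_lt_top).ne
  calc n * volume E = ENNReal.ofReal (2 * R) * ENNReal.ofReal (n / (2 * R) * volume.real E) := by
        rw [← ENNReal.ofReal_mul (by positivity), ← mul_assoc, mul_div_cancel₀ _ (by positivity),
          ENNReal.ofReal_mul (by positivity), ENNReal.ofReal_natCast, ofReal_measureReal]
    _ ≤ _ := by gcongr

/-! ### Density estimates -/

/-- De Giorgi's iteration: fast geometric decay. -/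
lemma eq_zero_of_pow_le_mul_pow {n : ℕ} (hn : 2 ≤ n) {a : ℝ → ℝ} (ha : ∀ ρ, 0 ≤ a ρ)
    (hmono : Monotone a) {K r : ℝ} (hK : 0 < K) (hr : 0 < r)
    (h : ∀ ρ ρ', 0 < ρ → ρ < ρ' → ρ' ≤ r → a ρ ^ (n - 1) ≤ (K / (ρ' - ρ) * a ρ') ^ n)
    (hsmall : a r ≤ ((1 / 2 : ℝ) ^ n) ^ (n - 1) / (4 * K) ^ n * r ^ n) :
    a (r / 2) = 0 := by
  obtain ⟨l, hl⟩ : ∃ l : ℝ, l = (1 / 2 : ℝ) ^ n := ⟨_, rfl⟩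
  rw [← hl] at hsmall
  have hl0 : 0 < l := by rw [hl]; positivity
  set c : ℝ := l ^ (n - 1) / (4 * K) ^ n with hc
  have hc0 : 0 < c := by positivity
  -- Radii decreasing from `r` to `r / 2` with gaps `r / 2 ^ (i + 2)`, so that `K / gap = 4 K 2 ^ i
  -- / r`; hence the factor `4 K` in the smallness threshold.
  set ρ : ℕ → ℝ := fun i => r / 2 + r / 2 ^ (i + 1) with hρ
  have hρ0 : ∀ i, 0 < ρ i := fun i => by positivity
  have hρr : ∀ i, ρ i ≤ r := by
    intro i
    have h2 : (2 : ℝ) ≤ 2 ^ (i + 1) := by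
      rw [pow_succ]
      have : (1 : ℝ) ≤ 2 ^ i := one_le_pow₀ (by norm_num)
      linarith
    have : r / 2 ^ (i + 1) ≤ r / 2 := by gcongr
    simp only [hρ]
    linarith
  have hdiff : ∀ i, ρ i - ρ (i + 1) = r / 2 ^ (i + 2) := by
    intro i
    simp only [hρ]
    field_simp
    ring
  -- The constants are tuned so that the induction closes exactly: `(4 K) ^ n * c = l ^ (n - 1)` by
  -- choice of `c`, and `(2 l) ^ n = l ^ (n - 1)` because `l = 2 ^ (-n)`.
  have key : ∀ i, a (ρ i) ≤ c * r ^ n * l ^ i := by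
    intro i
    induction i with
    | zero =>
      have : ρ 0 = r := by simp only [hρ]; ring
      rw [this]
      simpa using hsmall
    | succ i ih =>
      have hlt : ρ (i + 1) < ρ i := by
        have := hdiff i
        have : 0 < r / 2 ^ (i + 2) := by positivity
        linarith
      have h1 := h (ρ (i + 1)) (ρ i) (hρ0 _) hlt (hρr i)
      rw [hdiff] at h1
      refine le_of_pow_le_pow_left₀ (n := n - 1) (by omega) (by positivity) (h1.trans ?_)
      have h2 : (K / (r / 2 ^ (i + 2)) * a (ρ i)) ^ n ≤
          (K / (r / 2 ^ (i + 2)) * (c * r ^ n * l ^ i)) ^ n := by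
        have := ha (ρ i)
        gcongr
      refine h2.trans (le_of_eq ?_)
      obtain ⟨m, rfl⟩ : ∃ m, n = m + 1 := ⟨n - 1, by omega⟩
      have e1 : K / (r / 2 ^ (i + 2)) * (c * r ^ (m + 1) * l ^ i) =
          (4 * K) * c * r ^ m * (2 ^ i * l ^ i) := by
        field_simp
        ring
      have e2 : (4 * K) ^ (m + 1) * c = l ^ m := by
        simp only [hc, Nat.add_sub_cancel]
        field_simp
      have e3 : (2 * l) ^ (m + 1) = l ^ m := by
        have e0 : 2 ^ (m + 1) * l = 1 := by
          rw [hl, ← mul_pow]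
          norm_num
        rw [mul_pow, pow_succ l m]
        linear_combination l ^ m * e0
      have e4 : (2 ^ i * l ^ i) ^ (m + 1) = (l ^ i) ^ m := by
        rw [← mul_pow, ← pow_mul, mul_comm i, pow_mul, e3, ← pow_mul, ← pow_mul,
          mul_comm i m]
      rw [e1, mul_pow, e4, mul_pow, mul_pow, Nat.add_sub_cancel]
      calc (4 * K) ^ (m + 1) * c ^ (m + 1) * (r ^ m) ^ (m + 1) * (l ^ i) ^ m
          = ((4 * K) ^ (m + 1) * c) * c ^ m * (r ^ m) ^ (m + 1) * (l ^ i) ^ m := by ring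
        _ = l ^ m * c ^ m * (r ^ m) ^ (m + 1) * (l ^ i) ^ m := by rw [e2]
        _ = _ := by
          rw [mul_pow, mul_pow, ← pow_mul r, ← pow_mul r, mul_comm m (m + 1), pow_succ l i, mul_pow]
          ring
  have hlim : Tendsto (fun i : ℕ => c * r ^ n * l ^ i) atTop (𝓝 0) := by
    have hl1 : l < 1 := hl ▸ pow_lt_one₀ (by norm_num) (by norm_num) (by omega)
    simpa using (tendsto_pow_atTop_nhds_zero_of_lt_one hl0.le hl1).const_mul (c * r ^ n)
  refine le_antisymm (ge_of_tendsto' hlim fun i => (hmono ?_).trans (key i)) (ha _)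
  have : 0 < r / 2 ^ (i + 1) := by positivity
  simp only [hρ]
  linarith

/-- Balls are cut out by the negative squared distance, which unlike the distance is differentiable
at the centre. -/
lemma superlevel_neg_norm_sub_sq (x : Eucl n) (t : ℝ) :
    {y : Eucl n | t < -‖y - x‖ ^ 2} = Metric.ball x √(-t) := by
  ext y
  rw [mem_ofPred_eq, mem_ball_iff_norm, Real.lt_sqrt (norm_nonneg _)]
  constructor <;> intro h <;> linarith

lemma norm_fderiv_neg_norm_sub_sq_le (x y : Eucl n) :
    ‖fderiv ℝ (fun y : Eucl n => -‖y - x‖ ^ 2) y‖ ≤ 2 * ‖y - x‖ := by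
  have h : HasFDerivAt (fun y : Eucl n => -‖y - x‖ ^ 2) _ y :=
    (((hasFDerivAt_id y).sub_const x).norm_sq).neg
  rw [h.fderiv, norm_neg]
  refine ContinuousLinearMap.opNorm_le_bound _ (by positivity) fun v => ?_
  simp only [id_eq, smul_apply, ContinuousLinearMap.comp_id, innerSL_apply_apply,
    nsmul_eq_mul, norm_mul, Nat.cast_ofNat, Real.norm_ofNat]
  have := norm_inner_le_norm (𝕜 := ℝ) (y - x) v
  nlinarith

/-- Between two concentric spheres there is a sphere along which cutting is cheap. -/
lemma exists_ball_perimeter_cut_le {E : Set (Eucl n)} (x : Eucl n) {ρ ρ' : ℝ} (hρ : 0 < ρ)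
    (hρρ' : ρ < ρ') : ∃ s, ρ < s ∧ s < ρ' ∧
      perimeter (E ∩ Metric.ball x s) + perimeter (E \ Metric.ball x s) ≤
        perimeter E + ENNReal.ofReal (4 / (ρ' - ρ)) * volume (E ∩ Metric.ball x ρ') := by
  have hf : ContDiff ℝ 1 fun y : Eucl n => -‖y - x‖ ^ 2 :=
    ((contDiff_id.sub contDiff_const).norm_sq ℝ).neg
  obtain ⟨G, hG, h1, h2⟩ := exists_perimeter_cut_le hf E
  have hρ' : 0 < ρ' := hρ.trans hρρ'
  have hlen : 0 < ρ' ^ 2 - ρ ^ 2 := by nlinarith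
  set V := volume (E ∩ Metric.ball x ρ') with hV
  have hint : ∫⁻ t in Ioi (-ρ' ^ 2), G t ≤ ENNReal.ofReal (4 * ρ') * V := by
    refine (h2 _).trans ?_
    rw [superlevel_neg_norm_sub_sq, neg_neg, Real.sqrt_sq hρ'.le]
    have h3 : ∫⁻ y in E ∩ Metric.ball x ρ', ‖fderiv ℝ (fun y : Eucl n => -‖y - x‖ ^ 2) y‖ₑ ≤
        ENNReal.ofReal (2 * ρ') * V := by
      rw [hV, ← setLIntegral_const]
      have h0 : ∀ᵐ y ∂(volume.restrict (Metric.ball x ρ')),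
          ‖fderiv ℝ (fun y : Eucl n => -‖y - x‖ ^ 2) y‖ₑ ≤ ENNReal.ofReal (2 * ρ') := by
        filter_upwards [ae_restrict_mem measurableSet_ball] with y hy
        rw [← ofReal_norm]
        refine ENNReal.ofReal_le_ofReal ((norm_fderiv_neg_norm_sub_sq_le x y).trans ?_)
        rw [mem_ball_iff_norm] at hy
        linarith
      exact lintegral_mono_ae (ae_mono (Measure.restrict_mono inter_subset_right le_rfl) h0)
    calc 2 * ∫⁻ y in E ∩ Metric.ball x ρ', ‖fderiv ℝ (fun y : Eucl n => -‖y - x‖ ^ 2) y‖ₑ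
        ≤ ENNReal.ofReal 2 * (ENNReal.ofReal (2 * ρ') * V) := by
          rw [ENNReal.ofReal_ofNat]
          gcongr
      _ = _ := by
          rw [← mul_assoc, ← ENNReal.ofReal_mul (by norm_num)]
          congr 2
          ring
  -- Some level does no worse than the average over an interval of length `ρ'² - ρ²`. With `|∇| ≤ 2
  -- ρ'` and the factor two of the cut the cost is `4 ρ' / (ρ'² - ρ²) ≤ 4 / (ρ' - ρ)` times the
  -- volume.
  obtain ⟨t, ht, hGt⟩ := exists_le_setLAverage (μ := volume) (s := Ioo (-ρ' ^ 2) (-ρ ^ 2)) (f := G)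
    (by simpa using hlen) (by simp) hG.aemeasurable
  refine ⟨√(-t), ?_, ?_, ?_⟩
  · exact (Real.lt_sqrt hρ.le).2 (by linarith [ht.2])
  · exact (Real.sqrt_lt' hρ').2 (by linarith [ht.1])
  · rw [← superlevel_neg_norm_sub_sq x t]
    refine (h1 t).trans ?_
    gcongr
    refine hGt.trans ?_
    rw [setLAverage_eq, Real.volume_Ioo]
    calc (∫⁻ t in Ioo (-ρ' ^ 2) (-ρ ^ 2), G t) / ENNReal.ofReal (-ρ ^ 2 - -ρ' ^ 2)
        ≤ (ENNReal.ofReal (4 * ρ') * V) / ENNReal.ofReal (-ρ ^ 2 - -ρ' ^ 2) := by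
          gcongr
          exact (lintegral_mono_set Ioo_subset_Ioi_self).trans hint
      _ = ENNReal.ofReal (4 * ρ' / (ρ' ^ 2 - ρ ^ 2)) * V := by
          rw [show -ρ ^ 2 - -ρ' ^ 2 = ρ' ^ 2 - ρ ^ 2 by ring, ENNReal.ofReal_div_of_pos hlen,
            ENNReal.mul_div_right_comm]
      _ ≤ _ := by
          gcongr ENNReal.ofReal ?_ * _
          rw [div_le_div_iff₀ hlen (by linarith)]
          nlinarith

/-- Density estimate: if removing balls around `x` does not decrease the perimeter of `E` up to a
volume term, and `E` has small density in `B_r(x)`, then `E` does not meet `B_{r/2}(x)`. -/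
lemma exists_density_const (hn : 2 ≤ n) {L : ℝ} (hL : 0 ≤ L) : ∃ c : ℝ, 0 < c ∧
    ∀ (E : Set (Eucl n)) (x : Eucl n) (r Λ : ℝ), 0 < r → Λ * r ≤ L → NullMeasurableSet E →
      perimeter E ≠ ∞ →
      (∀ s, 0 < s → s ≤ r → perimeter E ≤ perimeter (E \ Metric.ball x s) +
        ENNReal.ofReal Λ * volume (E ∩ Metric.ball x s)) →
      volume.real (E ∩ Metric.ball x r) ≤ c * r ^ n →
      volume (E ∩ Metric.ball x (r / 2)) = 0 := by
  obtain ⟨C, hC⟩ := exists_isoperimetric_const hn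
  -- `4` comes from the spherical cut and `L` from the volume term; `C + 1` is used since `C ≤ (C +
  -- 1) ^ n`.
  set K : ℝ := (C + 1) * (L + 4) with hK
  have hK0 : 0 < K := by positivity
  refine ⟨((1 / 2 : ℝ) ^ n) ^ (n - 1) / (4 * K) ^ n, by positivity,
    fun E x r Λ hr hΛ hE hP hmin hsmall => ?_⟩
  have hfin : ∀ ρ, volume (E ∩ Metric.ball x ρ) ≠ ∞ := fun ρ =>
    ((measure_mono inter_subset_right).trans_lt measure_ball_lt_top).ne
  have h0 : volume.real (E ∩ Metric.ball x (r / 2)) = 0 := by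
    refine eq_zero_of_pow_le_mul_pow hn (a := fun ρ => volume.real (E ∩ Metric.ball x ρ))
      (fun _ => measureReal_nonneg) (fun ρ ρ' h => ?_) hK0 hr (fun ρ ρ' h1 h2 h3 => ?_) hsmall
    · exact measureReal_mono (inter_subset_inter_right _ (Metric.ball_subset_ball h)) (hfin _)
    · obtain ⟨s, hs1, hs2, hs⟩ := exists_ball_perimeter_cut_le (E := E) x h1 h2
      set V := volume (E ∩ Metric.ball x ρ') with hV
      have hd : 0 < ρ' - ρ := by linarith
      have hPs : perimeter (E \ Metric.ball x s) ≠ ∞ := by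
        refine ne_top_of_le_ne_top ?_ (le_add_self.trans hs)
        exact ENNReal.add_ne_top.2 ⟨hP, ENNReal.mul_ne_top (by simp) (hfin _)⟩
      have hVs : volume (E ∩ Metric.ball x s) ≤ V :=
        measure_mono (inter_subset_inter_right _ (Metric.ball_subset_ball hs2.le))
      -- Minimality bounds `P(E)` by `P(E \ B_s)` plus volume, and the finite `P(E \ B_s)` cancels
      -- against the cut. The volume term is absorbed because `Λ ≤ L / (ρ' - ρ)`, as `ρ' - ρ ≤ r`.
      have hPV : perimeter (E ∩ Metric.ball x s) ≤ ENNReal.ofReal ((L + 4) / (ρ' - ρ)) * V := by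
        have h4 : perimeter (E \ Metric.ball x s) + perimeter (E ∩ Metric.ball x s) ≤
            perimeter (E \ Metric.ball x s) + (ENNReal.ofReal Λ * V +
              ENNReal.ofReal (4 / (ρ' - ρ)) * V) := by
          rw [add_comm, ← add_assoc]
          refine hs.trans ?_
          gcongr
          refine (hmin s (h1.trans hs1) (hs2.le.trans h3)).trans ?_
          gcongr
        rw [ENNReal.add_le_add_iff_left hPs] at h4
        refine h4.trans ?_
        rw [← add_mul]
        gcongr
        rw [add_div, ENNReal.ofReal_add (by positivity) (by positivity)]
        gcongr
        rw [le_div_iff₀ hd]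
        rcases le_total Λ 0 with hΛ0 | hΛ0
        · exact (mul_nonpos_of_nonpos_of_nonneg hΛ0 hd.le).trans hL
        · refine le_trans ?_ hΛ
          gcongr
          linarith
      have h5 := hC (E ∩ Metric.ball x s) (‖x‖ + s)
        (hE.inter measurableSet_ball.nullMeasurableSet) (by
          refine inter_subset_right.trans fun y hy => ?_
          rw [mem_ball_iff_norm] at hy
          rw [mem_closedBall_zero_iff]
          have := norm_add_le (y - x) x
          rw [sub_add_cancel] at this
          linarith)
      have h6 : volume (E ∩ Metric.ball x ρ) ^ (n - 1) ≤
          C * (ENNReal.ofReal ((L + 4) / (ρ' - ρ)) * V) ^ n := by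
        refine le_trans ?_ (h5.trans (by gcongr))
        gcongr
      have h7 := ENNReal.toReal_mono (ENNReal.mul_ne_top (by simp) (ENNReal.pow_ne_top
        (ENNReal.mul_ne_top (by simp) (hfin _)))) h6
      rw [ENNReal.toReal_pow, ENNReal.toReal_mul, ENNReal.toReal_pow, ENNReal.toReal_mul,
        ENNReal.toReal_ofReal (by positivity), ENNReal.coe_toReal] at h7
      refine h7.trans ?_
      change C * ((L + 4) / (ρ' - ρ) * volume.real (E ∩ Metric.ball x ρ')) ^ n ≤ _
      have h8 : (C : ℝ) ≤ (C + 1) ^ n := by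
        have h9 : (C : ℝ) + 1 ≤ (C + 1) ^ n := le_self_pow₀ (by simp) (by omega)
        linarith
      calc C * ((L + 4) / (ρ' - ρ) * volume.real (E ∩ Metric.ball x ρ')) ^ n
          ≤ (C + 1) ^ n * ((L + 4) / (ρ' - ρ) * volume.real (E ∩ Metric.ball x ρ')) ^ n := by
            gcongr
        _ = _ := by
            rw [← mul_pow, hK]
            ring
  exact (measureReal_eq_zero_iff (hfin _)).1 h0

/-! ### The gradient measure -/

/-- Both sides are continuous in `L¹` and agree on indicators. This converts the distributional
identity for scalar test functions, coordinate by coordinate, into one for vector fields. -/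
lemma integral_smul_const_innerSL {D : VectorMeasure (Eucl n) (Eucl n)}
    [IsFiniteMeasure D.variation] (e : Eucl n) {f : Eucl n → ℝ} (hf : Integrable f D.variation) :
    ∫ᵛ x, f x • e ∂[innerSL ℝ; D] = inner ℝ e (∫ᵛ x, f x ∂•D) := by
  let L : ℝ →L[ℝ] Eucl n := ContinuousLinearMap.toSpanSingleton ℝ e
  have hLint : ∀ {g : Eucl n → ℝ}, Integrable g D.variation →
      Integrable (fun x => g x • e) D.variation := fun hg => hg.smul_const e
  refine hf.induction (P := fun f => ∫ᵛ x, f x • e ∂[innerSL ℝ; D] = inner ℝ e (∫ᵛ x, f x ∂•D))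
    ?_ ?_ ?_ ?_
  · intro c s hs _
    have h1 : (fun x => s.indicator (fun _ => c) x • e) = s.indicator fun _ => c • e := by
      ext1 x
      by_cases hx : x ∈ s <;> simp [hx]
    rw [h1, VectorMeasure.integral_indicator_const _ hs, VectorMeasure.integral_indicator_const _ hs]
    simp only [inner_smul_right, map_smul, _root_.smul_apply, ContinuousLinearMap.lsmul_apply]
    rfl
  · intro f g _ hf hg h1 h2
    simp only [Pi.add_apply, add_smul]
    rw [VectorMeasure.integral_fun_add (hLint hf) (hLint hg), h1, h2,
      VectorMeasure.integral_fun_add hf hg, inner_add_right]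
  · have h1 : ∀ f : Eucl n →₁[D.variation] ℝ,
        ∫ᵛ x, f x • e ∂[innerSL ℝ; D] = ∫ᵛ x, L.compLp f x ∂[innerSL ℝ; D] := fun f =>
      VectorMeasure.integral_congr_ae (by
        filter_upwards [L.coeFn_compLp f] with x hx
        rw [hx]
        simp [L])
    simp_rw [h1]
    refine isClosed_eq ?_ ?_
    · exact VectorMeasure.continuous_integral.comp (L.compLpL 1 D.variation).continuous
    · exact continuous_const.inner VectorMeasure.continuous_integral
  · intro f g hfg _ h
    rw [← VectorMeasure.integral_congr_ae hfg, ← h]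
    refine VectorMeasure.integral_congr_ae ?_
    filter_upwards [hfg] with x hx
    rw [hx]

lemma integrable_of_hasCompactSupport {D : Measure (Eucl n)} [IsFiniteMeasure D] {F : Type*}
    [NormedAddCommGroup F] [NormedSpace ℝ F] {φ : Eucl n → F}
    (hφ : Continuous φ) (hc : HasCompactSupport φ) : Integrable φ D :=
  hφ.integrable_of_hasCompactSupport hc

lemma gradient_apply (φ : Eucl n → ℝ) (x : Eucl n) (i : Fin n) :
    gradient φ x i = fderiv ℝ φ x (EuclideanSpace.single i 1) := by
  have h : inner ℝ (gradient φ x) (EuclideanSpace.single i (1 : ℝ)) =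
      fderiv ℝ φ x (EuclideanSpace.single i 1) := InnerProductSpace.toDual_symm_apply
  rw [← h, EuclideanSpace.inner_single_right]
  simp

lemma continuous_gradient {φ : Eucl n → ℝ} (hφ : ContDiff ℝ 1 φ) : Continuous (gradient φ) :=
  (InnerProductSpace.toDual ℝ (Eucl n)).symm.continuous.comp (hφ.continuous_fderiv (by simp))

lemma hasCompactSupport_gradient {φ : Eucl n → ℝ} (hc : HasCompactSupport φ) :
    HasCompactSupport (gradient φ) :=
  HasCompactSupport.intro (hc.fderiv ℝ) fun x hx => by
    simp [gradient, image_eq_zero_of_notMem_tsupport hx]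

lemma divergence_eq_sum {ξ : Eucl n → Eucl n} (hξ : ContDiff ℝ 1 ξ) (x : Eucl n) :
    divergence ξ x = ∑ i, gradient (fun y => ξ y i) x i := by
  unfold divergence
  refine Finset.sum_congr rfl fun i _ => ?_
  rw [gradient_apply]
  have := ((EuclideanSpace.proj i : Eucl n →L[ℝ] ℝ).hasFDerivAt.comp x
    ((hξ.differentiable (by simp)) x).hasFDerivAt).fderiv
  change fderiv ℝ (fun y => ξ y i) x = _ at this
  rw [this]; rfl

lemma IsDistribGradient.integral_mul_gradient {v : Eucl n → ℝ}
    {D : VectorMeasure (Eucl n) (Eucl n)} (h : IsDistribGradient v D) {φ : Eucl n → ℝ}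
    (hφ : ContDiff ℝ 1 φ) (hc : HasCompactSupport φ) (i : Fin n) :
    ∫ x, v x * gradient φ x i = - (∫ᵛ x, φ x ∂•D) i := by
  have h1 := congrArg (fun y : Eucl n => y i) (h.integral_eq φ hφ hc)
  have hint : Integrable fun x => v x • gradient φ x :=
    h.locallyIntegrable.integrable_smul_right_of_hasCompactSupport (continuous_gradient hφ)
      (hasCompactSupport_gradient hc)
  have h2 := (EuclideanSpace.proj i : Eucl n →L[ℝ] ℝ).integral_comp_comm hint
  simp only [PiLp.neg_apply] at h1
  rw [← h1]
  simpa using h2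

lemma IsDistribGradient.integral_mul_divergence {v : Eucl n → ℝ}
    {D : VectorMeasure (Eucl n) (Eucl n)} (h : IsDistribGradient v D) {ξ : Eucl n → Eucl n}
    (hξ : ContDiff ℝ 1 ξ) (hc : HasCompactSupport ξ) :
    ∫ x, v x * divergence ξ x = - ∫ᵛ x, ξ x ∂[innerSL ℝ; D] := by
  have := h.finite
  have hcoord : ∀ i, ContDiff ℝ 1 fun x => ξ x i := fun i => by fun_prop
  have hcs : ∀ i, HasCompactSupport fun x => ξ x i := fun i =>
    hc.comp_left (g := fun v : Eucl n => v i) (by simp)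
  have hint : ∀ i, Integrable fun x => v x * gradient (fun y => ξ y i) x i := fun i => by
    refine h.locallyIntegrable.integrable_smul_right_of_hasCompactSupport
      (g := fun x => gradient (fun y => ξ y i) x i) ?_ ?_
    · have := continuous_gradient (hcoord i)
      fun_prop
    · exact (hasCompactSupport_gradient (hcs i)).comp_left (g := fun v : Eucl n => v i) (by simp)
  simp_rw [divergence_eq_sum hξ, Finset.mul_sum]
  rw [integral_finsetSum _ fun i _ => hint i]
  simp_rw [fun i => h.integral_mul_gradient (hcoord i) (hcs i) i]
  rw [Finset.sum_neg_distrib]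
  congr 1
  have hintD : ∀ i, Integrable (fun x => ξ x i) D.variation := fun i =>
    integrable_of_hasCompactSupport (hcoord i).continuous (hcs i)
  have h1 : ∀ i, (∫ᵛ x, ξ x i ∂•D) i =
      ∫ᵛ x, ξ x i • EuclideanSpace.single i (1 : ℝ) ∂[innerSL ℝ; D] := by
    intro i
    rw [integral_smul_const_innerSL _ (hintD i)]
    simp [EuclideanSpace.inner_single_left]
  simp_rw [h1]
  rw [← VectorMeasure.integral_finsetSum]
  · simp_rw [sum_coord_smul_single]
  · intro i _
    exact (hintD i).smul_const _

lemma tv_le_variation {v : Eucl n → ℝ} {D : VectorMeasure (Eucl n) (Eucl n)}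
    (h : IsDistribGradient v D) {U : Set (Eucl n)} (hU : MeasurableSet U) :
    tv U v ≤ D.variation U := by
  refine tv_le_iff.2 fun ξ h1 h2 h3 h4 => ?_
  rw [h.integral_mul_divergence h1 h2]
  calc ENNReal.ofReal (-∫ᵛ x, ξ x ∂[innerSL ℝ; D]) ≤ ‖∫ᵛ x, ξ x ∂[innerSL ℝ; D]‖ₑ := by
        rw [← ofReal_norm]
        exact ENNReal.ofReal_le_ofReal (neg_le_abs _)
    _ ≤ ‖innerSL ℝ (E := Eucl n)‖ₑ * ∫⁻ x, ‖ξ x‖ₑ ∂D.variation :=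
        VectorMeasure.enorm_integral_le_lintegral_enorm
    _ ≤ 1 * ∫⁻ x, U.indicator 1 x ∂D.variation := by
        gcongr with x
        · rw [← ofReal_norm]
          exact ENNReal.ofReal_le_one.2 (norm_innerSL_le ℝ)
        · by_cases hx : x ∈ U
          · rw [indicator_of_mem hx, ← ofReal_norm]
            exact ENNReal.ofReal_le_one.2 (h3 x)
          · rw [image_eq_zero_of_notMem_tsupport (fun h => hx (h4 h))]
            simp
    _ = D.variation U := by rw [one_mul, lintegral_indicator_one hU]

/-! ### Smooth fields almost attaining the variation on an open set -/

lemma exists_contDiff_one_of_isCompact {K U : Set (Eucl n)} (hK : IsCompact K) (hU : IsOpen U)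
    (hKU : K ⊆ U) : ∃ φ : Eucl n → ℝ, ContDiff ℝ 2 φ ∧ HasCompactSupport φ ∧ tsupport φ ⊆ U ∧
      (∀ x, φ x ∈ Icc (0 : ℝ) 1) ∧ ∀ x ∈ K, φ x = 1 := by
  obtain ⟨V, hV, hKV, hVU, hVc⟩ := exists_open_between_and_isCompact_closure hK hU hKU
  obtain ⟨f, h0, h1, h2⟩ := exists_contMDiffMap_zero_one_of_isClosed (modelWithCornersSelf ℝ (Eucl n))
    (n := 2) hV.isClosed_compl hK.isClosed (disjoint_compl_left_iff_subset.2 hKV)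
  have hsupp : tsupport f ⊆ closure V := closure_mono fun x hx => by
    by_contra hxV
    exact hx (h0 hxV)
  exact ⟨f, f.contMDiff.contDiff, hVc.of_isClosed_subset (isClosed_tsupport _) hsupp,
    hsupp.trans hVU, h2, fun x hx => h1 hx⟩

/-- The map `v ↦ 2v / (1 + ‖v‖²)`, which takes values in the unit ball and fixes the unit sphere
and the origin. -/
def ballRetract (v : Eucl n) : Eucl n := (2 / (1 + ‖v‖ ^ 2)) • v

lemma contDiff_ballRetract : ContDiff ℝ 1 (ballRetract (n := n)) := by
  unfold ballRetract
  refine ContDiff.smul (contDiff_const.div (contDiff_const.add (contDiff_id.norm_sq ℝ))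
    fun x => ?_) contDiff_id
  simp only [id]
  positivity

lemma norm_ballRetract_le (v : Eucl n) : ‖ballRetract v‖ ≤ 1 := by
  unfold ballRetract
  rw [norm_smul, norm_div, Real.norm_of_nonneg (by positivity : 0 ≤ 1 + ‖v‖ ^ 2), div_mul_eq_mul_div,
    div_le_one (by positivity)]
  simp only [Real.norm_ofNat]
  nlinarith [sq_nonneg (1 - ‖v‖)]

lemma ballRetract_of_norm_eq_one {v : Eucl n} (hv : ‖v‖ = 1) : ballRetract v = v := by
  unfold ballRetract
  rw [hv]
  norm_num

@[simp] lemma ballRetract_zero : ballRetract (0 : Eucl n) = 0 := by simp [ballRetract]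

/-- A finite disjoint family `P` almost realizes the variation. On compact cores of its members a
smooth field can equal the optimal directions `-D p / ‖D p‖`; off the cores only a set of small
variation remains. -/
lemma variation_le_tv {v : Eucl n → ℝ} {D : VectorMeasure (Eucl n) (Eucl n)}
    (h : IsDistribGradient v D) {U : Set (Eucl n)} (hU : IsOpen U) :
    D.variation U ≤ tv U v := by
  classical
  have := h.finite
  set μ := D.variation with hμ
  refine ENNReal.le_of_forall_pos_le_add fun ε hε htv => ?_
  -- One `δ` is lost in the choice of the family; the set off the cores has variation at most `2 δ`,
  -- where two fields in the unit ball differ by at most two, costing `4 δ`.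
  obtain ⟨δ, hδ0, hδε⟩ : ∃ δ : ℝ≥0, 0 < δ ∧ 5 * δ ≤ ε := ⟨ε / 5, by positivity, by
    rw [mul_div_cancel₀ _ (by norm_num)]⟩
  obtain ⟨P, hPU, hPd, hPm, hP⟩ := D.exists_variation_le_add hU.measurableSet hδ0
    (measure_ne_top μ U)
  have hpos : (0 : ℝ≥0∞) < δ / (P.card + 1) := ENNReal.div_pos (by simpa using hδ0.ne') (by finiteness)
  have hcpt : ∀ p : Set (Eucl n), ∃ K, K ⊆ p ∧ IsCompact K ∧
      (p ∈ P → μ (p \ K) < δ / (P.card + 1)) := by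
    intro p
    by_cases hp : p ∈ P
    · obtain ⟨K, h1, h2, h3⟩ := (hPm p hp).exists_isCompact_sdiff_lt (measure_ne_top μ p) hpos.ne'
      exact ⟨K, h1, h2, fun _ => h3⟩
    · exact ⟨∅, empty_subset _, isCompact_empty, fun h => absurd h hp⟩
  choose K hKp hKc hKμ using hcpt
  have hbump : ∀ p : Set (Eucl n), ∃ φ : Eucl n → ℝ, p ∈ P → ContDiff ℝ 1 φ ∧
      HasCompactSupport φ ∧ tsupport φ ⊆ U ∧ (∀ x ∈ K p, φ x = 1) ∧
      ∀ q ∈ P, q ≠ p → ∀ x ∈ K q, φ x = 0 := by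
    intro p
    by_cases hp : p ∈ P
    · obtain ⟨φ, h1, h2, h3, -, h4⟩ := exists_contDiff_one_of_isCompact
        (U := U \ ⋃ q ∈ P.erase p, K q) (hKc p)
        (hU.sdiff (isClosed_biUnion_finset fun q _ => (hKc q).isClosed)) (by
          intro x hx
          refine ⟨hPU p hp (hKp p hx), ?_⟩
          simp only [mem_iUnion, not_exists]
          intro q hq hxq
          rw [Finset.mem_erase] at hq
          exact disjoint_left.1 (hPd hq.2 hp hq.1) (hKp q hxq) (hKp p hx))
      refine ⟨φ, fun _ => ⟨h1.of_le (by norm_num), h2, h3.trans sdiff_subset, h4,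
        fun q hq hqp x hx => ?_⟩⟩
      refine image_eq_zero_of_notMem_tsupport fun hxs => (h3 hxs).2 ?_
      simp only [mem_iUnion]
      exact ⟨q, Finset.mem_erase.2 ⟨hqp, hq⟩, hx⟩
    · exact ⟨0, fun h => absurd h hp⟩
  choose φ hφ using hbump
  -- The sign matches the minus in the integration by parts formula.
  set w : Set (Eucl n) → Eucl n := fun p => -(‖D p‖⁻¹ • D p) with hw
  have hw1 : ∀ p, w p = 0 ∨ ‖w p‖ = 1 := by
    intro p
    by_cases h0 : D p = 0
    · left; simp [hw, h0]
    · right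
      rw [hw]
      dsimp only
      rw [norm_neg, norm_smul, norm_inv, norm_norm, inv_mul_cancel₀ (norm_ne_zero_iff.2 h0)]
  have hwle : ∀ p, ‖w p‖ ≤ 1 := fun p => by
    rcases hw1 p with h0 | h0 <;> simp [h0]
  have hwD : ∀ p, inner ℝ (w p) (D p) = -‖D p‖ := by
    intro p
    rw [hw]
    dsimp only
    rw [inner_neg_left, real_inner_smul_left, real_inner_self_eq_norm_sq]
    by_cases h0 : ‖D p‖ = 0
    · simp [h0]
    · field_simp
  set η : Eucl n → Eucl n := fun x => ∑ p ∈ P, φ p x • w p with hη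
  have hηd : ContDiff ℝ 1 η := ContDiff.sum fun p hp => (hφ p hp).1.smul contDiff_const
  have hη0 : ∀ x, (∀ p ∈ P, x ∉ tsupport (φ p)) → η x = 0 := fun x hx =>
    Finset.sum_eq_zero fun p hp => by rw [image_eq_zero_of_notMem_tsupport (hx p hp), zero_smul]
  -- The bumps may overlap off the cores, so `η` can leave the unit ball. The retraction repairs
  -- this without changing the values `w p` on the cores, which are zero or unit vectors.
  set ξ : Eucl n → Eucl n := fun x => ballRetract (η x) with hξ
  have hξd : ContDiff ℝ 1 ξ := contDiff_ballRetract.comp hηd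
  have hcl : IsCompact (⋃ p ∈ P, tsupport (φ p)) :=
    P.finite_toSet.isCompact_biUnion fun p hp => (hφ p hp).2.1
  have hξ0 : ∀ x, x ∉ ⋃ p ∈ P, tsupport (φ p) → ξ x = 0 := by
    intro x hx
    rw [hξ]
    dsimp only
    rw [hη0 x fun p hp hxp => hx (mem_biUnion hp hxp), ballRetract_zero]
  have hξc : HasCompactSupport ξ := HasCompactSupport.intro hcl hξ0
  have hξU : tsupport ξ ⊆ U := by
    refine (closure_minimal (fun x hx => ?_) hcl.isClosed).trans
      (iUnion₂_subset fun p hp => (hφ p hp).2.2.1)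
    by_contra hx'
    exact hx (hξ0 x hx')
  have hξ1 : ∀ x, ‖ξ x‖ ≤ 1 := fun x => norm_ballRetract_le _
  have hξK : ∀ p ∈ P, ∀ x ∈ K p, ξ x = w p := by
    intro p hp x hx
    have : η x = w p := by
      rw [hη]
      dsimp only
      rw [Finset.sum_eq_single p]
      · rw [(hφ p hp).2.2.2.1 x hx, one_smul]
      · intro q hq hqp
        rw [(hφ q hq).2.2.2.2 p hp hqp.symm x hx, zero_smul]
      · exact fun h => absurd hp h
    rw [hξ]
    dsimp only
    rw [this]
    rcases hw1 p with h0 | h0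
    · rw [h0, ballRetract_zero]
    · exact ballRetract_of_norm_eq_one h0
  set s : Eucl n → Eucl n := fun x => ∑ p ∈ P, p.indicator (fun _ => w p) x with hs
  have hsint : ∀ p ∈ P, Integrable (p.indicator fun _ => w p) μ := fun p hp =>
    (integrable_const _).indicator (hPm p hp)
  have hsI : ∫ᵛ x, s x ∂[innerSL ℝ; D] = - ∑ p ∈ P, ‖D p‖ := by
    rw [hs, VectorMeasure.integral_finsetSum _ hsint, ← Finset.sum_neg_distrib]
    refine Finset.sum_congr rfl fun p hp => ?_
    rw [VectorMeasure.integral_indicator_const _ (hPm p hp), innerSL_apply_apply, hwD]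
  have hsp : ∀ p ∈ P, ∀ x ∈ p, s x = w p := by
    intro p hp x hx
    rw [hs]
    dsimp only
    rw [Finset.sum_eq_single p]
    · rw [indicator_of_mem hx]
    · intro q hq hqp
      exact indicator_of_notMem (fun hxq => disjoint_left.1 (hPd hq hp hqp) hxq hx) _
    · exact fun h => absurd hp h
  have hs0 : ∀ x, (∀ p ∈ P, x ∉ p) → s x = 0 := fun x hx =>
    Finset.sum_eq_zero fun p hp => indicator_of_notMem (hx p hp) _
  have hs1 : ∀ x, ‖s x‖ ≤ 1 := by
    intro x
    by_cases hx : ∃ p ∈ P, x ∈ p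
    · obtain ⟨p, hp, hxp⟩ := hx
      rw [hsp p hp x hxp]
      exact hwle p
    · push Not at hx
      rw [hs0 x hx]
      simp
  set B : Set (Eucl n) := U \ ⋃ p ∈ P, K p with hB
  have hBm : MeasurableSet B := hU.measurableSet.diff
    (P.measurableSet_biUnion fun p _ => (hKc p).measurableSet)
  have hBμ : μ B ≤ 2 * δ := by
    have hsub : B ⊆ (U \ ⋃ p ∈ P, p) ∪ ⋃ p ∈ P, p \ K p := by
      rintro x ⟨hxU, hxK⟩
      by_cases hx : x ∈ ⋃ p ∈ P, p
      · right
        simp only [mem_iUnion, exists_prop] at hx ⊢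
        obtain ⟨p, hp, hxp⟩ := hx
        refine ⟨p, hp, hxp, fun h => hxK ?_⟩
        exact mem_biUnion (s := (P : Set (Set (Eucl n)))) hp h
      · exact Or.inl ⟨hxU, hx⟩
    have hPun : MeasurableSet (⋃ p ∈ P, p) := P.measurableSet_biUnion hPm
    have h1 : μ (U \ ⋃ p ∈ P, p) ≤ δ := by
      rw [measure_sdiff (iUnion₂_subset hPU) hPun.nullMeasurableSet (measure_ne_top _ _),
        tsub_le_iff_left]
      refine hP.trans ?_
      gcongr
      rw [show (⋃ p ∈ P, p) = ⋃ p ∈ P, id p from rfl, measure_biUnion_finset hPd hPm]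
      exact Finset.sum_le_sum fun p _ => D.enorm_measure_le_variation p
    have h2 : μ (⋃ p ∈ P, p \ K p) ≤ δ := by
      refine (measure_biUnion_finset_le _ _).trans ?_
      refine (Finset.sum_le_card_nsmul _ _ _ fun p hp => (hKμ p hp).le).trans ?_
      rw [nsmul_eq_mul]
      calc (P.card : ℝ≥0∞) * (δ / (P.card + 1)) ≤ (P.card + 1) * (δ / (P.card + 1)) := by
            gcongr
            exact le_self_add
        _ ≤ δ := ENNReal.mul_div_le
    calc μ B ≤ μ (U \ ⋃ p ∈ P, p) + μ (⋃ p ∈ P, p \ K p) :=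
          (measure_mono hsub).trans (measure_union_le _ _)
      _ ≤ δ + δ := add_le_add h1 h2
      _ = 2 * δ := (two_mul _).symm
  have hdiff : ‖∫ᵛ x, ξ x ∂[innerSL ℝ; D] - ∫ᵛ x, s x ∂[innerSL ℝ; D]‖ₑ ≤ 4 * δ := by
    rw [← VectorMeasure.integral_fun_sub (integrable_of_hasCompactSupport hξd.continuous hξc)
      (integrable_finsetSum _ hsint)]
    calc ‖∫ᵛ x, ξ x - s x ∂[innerSL ℝ; D]‖ₑ
        ≤ ‖innerSL ℝ (E := Eucl n)‖ₑ * ∫⁻ x, ‖ξ x - s x‖ₑ ∂μ :=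
          VectorMeasure.enorm_integral_le_lintegral_enorm
      _ ≤ 1 * ∫⁻ x, B.indicator (fun _ => 2) x ∂μ := by
          gcongr with x
          · rw [← ofReal_norm]
            exact ENNReal.ofReal_le_one.2 (norm_innerSL_le ℝ)
          · by_cases hx : x ∈ B
            · rw [indicator_of_mem hx, ← ofReal_norm]
              refine (ENNReal.ofReal_le_ofReal ((norm_sub_le _ _).trans
                (by linarith [hξ1 x, hs1 x] : _ ≤ (2 : ℝ)))).trans (by simp)
            · rw [indicator_of_notMem hx]
              suffices ξ x = s x by simp [this]
              by_cases hxU : x ∈ U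
              · have hxK : x ∈ ⋃ p ∈ P, K p := by
                  by_contra hxK
                  exact hx ⟨hxU, hxK⟩
                simp only [mem_iUnion, exists_prop] at hxK
                obtain ⟨p, hp, hxp⟩ := hxK
                rw [hξK p hp x hxp, hsp p hp x (hKp p hxp)]
              · rw [hs0 x fun p hp hxp => hxU (hPU p hp hxp)]
                exact image_eq_zero_of_notMem_tsupport fun h => hxU (hξU h)
      _ = 2 * μ B := by rw [one_mul, lintegral_indicator_const hBm]
      _ ≤ 2 * (2 * δ) := by gcongr
      _ = 4 * δ := by rw [← mul_assoc]; norm_num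
  have hmain : ENNReal.ofReal (-∫ᵛ x, ξ x ∂[innerSL ℝ; D]) ≤ tv U v := by
    rw [← h.integral_mul_divergence hξd hξc]
    exact ofReal_integral_le_tv v hξd hξc hξ1 hξU
  calc μ U ≤ ∑ p ∈ P, ‖D p‖ₑ + δ := hP
    _ = ENNReal.ofReal (∑ p ∈ P, ‖D p‖) + δ := by
        rw [ENNReal.ofReal_sum_of_nonneg fun _ _ => norm_nonneg _]
        simp_rw [ofReal_norm]
    _ = ENNReal.ofReal (-∫ᵛ x, ξ x ∂[innerSL ℝ; D] +
          (∫ᵛ x, ξ x ∂[innerSL ℝ; D] - ∫ᵛ x, s x ∂[innerSL ℝ; D])) + δ := by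
        rw [hsI]
        congr 2
        ring
    _ ≤ tv U v + 4 * δ + δ := by
        gcongr
        refine ENNReal.ofReal_add_le.trans (add_le_add hmain (le_trans ?_ hdiff))
        rw [← ofReal_norm]
        exact ENNReal.ofReal_le_ofReal (le_abs_self _)
    _ ≤ tv U v + ε := by
        rw [add_assoc]
        gcongr
        calc (4 * δ + δ : ℝ≥0∞) = ((5 * δ : ℝ≥0) : ℝ≥0∞) := by push_cast; ring
          _ ≤ ε := by exact_mod_cast hδε

lemma variation_eq_tv {v : Eucl n → ℝ} {D : VectorMeasure (Eucl n) (Eucl n)}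
    (h : IsDistribGradient v D) {U : Set (Eucl n)} (hU : IsOpen U) :
    D.variation U = tv U v :=
  le_antisymm (variation_le_tv h hU) (tv_le_variation h hU.measurableSet)

/-! ### Existence of the gradient measure -/

lemma isFiniteMeasure_variation_withDensityᵥ_const (m : Measure (Eucl n)) [IsFiniteMeasure m]
    (e : Eucl n) : IsFiniteMeasure (m.withDensityᵥ fun _ => e).variation := by
  rw [Measure.variation_withDensityᵥ (integrable_const e)]
  exact isFiniteMeasure_withDensity (by simp [lintegral_const, ENNReal.mul_ne_top])

lemma integral_withDensityᵥ_const (m : Measure (Eucl n)) [IsFiniteMeasure m] (e : Eucl n)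
    {f : Eucl n → ℝ} (hf : Integrable f m) :
    ∫ᵛ x, f x ∂•(m.withDensityᵥ fun _ => e) = (∫ x, f x ∂m) • e := by
  have hfin := isFiniteMeasure_variation_withDensityᵥ_const m e
  have hvar : (m.withDensityᵥ fun _ => e).variation = ‖e‖ₑ • m := by
    rw [Measure.variation_withDensityᵥ (integrable_const e), withDensity_const]
  have hint : ∀ {g : Eucl n → ℝ}, Integrable g m →
      Integrable g (m.withDensityᵥ fun _ => e).variation := fun hg => by
    rw [hvar]; exact hg.smul_measure (by simp)
  refine hf.induction (P := fun f => ∫ᵛ x, f x ∂•(m.withDensityᵥ fun _ => e) =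
    (∫ x, f x ∂m) • e) ?_ ?_ ?_ ?_
  · intro c s hs _
    rw [VectorMeasure.integral_indicator_const _ hs, withDensityᵥ_apply (integrable_const e) hs,
      integral_indicator_const _ hs, setIntegral_const]
    simp [smul_smul, mul_comm]
  · intro f g _ hf hg h1 h2
    simp only [Pi.add_apply]
    rw [VectorMeasure.integral_fun_add (hint hf) (hint hg), h1, h2,
      integral_add hf hg, add_smul]
  · refine isClosed_eq ?_ (continuous_integral.smul continuous_const)
    obtain ⟨c, hc⟩ : ∃ c : ℝ≥0, ∀ f g : Eucl n → ℝ, Integrable f m → Integrable g m →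
        edist (∫ᵛ x, f x ∂•(m.withDensityᵥ fun _ => e)) (∫ᵛ x, g x ∂•(m.withDensityᵥ fun _ => e)) ≤
          c * ∫⁻ x, edist (f x) (g x) ∂m := by
      refine ⟨‖(ContinuousLinearMap.lsmul ℝ ℝ : ℝ →L[ℝ] Eucl n →L[ℝ] Eucl n)‖₊ * ‖e‖₊, fun f g hf hg => ?_⟩
      rw [edist_eq_enorm_sub, ← VectorMeasure.integral_fun_sub (hint hf) (hint hg)]
      refine VectorMeasure.enorm_integral_le_lintegral_enorm.trans (le_of_eq ?_)
      rw [hvar, lintegral_smul_measure, smul_eq_mul, ← mul_assoc]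
      simp_rw [edist_eq_enorm_sub]
      rfl
    refine LipschitzWith.continuous (K := c) fun f g => ?_
    rw [L1.edist_def]
    exact hc f g (L1.integrable_coeFn f) (L1.integrable_coeFn g)
  · intro f g hfg _ h
    have hfg' : f =ᵐ[(m.withDensityᵥ fun _ => e).variation] g := by
      rw [hvar]; exact Measure.ae_smul_measure hfg _
    rw [← VectorMeasure.integral_congr_ae hfg', ← integral_congr_ae hfg, h]

lemma divergence_smul_const {φ : Eucl n → ℝ} (hφ : ContDiff ℝ 1 φ) (e x : Eucl n) :
    divergence (fun y => φ y • e) x = fderiv ℝ φ x e := by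
  have h := divergence_smul hφ (contDiff_const (c := e)) x
  have h0 : divergence (fun _ : Eucl n => e) x = 0 := by simp [divergence]
  rw [h0] at h
  simpa using h

/-- The positive and negative parts of the partial derivatives of the mollifications have bounded
mass in a fixed ball, hence are relatively compact as measures. Their weak limits represent the
partial derivative of `v`. -/
lemma exists_measures_of_tv_ne_top {v : Eucl n → ℝ} (hv : Integrable v) {R M : ℝ}
    (hR : ∀ x, R < ‖x‖ → v x = 0) (hM : ∀ x, |v x| ≤ M) (htv : tv univ v ≠ ∞) (i : Fin n) :
    ∃ p q : FiniteMeasure (Eucl n), ∀ φ : Eucl n → ℝ, ContDiff ℝ 1 φ → HasCompactSupport φ →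
      ∫ x, v x * fderiv ℝ φ x (EuclideanSpace.single i 1) =
        -(∫ x, φ x ∂(p : Measure (Eucl n)) - ∫ x, φ x ∂(q : Measure (Eucl n))) := by
  obtain ⟨w, hw1, hw2, hw3, hw4, hw5⟩ := exists_smooth_approx hv hR
  set e : Eucl n := EuclideanSpace.single i 1 with he
  have he1 : ‖e‖ₑ = 1 := by rw [← ofReal_norm]; simp [he]
  set g : ℕ → Eucl n → ℝ := fun j x => fderiv ℝ (w j) x e with hg
  have hgc : ∀ j, Continuous (g j) := fun j =>
    ((hw1 j).continuous_fderiv (by simp)).clm_apply continuous_const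
  have hg0 : ∀ j x, R + 1 < ‖x‖ → g j x = 0 := by
    intro j x hx
    have : w j =ᶠ[𝓝 x] fun _ => 0 := by
      filter_upwards [(isOpen_lt continuous_const continuous_norm).mem_nhds hx] with y hy
      exact hw2 j y hy
    simp [hg, this.fderiv_eq]
  have hgle : ∀ j, ∫⁻ x, ‖g j x‖ₑ ≤ tv univ v := fun j => by
    refine (lintegral_mono fun x => ?_).trans (hw4 j)
    calc ‖g j x‖ₑ ≤ ‖fderiv ℝ (w j) x‖ₑ * ‖e‖ₑ := ContinuousLinearMap.le_opENorm _ _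
      _ = _ := by rw [he1, mul_one]
  set C : ℝ≥0 := (tv univ v).toNNReal with hC
  have hCtv : (C : ℝ≥0∞) = tv univ v := ENNReal.coe_toNNReal htv
  set K : Set (Eucl n) := Metric.closedBall 0 (R + 1) with hK
  -- The signs `σ = 1` and `σ = -1` give the two parts. Limits along one fixed ultrafilter serve
  -- both at once, with no extraction of subsequences.
  have key : ∀ σ : ℝ, |σ| = 1 → ∃ p : FiniteMeasure (Eucl n), ∃ ν : ℕ → FiniteMeasure (Eucl n),
      (∀ j, (ν j : Measure (Eucl n)) = volume.withDensity fun x => ENNReal.ofReal (σ * g j x)) ∧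
      Tendsto ν (hyperfilter ℕ) (𝓝 p) := by
    intro σ hσ
    have hle : ∀ j, ∫⁻ x, ENNReal.ofReal (σ * g j x) ≤ C := fun j => by
      rw [hCtv]
      refine (lintegral_mono fun x => ?_).trans (hgle j)
      rw [← ofReal_norm]
      refine ENNReal.ofReal_le_ofReal ((le_abs_self _).trans ?_)
      rw [abs_mul, hσ, one_mul, Real.norm_eq_abs]
    have hfin : ∀ j, IsFiniteMeasure (volume.withDensity fun x => ENNReal.ofReal (σ * g j x)) :=
      fun j => isFiniteMeasure_withDensity ((hle j).trans_lt ENNReal.coe_lt_top).ne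
    let ν : ℕ → FiniteMeasure (Eucl n) := fun j => ⟨_, hfin j⟩
    have hmem : ∀ j, ν j ∈ {μ : FiniteMeasure (Eucl n) | μ.mass ≤ C ∧ μ Kᶜ = 0} := by
      intro j
      constructor
      · rw [← ENNReal.coe_le_coe, FiniteMeasure.ennreal_mass]
        change (volume.withDensity fun x => ENNReal.ofReal (σ * g j x)) univ ≤ C
        rw [withDensity_apply _ MeasurableSet.univ, setLIntegral_univ]
        exact hle j
      · rw [FiniteMeasure.null_iff_toMeasure_null]
        change (volume.withDensity fun x => ENNReal.ofReal (σ * g j x)) Kᶜ = 0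
        rw [withDensity_apply _ Metric.isClosed_closedBall.measurableSet.compl]
        refine setLIntegral_eq_zero Metric.isClosed_closedBall.measurableSet.compl fun x hx => ?_
        rw [hg0 j x (by simpa [hK] using hx)]
        simp
    obtain ⟨p, -, hp⟩ := (isCompact_setOfPred_finiteMeasure_le_of_isCompact C
      (isCompact_closedBall (0 : Eucl n) (R + 1))).ultrafilter_le_nhds'
      ((hyperfilter ℕ).map ν) (Filter.Eventually.of_forall hmem : ∀ᶠ j in (hyperfilter ℕ : Filter ℕ), _)
    exact ⟨p, ν, fun j => rfl, hp⟩
  obtain ⟨p, ν, hν, hp⟩ := key 1 (by simp)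
  obtain ⟨q, ν', hν', hq⟩ := key (-1) (by simp)
  refine ⟨p, q, fun φ hφ hc => ?_⟩
  have hξ : ContDiff ℝ 1 fun y => φ y • e := hφ.smul contDiff_const
  have hξc : HasCompactSupport fun y => φ y • e := hc.smul_right (f' := fun _ => e)
  have lim1 := tendsto_integral_mul_divergence (fun j => (hw1 j).continuous.aestronglyMeasurable)
    (hw5 M hM) hw3 hξ hξc
  simp_rw [divergence_smul_const hφ] at lim1
  obtain ⟨B, hB⟩ := hφ.continuous.bounded_above_of_compact_support hc
  let φb : BoundedContinuousFunction (Eucl n) ℝ :=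
    BoundedContinuousFunction.ofNormedAddCommGroup φ hφ.continuous B hB
  have lim2 := (FiniteMeasure.tendsto_iff_forall_integral_tendsto.1 hp φb).sub
    (FiniteMeasure.tendsto_iff_forall_integral_tendsto.1 hq φb)
  refine tendsto_nhds_unique (lim1.mono_left Nat.hyperfilter_le_atTop) ?_
  refine lim2.neg.congr fun j => ?_
  have hd : ∀ σ : ℝ, ∫ x, φ x ∂(volume.withDensity fun x => ENNReal.ofReal (σ * g j x)) =
      ∫ x, max (σ * g j x) 0 * φ x := by
    intro σ
    rw [integral_withDensity_eq_integral_toReal_smul]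
    · simp [ENNReal.toReal_ofReal']
    · exact ((hgc j).measurable.const_mul σ).ennreal_ofReal
    · simp
  have hint : ∀ σ : ℝ, Integrable fun x => max (σ * g j x) 0 * φ x := fun σ =>
    (((continuous_const.mul (hgc j)).max continuous_const).mul
      hφ.continuous).integrable_of_hasCompactSupport hc.mul_left
  have h3 := integral_mul_divergence ((hw1 j).of_le (by norm_num)) hξ hξc
  simp_rw [divergence_smul_const hφ] at h3
  rw [h3]
  change -(∫ x, φ x ∂(ν j : Measure (Eucl n)) - ∫ x, φ x ∂(ν' j : Measure (Eucl n))) = _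
  rw [hν, hν', hd, hd, ← integral_sub (hint 1) (hint (-1))]
  congr 2
  ext x
  rw [map_smul, smul_eq_mul, ← sub_mul, mul_comm]
  congr 1
  change _ = g j x
  rcases le_total 0 (g j x) with h | h
  · rw [max_eq_left (by linarith), max_eq_right (by linarith)]; ring
  · rw [max_eq_right (by linarith), max_eq_left (by linarith)]; ring

lemma exists_isDistribGradient {v : Eucl n → ℝ} (hv : Integrable v) {R M : ℝ}
    (hR : ∀ x, R < ‖x‖ → v x = 0) (hM : ∀ x, |v x| ≤ M) (htv : tv univ v ≠ ∞) :
    ∃ D, IsDistribGradient v D := by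
  choose p q hpq using exists_measures_of_tv_ne_top hv hR hM htv
  let e : Fin n → Eucl n := fun i => EuclideanSpace.single i 1
  let P : Fin n → VectorMeasure (Eucl n) (Eucl n) := fun i =>
    (p i : Measure (Eucl n)).withDensityᵥ fun _ => e i
  let Q : Fin n → VectorMeasure (Eucl n) (Eucl n) := fun i =>
    (q i : Measure (Eucl n)).withDensityᵥ fun _ => e i
  have hP : ∀ i, IsFiniteMeasure (P i).variation := fun i =>
    isFiniteMeasure_variation_withDensityᵥ_const _ _
  have hQ : ∀ i, IsFiniteMeasure (Q i).variation := fun i =>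
    isFiniteMeasure_variation_withDensityᵥ_const _ _
  have hPQ : ∀ i, IsFiniteMeasure (P i - Q i).variation := fun i =>
    isFiniteMeasure_of_le _ VectorMeasure.variation_sub_le
  refine ⟨∑ i, (P i - Q i), hv.locallyIntegrable,
    isFiniteMeasure_of_le _ (VectorMeasure.variation_finsetSum_le _ _), fun φ hφ hc => ?_⟩
  have hI : ∀ (m : Measure (Eucl n)) [IsFiniteMeasure m], Integrable φ m := fun m _ =>
    integrable_of_hasCompactSupport hφ.continuous hc
  have h1 : ∫ᵛ x, φ x ∂•(∑ i, (P i - Q i)) =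
      ∑ i, (∫ x, φ x ∂(p i : Measure (Eucl n)) - ∫ x, φ x ∂(q i : Measure (Eucl n))) • e i := by
    rw [VectorMeasure.integral_finsetSum_vectorMeasure fun i _ => hI _]
    refine Finset.sum_congr rfl fun i _ => ?_
    rw [VectorMeasure.integral_sub_vectorMeasure (hI _) (hI _), sub_smul,
      integral_withDensityᵥ_const _ _ (hI _), integral_withDensityᵥ_const _ _ (hI _)]
  rw [h1, ← sum_coord_smul_single (∫ x, v x • gradient φ x), ← Finset.sum_neg_distrib]
  refine Finset.sum_congr rfl fun i _ => ?_
  rw [← neg_smul, ← hpq i φ hφ hc]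
  congr 1
  have hint : Integrable fun x => v x • gradient φ x :=
    hv.locallyIntegrable.integrable_smul_right_of_hasCompactSupport (continuous_gradient hφ)
      (hasCompactSupport_gradient hc)
  have h2 := (EuclideanSpace.proj i : Eucl n →L[ℝ] ℝ).integral_comp_comm hint
  simp_rw [← gradient_apply]
  simpa using h2.symm

lemma gradMeasure_spec {v : Eucl n → ℝ} (h : ∃ D, IsDistribGradient v D) :
    IsDistribGradient v (gradMeasure v) := by
  unfold gradMeasure
  rw [dif_pos h]
  exact h.choose_spec

/-- This inequality survives when no finite gradient measure exists, since then `gradMeasure` is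
zero. -/
lemma variation_gradMeasure_le (v : Eucl n → ℝ) {U : Set (Eucl n)} (hU : IsOpen U) :
    (gradMeasure v).variation U ≤ tv U v := by
  by_cases h : ∃ D, IsDistribGradient v D
  · exact variation_le_tv (gradMeasure_spec h) hU
  · simp [gradMeasure, dif_neg h]

/-! ### Volume near boundary points of normalized sets -/

lemma tv_eq_zero_of_ae_eq_zero {v : Eucl n → ℝ} {U : Set (Eucl n)}
    (h : ∀ᵐ x, x ∈ U → v x = 0) : tv U v = 0 := by
  refine le_antisymm (tv_le_iff.2 fun ξ h1 h2 h3 h4 => ?_) zero_le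
  rw [integral_eq_zero_of_ae]
  · simp
  · filter_upwards [h] with x hx
    by_cases hxU : x ∈ U
    · simp [hx hxU]
    · simp [divergence_eq_zero_of_notMem_tsupport fun h => hxU (h4 h)]

lemma volume_inter_pos_of_mem_reducedBoundary {F : Set (Eucl n)} {x : Eucl n}
    (hx : x ∈ reducedBoundary F) {r : ℝ} (hr : 0 < r) : 0 < volume (F ∩ Metric.ball x r) := by
  rw [pos_iff_ne_zero]
  intro h0
  have h1 := variation_gradMeasure_le (F.indicator (1 : Eucl n → ℝ)) (Metric.isOpen_ball (x := x) (ε := r))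
  rw [tv_eq_zero_of_ae_eq_zero] at h1
  · exact (hx.1 r hr).not_ge h1
  · filter_upwards [measure_eq_zero_iff_ae_notMem.1 h0] with y hy hyb
    exact indicator_of_notMem (fun hyF => hy ⟨hyF, hyb⟩) _

/-- Near a boundary point there is a point of the reduced boundary, where `|Dχ_F|` charges every
ball, so `F` cannot be null there. The normalization of the sets enters the proof only through this
fact. -/
lemma volume_inter_pos_of_mem_frontier {F : Set (Eucl n)} (hF : IsNormalized F) {x : Eucl n}
    (hx : x ∈ frontier F) {U : Set (Eucl n)} (hU : IsOpen U) (hxU : x ∈ U) :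
    0 < volume (F ∩ U) := by
  rw [hF] at hx
  obtain ⟨y, hyU, hy⟩ := mem_closure_iff.1 hx U hU hxU
  obtain ⟨r, hr, hrU⟩ := Metric.isOpen_iff.1 hU y hyU
  exact (volume_inter_pos_of_mem_reducedBoundary hy hr).trans_le
    (measure_mono (inter_subset_inter_right _ hrU))

/-! ### Outward minimizing sets and the minimizing movement step -/

/-- `E` is outward minimizing in `Ω` up to null sets. -/
structure IsOutwardMinimizingAE (Ω E : Set (Eucl n)) : Prop where
  measurable : NullMeasurableSet E
  subset : E ≤ᵐ[volume] Ω
  perimeter_le : ∀ F : Set (Eucl n), NullMeasurableSet F → E ≤ᵐ[volume] F → F ≤ᵐ[volume] Ω →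
    perimeter E ≤ perimeter F

lemma IsOutwardMinimizing.ae {Ω E : Set (Eucl n)} (h : IsOutwardMinimizing Ω E)
    (hΩ : MeasurableSet Ω) : IsOutwardMinimizingAE Ω E := by
  refine ⟨h.measurable, h.subset.eventuallyLE, fun F hF hEF hFΩ => ?_⟩
  -- An almost everywhere competitor is modified on a null set into one satisfying the inclusions
  -- exactly.
  have hae : ((F ∪ E) ∩ Ω : Set (Eucl n)) =ᵐ[volume] F := by
    filter_upwards [hEF, hFΩ] with x (h1 : x ∈ E → x ∈ F) (h2 : x ∈ F → x ∈ Ω)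
    refine propext ⟨fun hx => ?_, fun hx => ⟨Or.inl hx, h2 hx⟩⟩
    exact hx.1.elim id h1
  rw [← perimeter_congr_ae hae]
  exact h.perimeter_le _ ((hF.union h.measurable).inter hΩ.nullMeasurableSet)
    (fun x hx => ⟨Or.inr hx, h.subset hx⟩) inter_subset_right

/-- By coarea, some superlevel set of a smooth cutoff between `closure E` and `Ω` has finite
perimeter, and it is an admissible competitor. -/
lemma IsOutwardMinimizing.perimeter_ne_top {Ω E : Set (Eucl n)} (h : IsOutwardMinimizing Ω E)
    (hE : Bornology.IsBounded E) (hΩ : IsOpen Ω) (hEΩ : closure E ⊆ Ω) : perimeter E ≠ ∞ := by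
  obtain ⟨φ, h1, h2, h3, h4, h5⟩ := exists_contDiff_one_of_isCompact hE.isCompact_closure hΩ hEΩ
  obtain ⟨G, hG, hG1, hG2⟩ := exists_perimeter_superlevel_le (h1.of_le (by norm_num))
  have hfin : ∫⁻ x, ‖fderiv ℝ φ x‖ₑ < ∞ :=
    ((h1.continuous_fderiv (by simp)).integrable_of_hasCompactSupport
      (h2.fderiv ℝ) : Integrable _ volume).hasFiniteIntegral
  have hlt : ∫⁻ t in Ioo (0 : ℝ) 1, G t < ∞ :=
    (lintegral_mono_set Ioo_subset_Ioi_self).trans_lt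
      ((hG2 0).trans_lt ((setLIntegral_le_lintegral _ _).trans_lt hfin))
  obtain ⟨t, ht, hGt⟩ : ∃ t ∈ Ioo (0 : ℝ) 1, G t < ∞ := by
    by_contra! hcon
    have : ∫⁻ t in Ioo (0 : ℝ) 1, G t = ∞ := by
      rw [setLIntegral_congr_fun measurableSet_Ioo (g := fun _ => ∞)
        fun t ht => top_le_iff.1 (hcon t ht)]
      simp
    exact hlt.ne this
  refine ne_top_of_le_ne_top hGt.ne ((h.perimeter_le {x | t < φ x} ?_ ?_ ?_).trans (hG1 t))
  · exact (measurableSet_lt measurable_const h1.continuous.measurable).nullMeasurableSet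
  · intro x hx
    rw [mem_ofPred_eq, h5 x (subset_closure hx)]
    exact ht.2
  · intro x hx
    by_contra hxΩ
    rw [mem_ofPred_eq, image_eq_zero_of_notMem_tsupport fun h => hxΩ (h3 h)] at hx
    exact hx.not_gt ht.1

lemma inter_ae_eq_left_of_ae_le {E F : Set (Eucl n)} (h : E ≤ᵐ[volume] F) :
    (E ∩ F : Set (Eucl n)) =ᵐ[volume] E := by
  filter_upwards [h] with x (hx : x ∈ E → x ∈ F)
  exact propext ⟨fun h => h.1, fun h => ⟨h, hx h⟩⟩

lemma perimeter_inter_add_perimeter_union_le_of_ae {E F : Set (Eucl n)} (hE : NullMeasurableSet E)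
    (hF : NullMeasurableSet F) {R : ℝ} (hER : E ≤ᵐ[volume] Metric.closedBall 0 R)
    (hFR : F ≤ᵐ[volume] Metric.closedBall 0 R) :
    perimeter (E ∩ F) + perimeter (E ∪ F) ≤ perimeter E + perimeter F := by
  set B : Set (Eucl n) := Metric.closedBall 0 R with hB
  have hBm : NullMeasurableSet B := Metric.isClosed_closedBall.measurableSet.nullMeasurableSet
  have h1 : (E ∩ B : Set (Eucl n)) =ᵐ[volume] E := inter_ae_eq_left_of_ae_le hER
  have h2 : (F ∩ B : Set (Eucl n)) =ᵐ[volume] F := inter_ae_eq_left_of_ae_le hFR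
  rw [← perimeter_congr_ae h1, ← perimeter_congr_ae h2, ← perimeter_congr_ae (h1.inter h2),
    ← perimeter_congr_ae (h1.union h2)]
  exact perimeter_inter_add_perimeter_union_le (hE.inter hBm) (hF.inter hBm) inter_subset_right
    inter_subset_right

lemma frontier_subset_closure_of_isNormalized {F E : Set (Eucl n)} (hF : IsNormalized F)
    (hFE : F ≤ᵐ[volume] E) : frontier F ⊆ closure E := by
  intro x hx
  by_contra hxE
  refine (volume_inter_pos_of_mem_frontier hF hx isClosed_closure.isOpen_compl hxE).ne' ?_
  have hsub : F ∩ (closure E)ᶜ ⊆ F \ E := fun y hy => ⟨hy.1, fun h => hy.2 (subset_closure h)⟩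
  exact measure_mono_null hsub (ae_le_set.1 hFE)

lemma functional_self (h : ℝ) (F : Set (Eucl n)) : functional h F F = perimeter F := by
  simp [functional]

section Step

variable {h : ℝ} {E F : Set (Eucl n)}

lemma perimeter_le_of_minimizer
    (hmin : ∀ G : Set (Eucl n), NullMeasurableSet G → functional h E F ≤ functional h G F)
    (hF : NullMeasurableSet F) : perimeter E ≤ perimeter F :=
  le_self_add.trans ((hmin F hF).trans (functional_self h F).le)

lemma lintegral_infEDist_le_of_minimizer (hh : 0 < h)
    (hmin : ∀ G : Set (Eucl n), NullMeasurableSet G → functional h E F ≤ functional h G F)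
    (hF : NullMeasurableSet F) :
    ∫⁻ x in E ∆ F, Metric.infEDist x (frontier F) ≤ ENNReal.ofReal h * perimeter F := by
  have h1 : (∫⁻ x in E ∆ F, Metric.infEDist x (frontier F)) / ENNReal.ofReal h ≤ perimeter F :=
    le_add_self.trans ((hmin F hF).trans (functional_self h F).le)
  rwa [ENNReal.div_le_iff' (by simpa using hh) ENNReal.ofReal_ne_top] at h1

/-- Comparison of a minimizer with a competitor whose symmetric difference with `F` exceeds the
one of the minimizer at most by `S`. -/
lemma perimeter_le_add_of_functional_le (hh : 0 < h) {G S : Set (Eucl n)}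
    (hmin : functional h E F ≤ functional h G F)
    (hfin : ∫⁻ x in E ∆ F, Metric.infEDist x (frontier F) ≠ ∞)
    (hG : G ∆ F ≤ᵐ[volume] (E ∆ F ∪ S : Set (Eucl n))) :
    perimeter E ≤
      perimeter G + (∫⁻ x in S, Metric.infEDist x (frontier F)) / ENNReal.ofReal h := by
  set I := (∫⁻ x in E ∆ F, Metric.infEDist x (frontier F)) / ENNReal.ofReal h with hI
  -- In `[0, ∞]` the common distance term can only be cancelled because it is finite.
  have hIfin : I ≠ ∞ := ENNReal.div_ne_top hfin (by simpa using hh)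
  refine ENNReal.le_of_add_le_add_right hIfin (hmin.trans ?_)
  unfold functional
  rw [add_assoc, ← ENNReal.add_div]
  gcongr
  rw [add_comm]
  exact (lintegral_mono_set' hG).trans (lintegral_union_le _ _ _)

lemma perimeter_le_of_functional_le (hh : 0 < h) {G : Set (Eucl n)}
    (hmin : functional h E F ≤ functional h G F)
    (hfin : ∫⁻ x in E ∆ F, Metric.infEDist x (frontier F) ≠ ∞)
    (hG : G ∆ F ≤ᵐ[volume] (E ∆ F : Set (Eucl n))) :
    perimeter E ≤ perimeter G := by
  have := perimeter_le_add_of_functional_le hh (S := ∅) hmin hfin (by simpa using hG)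
  simpa using this

end Step

/-- Energy comparison with `F` gives `∫_{E Δ F} d ≤ h P(E₀)`. On a ball of radius `δ / 4` centred
outside the neighbourhood, `d` is at least that radius, so `E` has small density there for small
`h`. The threshold does not depend on `F`, so it serves all steps. -/
lemma exists_timestep_ae_subset_thickening (hn : 2 ≤ n) {E₀ : Set (Eucl n)}
    (hP : perimeter E₀ ≠ ∞) {δ : ℝ} (hδ : 0 < δ) :
    ∃ h₀ > 0, ∀ h : ℝ, 0 < h → h ≤ h₀ → ∀ E F : Set (Eucl n), NullMeasurableSet E →
      NullMeasurableSet F → IsNormalized F → F ≤ᵐ[volume] E₀ → perimeter F ≤ perimeter E₀ →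
      (∀ G : Set (Eucl n), NullMeasurableSet G → functional h E F ≤ functional h G F) →
      E ≤ᵐ[volume] Metric.thickening δ E₀ := by
  obtain ⟨c, hc0, hc⟩ := exists_density_const hn le_rfl
  set P := (perimeter E₀).toReal with hPdef
  have hP0 : 0 ≤ P := ENNReal.toReal_nonneg
  set r := δ / 4 with hr
  have hr0 : 0 < r := by positivity
  -- Chosen so that `h P ≤ r (c r ^ n)`; the `+ 1` avoids division by zero.
  refine ⟨c * r ^ n * r / (P + 1), by positivity, fun h hh hh0 E F hE hF hFn hFE hPF hmin => ?_⟩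
  have hPFfin : perimeter F ≠ ∞ := ne_top_of_le_ne_top hP hPF
  have hPE := perimeter_le_of_minimizer hmin hF
  have hint := lintegral_infEDist_le_of_minimizer hh hmin hF
  have hfin : ∫⁻ x in E ∆ F, Metric.infEDist x (frontier F) ≠ ∞ :=
    ne_top_of_le_ne_top (ENNReal.mul_ne_top ENNReal.ofReal_ne_top hPFfin) hint
  have hFnull : volume (F \ E₀) = 0 := ae_le_set.1 hFE
  have hloc : ∀ x, x ∉ Metric.thickening δ E₀ → volume (E ∩ Metric.ball x (r / 2)) = 0 := by
    intro x hx
    have hxd : ENNReal.ofReal δ ≤ Metric.infEDist x E₀ := by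
      rwa [Metric.mem_thickening_iff_infEDist_lt, not_lt] at hx
    have hball : ∀ y ∈ Metric.ball x r, ENNReal.ofReal r ≤ Metric.infEDist y E₀ := by
      intro y hy
      have h1 : Metric.infEDist x E₀ ≤ Metric.infEDist y E₀ + edist x y :=
        Metric.infEDist_le_infEDist_add_edist
      have h2 : edist x y ≤ ENNReal.ofReal r := by
        rw [edist_comm, edist_dist]
        exact ENNReal.ofReal_le_ofReal (Metric.mem_ball.1 hy).le
      have h3 : ENNReal.ofReal r + ENNReal.ofReal r ≤ Metric.infEDist y E₀ + ENNReal.ofReal r := by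
        rw [← ENNReal.ofReal_add hr0.le hr0.le]
        exact (ENNReal.ofReal_le_ofReal (by rw [hr]; linarith)).trans
          (hxd.trans (h1.trans (by gcongr)))
      exact ENNReal.le_of_add_le_add_right ENNReal.ofReal_ne_top h3
    have hballF : ∀ y ∈ Metric.ball x r, ENNReal.ofReal r ≤ Metric.infEDist y (frontier F) := by
      intro y hy
      refine (hball y hy).trans ?_
      rw [← Metric.infEDist_closure]
      exact Metric.infEDist_anti (frontier_subset_closure_of_isNormalized hFn hFE)
    have hball0 : ∀ y ∈ Metric.ball x r, y ∉ E₀ := by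
      intro y hy hy0
      have := hball y hy
      rw [Metric.infEDist_zero_of_mem hy0] at this
      simp [hr0.not_ge] at this
    -- Removing a ball disjoint from `F` up to a null set only shrinks `E Δ F`, so no volume term is
    -- needed: `Λ = L = 0`.
    refine hc E x r 0 hr0 (by simp) hE (ne_top_of_le_ne_top hPFfin hPE) (fun s _ hsr => ?_) ?_
    · simp only [ENNReal.ofReal_zero, zero_mul, add_zero]
      refine perimeter_le_of_functional_le hh (hmin _ (hE.diff
        Metric.isOpen_ball.measurableSet.nullMeasurableSet)) hfin ?_
      filter_upwards [hFE] with y (hy : y ∈ F → y ∈ E₀) hyG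
      rcases hyG with ⟨⟨h1, -⟩, h2⟩ | ⟨h1, h2⟩
      · exact Or.inl ⟨h1, h2⟩
      · refine Or.inr ⟨h1, fun hyE => h2 ⟨hyE, fun hyb => ?_⟩⟩
        exact hball0 y (Metric.ball_subset_ball hsr hyb) (hy h1)
    · have h1 : ENNReal.ofReal r * volume (E ∩ Metric.ball x r) ≤
          ENNReal.ofReal h * ENNReal.ofReal P := by
        have hsub : F ∩ Metric.ball x r ⊆ F \ E₀ := fun y hy => ⟨hy.1, hball0 y hy.2⟩
        have hnull := measure_mono_null hsub hFnull
        calc ENNReal.ofReal r * volume (E ∩ Metric.ball x r)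
            = ∫⁻ y in E ∩ Metric.ball x r, ENNReal.ofReal r := by simp
          _ ≤ ∫⁻ y in E ∩ Metric.ball x r, Metric.infEDist y (frontier F) :=
              lintegral_mono_ae ((ae_restrict_mem₀ (hE.inter
                Metric.isOpen_ball.measurableSet.nullMeasurableSet)).mono
                fun y hy => hballF y hy.2)
          _ ≤ ∫⁻ y in E ∆ F, Metric.infEDist y (frontier F) := by
              refine lintegral_mono_set' ?_
              filter_upwards [measure_eq_zero_iff_ae_notMem.1 hnull] with y hy hyE
              exact Or.inl ⟨hyE.1, fun h => hy ⟨h, hyE.2⟩⟩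
          _ ≤ ENNReal.ofReal h * perimeter F := hint
          _ ≤ ENNReal.ofReal h * ENNReal.ofReal P := by
              rw [hPdef, ENNReal.ofReal_toReal hP]
              gcongr
      have h2 : r * volume.real (E ∩ Metric.ball x r) ≤ h * P := by
        have h3 := ENNReal.toReal_mono (by finiteness) h1
        rwa [ENNReal.toReal_mul, ENNReal.toReal_mul, ENNReal.toReal_ofReal hr0.le,
          ENNReal.toReal_ofReal hh.le, ENNReal.toReal_ofReal hP0] at h3
      have h4 : h * (P + 1) ≤ c * r ^ n * r := by
        rwa [le_div_iff₀ (by positivity)] at hh0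
      have h5 : r * volume.real (E ∩ Metric.ball x r) ≤ r * (c * r ^ n) := by nlinarith
      exact le_of_mul_le_mul_left h5 hr0
  rw [ae_le_set]
  refine measure_null_of_locally_null _ fun x hx => ⟨_, inter_mem self_mem_nhdsWithin
    (mem_nhdsWithin_of_mem_nhds (Metric.ball_mem_nhds x (by positivity : 0 < r / 2))), ?_⟩
  exact measure_mono_null (inter_subset_inter_left _ sdiff_subset) (hloc x hx.2)

/-! ### Monotonicity of the scheme -/

lemma exists_density_point {S : Set (Eucl n)} (hS : NullMeasurableSet S) (hS0 : volume S ≠ 0)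
    {p : Eucl n → Prop} (hp : ∀ᵐ x ∂volume.restrict S, p x) {c : ℝ} (hc : 0 < c) :
    ∃ x, p x ∧ ∃ r, 0 < r ∧ r ≤ 1 ∧ volume.real (Metric.ball x r \ S) ≤ c * r ^ n := by
  have hne : (ae (volume.restrict S)).NeBot := by
    rw [ae_neBot, ne_eq, Measure.restrict_eq_zero]
    exact hS0
  obtain ⟨x, hpx, hx⟩ := (hp.and (Besicovitch.ae_tendsto_measure_inter_div volume S)).exists
  refine ⟨x, hpx, ?_⟩
  set ω := volume.real (Metric.ball (0 : Eucl n) 1) with hω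
  have hω0 : 0 ≤ ω := measureReal_nonneg
  set η := c / (ω + 1) with hη
  have hη0 : 0 < η := by positivity
  have hlim : Tendsto (fun r => volume.real (S ∩ Metric.closedBall x r) /
      volume.real (Metric.closedBall x r)) (𝓝[>] 0) (𝓝 1) := by
    have := (ENNReal.tendsto_toReal ENNReal.one_ne_top).comp hx
    simpa [Function.comp_def, ENNReal.toReal_div, Measure.real] using this
  have h1 := hlim.eventually (lt_mem_nhds (show 1 - η < 1 by linarith))
  have h2 : ∀ᶠ r : ℝ in 𝓝[>] 0, r ∈ Ioc (0 : ℝ) 1 := Ioc_mem_nhdsGT one_pos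
  obtain ⟨r, hr1, hr0, hr⟩ := (h1.and h2).exists
  refine ⟨r, hr0, hr, ?_⟩
  have hvol : volume.real (Metric.closedBall x r) = r ^ n * ω := by
    rw [Measure.addHaar_real_closedBall _ _ hr0.le]
    simp [hω]
  have hpos : 0 < volume.real (Metric.closedBall x r) :=
    ENNReal.toReal_pos (Metric.measure_closedBall_pos volume x hr0).ne'
      measure_closedBall_lt_top.ne
  rw [lt_div_iff₀ hpos] at hr1
  have hsplit := measureReal_inter_add_sdiff₀ (μ := volume) (s := Metric.closedBall x r) hS
    measure_closedBall_lt_top.ne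
  rw [inter_comm] at hsplit
  calc volume.real (Metric.ball x r \ S) ≤ volume.real (Metric.closedBall x r \ S) :=
        measureReal_mono (sdiff_subset_sdiff_left Metric.ball_subset_closedBall)
          (measure_ne_top_of_subset sdiff_subset measure_closedBall_lt_top.ne)
    _ ≤ η * (r ^ n * ω) := by rw [← hvol]; nlinarith
    _ = c * r ^ n * (ω / (ω + 1)) := by rw [hη]; ring
    _ ≤ c * r ^ n := by
        refine mul_le_of_le_one_right (by positivity) ?_
        rw [div_le_one (by positivity)]
        linarith

section Step

variable {h : ℝ} {E F Ω : Set (Eucl n)}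

/-- A minimizer contained in the domain of outward minimality of `F` is contained in `F`. -/
lemma minimizer_ae_subset (hn : 2 ≤ n) (hh : 0 < h) {R : ℝ}
    (hΩR : Ω ≤ᵐ[volume] Metric.closedBall (0 : Eucl n) R)
    (hE : NullMeasurableSet E) (hFn : IsNormalized F) (hF : IsOutwardMinimizingAE Ω F)
    (hP : perimeter F ≠ ∞)
    (hmin : ∀ G : Set (Eucl n), NullMeasurableSet G → functional h E F ≤ functional h G F)
    (hEΩ : E ≤ᵐ[volume] Ω) : E ≤ᵐ[volume] F := by
  set d : Eucl n → ℝ≥0∞ := fun x => Metric.infEDist x (frontier F) with hd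
  have hFm := hF.measurable
  have hPE := perimeter_le_of_minimizer hmin hFm
  have hPEfin : perimeter E ≠ ∞ := ne_top_of_le_ne_top hP hPE
  have hfin : ∫⁻ x in E ∆ F, d x ≠ ∞ :=
    ne_top_of_le_ne_top (ENNReal.mul_ne_top ENNReal.ofReal_ne_top hP)
      (lintegral_infEDist_le_of_minimizer hh hmin hFm)
  have hsub := perimeter_inter_add_perimeter_union_le_of_ae hE hFm (hEΩ.trans hΩR)
    (hF.subset.trans hΩR)
  have hPU : perimeter F ≤ perimeter (E ∪ F) := by
    refine hF.perimeter_le _ (hE.union hFm) subset_union_right.eventuallyLE ?_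
    filter_upwards [hEΩ, hF.subset] with x h1 h2 hx
    exact hx.elim h1 h2
  have hAm : NullMeasurableSet (E ∩ F) := hE.inter hFm
  -- Submodularity, with `P(F) ≤ P(E ∪ F)` cancelled by outward minimality.
  have hPA : perimeter (E ∩ F) ≤ perimeter E :=
    ENNReal.le_of_add_le_add_right hP ((add_le_add_right hPU _).trans hsub)
  have hPAfin : perimeter (E ∩ F) ≠ ∞ := ne_top_of_le_ne_top hPEfin hPA
  have hAF : (E ∩ F) ∆ F = F \ E := by
    ext x; simp only [mem_symmDiff, mem_inter_iff, Set.mem_sdiff]; tauto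
  have hsplit : ∫⁻ x in E ∆ F, d x = (∫⁻ x in E \ F, d x) + ∫⁻ x in F \ E, d x := by
    rw [← lintegral_add_measure, ← Measure.restrict_union₀ (disjoint_sdiff_sdiff.aedisjoint)
      (hFm.diff hE)]
    rfl
  have hFEfin : ∫⁻ x in F \ E, d x ≠ ∞ :=
    ne_top_of_le_ne_top hfin (hsplit ▸ le_add_self)
  have hAmin : functional h (E ∩ F) F ≤ functional h E F := by
    unfold functional
    rw [hAF]
    refine add_le_add hPA (ENNReal.div_le_div_right ?_ _)
    exact hsplit ▸ le_add_self
  -- Passing to `E ∩ F` saves exactly this integral, so minimality forces it to vanish. This leaves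
  -- `E \ F ⊆ ∂F`, which is not yet a null set.
  have hdzero : ∫⁻ x in E \ F, d x = 0 := by
    have h1 := hmin _ hAm
    unfold functional at h1
    rw [hAF, hsplit, ENNReal.add_div, ← add_assoc] at h1
    have h2 := ENNReal.le_of_add_le_add_right
      (ENNReal.div_ne_top hFEfin (by simpa using hh)) h1
    have h3 : (∫⁻ x in E \ F, d x) / ENNReal.ofReal h ≤ 0 := by
      refine (ENNReal.add_le_add_iff_left hPEfin).1 ?_
      rw [add_zero]
      exact h2.trans hPA
    have h4 := (ENNReal.div_eq_zero_iff.1 (le_zero_iff.1 h3)).resolve_right ENNReal.ofReal_ne_top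
    exact h4
  have hfr : ∀ᵐ x ∂volume.restrict (E \ F), x ∈ frontier F := by
    have h1 := (lintegral_eq_zero_iff (μ := volume.restrict (E \ F))
      Metric.continuous_infEDist.measurable).1 hdzero
    filter_upwards [h1] with x hx
    exact (Metric.mem_iff_infEDist_zero_of_closed isClosed_frontier).2 hx
  rw [ae_le_set]
  by_contra hS0
  -- At a density point of `E \ F` lying on `∂F`, both `E ∩ F` and `Eᶜ` have small density. Since `d
  -- ≤ 1` on a ball of radius at most one about it, both satisfy the density estimate with `Λ = 1 /
  -- h`.
  obtain ⟨c, hc0, hc⟩ := exists_density_const hn (L := 1 / h) (by positivity)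
  obtain ⟨x, hxF, r, hr0, hr1, hr⟩ := exists_density_point (hE.diff hFm) hS0 hfr hc0
  have hdle : ∀ y ∈ Metric.ball x r, d y ≤ 1 := fun y hy => by
    refine (Metric.infEDist_le_edist_of_mem hxF).trans ?_
    rw [edist_dist]
    exact ENNReal.ofReal_le_one.2 ((Metric.mem_ball.1 hy).le.trans hr1)
  have hΛ : 1 / h * r ≤ 1 / h := mul_le_of_le_one_right (by positivity) hr1
  have hset : ∀ (T : Set (Eucl n)) (s : ℝ), NullMeasurableSet T → s ≤ r →
      (∫⁻ y in T ∩ Metric.ball x s, d y) / ENNReal.ofReal h ≤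
        ENNReal.ofReal (1 / h) * volume (T ∩ Metric.ball x s) := by
    intro T s hT hs
    rw [one_div, ENNReal.ofReal_inv_of_pos hh, ENNReal.div_eq_inv_mul]
    gcongr
    calc ∫⁻ y in T ∩ Metric.ball x s, d y ≤ ∫⁻ y in T ∩ Metric.ball x s, 1 :=
          lintegral_mono_ae ((ae_restrict_mem₀ (hT.inter
            Metric.isOpen_ball.measurableSet.nullMeasurableSet)).mono
            fun y hy => hdle y (Metric.ball_subset_ball hs hy.2))
      _ = _ := by simp
  have hbm : ∀ s, NullMeasurableSet (Metric.ball x s) := fun s =>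
    Metric.isOpen_ball.measurableSet.nullMeasurableSet
  have hbfin : volume (Metric.ball x r \ (E \ F)) ≠ ∞ :=
    measure_ne_top_of_subset sdiff_subset measure_ball_lt_top.ne
  -- `E ∩ F` is itself a minimizer, hence comparable with itself minus a ball.
  have hA0 : volume (E ∩ F ∩ Metric.ball x (r / 2)) = 0 := by
    refine hc (E ∩ F) x r (1 / h) hr0 hΛ hAm hPAfin (fun s hs hsr => ?_) ?_
    · refine (perimeter_le_add_of_functional_le hh (G := (E ∩ F) \ Metric.ball x s)
        (S := E ∩ F ∩ Metric.ball x s)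
        (hAmin.trans (hmin _ (hAm.diff (hbm s)))) (hAF ▸ hFEfin) ?_).trans ?_
      · refine Eventually.of_forall fun y hy => ?_
        change y ∈ (E ∩ F) ∆ F ∪ E ∩ F ∩ Metric.ball x s
        have hy' : y ∈ ((E ∩ F) \ Metric.ball x s) ∆ F := hy
        simp only [mem_symmDiff, mem_inter_iff, Set.mem_sdiff, mem_union] at hy' ⊢
        tauto
      · gcongr
        exact hset _ s hAm hsr
    · refine (measureReal_mono ?_ hbfin).trans hr
      exact fun y hy => ⟨hy.2, fun h => h.2 hy.1.2⟩
  -- Adding a ball to `E` removes it from the complement, which has the same perimeter.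
  have hE0 : volume (Eᶜ ∩ Metric.ball x (r / 2)) = 0 := by
    refine hc Eᶜ x r (1 / h) hr0 hΛ hE.compl (by rwa [perimeter_compl hE]) (fun s hs hsr => ?_) ?_
    · have hcompl : Eᶜ \ Metric.ball x s = (E ∪ Metric.ball x s)ᶜ := by
        rw [compl_union, Set.sdiff_eq]
      rw [hcompl, perimeter_compl hE, perimeter_compl (hE.union (hbm s))]
      refine (perimeter_le_add_of_functional_le hh (S := Eᶜ ∩ Metric.ball x s)
        (hmin _ (hE.union (hbm s))) hfin ?_).trans ?_
      · refine Eventually.of_forall fun y hy => ?_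
        change y ∈ E ∆ F ∪ Eᶜ ∩ Metric.ball x s
        have hy' : y ∈ (E ∪ Metric.ball x s) ∆ F := hy
        simp only [mem_symmDiff, mem_inter_iff, mem_union, mem_compl_iff] at hy' ⊢
        tauto
      · gcongr
        exact hset _ s hE.compl hsr
    · refine (measureReal_mono ?_ hbfin).trans hr
      exact fun y hy => ⟨hy.2, fun h => hy.1 h.1⟩
  -- In the half ball `F` is covered by these two null sets, which is impossible at a boundary
  -- point.
  refine (volume_inter_pos_of_mem_frontier hFn hxF Metric.isOpen_ball
    (Metric.mem_ball_self (by positivity : 0 < r / 2))).ne' ?_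
  refine measure_mono_null (t := E ∩ F ∩ Metric.ball x (r / 2) ∪ Eᶜ ∩ Metric.ball x (r / 2))
    (fun y hy => ?_) (measure_union_null hA0 hE0)
  by_cases hyE : y ∈ E
  · exact Or.inl ⟨⟨hyE, hy.1⟩, hy.2⟩
  · exact Or.inr ⟨hyE, hy.2⟩

/-- For a competitor `G`, the set `G ∩ F` lies between `E` and `F`, hence is no farther from `F`
than `E` and `P(E) ≤ P(G ∩ F)`. Submodularity and `P(F) ≤ P(G ∪ F)` give `P(G ∩ F) ≤ P(G)`. -/
lemma IsOutwardMinimizingAE.of_minimizer (hh : 0 < h) {R : ℝ}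
    (hΩR : Ω ≤ᵐ[volume] Metric.closedBall (0 : Eucl n) R)
    (hE : NullMeasurableSet E) (hF : IsOutwardMinimizingAE Ω F) (hP : perimeter F ≠ ∞)
    (hmin : ∀ G : Set (Eucl n), NullMeasurableSet G → functional h E F ≤ functional h G F)
    (hEF : E ≤ᵐ[volume] F) : IsOutwardMinimizingAE Ω E := by
  have hFm := hF.measurable
  have hfin : ∫⁻ x in E ∆ F, Metric.infEDist x (frontier F) ≠ ∞ :=
    ne_top_of_le_ne_top (ENNReal.mul_ne_top ENNReal.ofReal_ne_top hP)
      (lintegral_infEDist_le_of_minimizer hh hmin hFm)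
  refine ⟨hE, hEF.trans hF.subset, fun G hG hEG hGΩ => ?_⟩
  have h1 : perimeter E ≤ perimeter (G ∩ F) := by
    refine perimeter_le_of_functional_le hh (hmin _ (hG.inter hFm)) hfin ?_
    filter_upwards [hEG] with y (h1 : y ∈ E → y ∈ G) hy
    change y ∈ E ∆ F
    have hy' : y ∈ (G ∩ F) ∆ F := hy
    simp only [mem_symmDiff, mem_inter_iff] at hy' ⊢
    tauto
  have h2 := perimeter_inter_add_perimeter_union_le_of_ae hG hFm (hGΩ.trans hΩR)
    (hF.subset.trans hΩR)
  have h3 : perimeter F ≤ perimeter (G ∪ F) := by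
    refine hF.perimeter_le _ (hG.union hFm) subset_union_right.eventuallyLE ?_
    filter_upwards [hGΩ, hF.subset] with x h1 h2 hx
    exact hx.elim h1 h2
  exact h1.trans (ENNReal.le_of_add_le_add_right hP ((add_le_add_right h3 _).trans h2))

end Step

/-! ### The scheme for small time steps -/

/-- Induction on `k`: outward minimality yields `P(E_k) ≤ P(E₀)`, so the uniform threshold keeps the
next set in `Ω`; it then lies in `E_k`, and is outward minimizing in turn. -/
lemma IsStrictlyMeanConvex.exists_timestep (hn : 2 ≤ n) {E₀ : Set (Eucl n)}
    (hbdd : Bornology.IsBounded E₀) (hconv : IsStrictlyMeanConvex E₀) :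
    perimeter E₀ ≠ ∞ ∧ ∃ Ω : Set (Eucl n), E₀ ⊆ Ω ∧ ∃ h₀ > 0, ∀ h : ℝ, 0 < h → h ≤ h₀ →
      ∀ E : ℕ → Set (Eucl n), IsScheme h E₀ E → ∀ k, IsOutwardMinimizingAE Ω (E k) ∧
        E (k + 1) ≤ᵐ[volume] E k ∧ E k ≤ᵐ[volume] E₀ := by
  obtain ⟨δ, hδ, hδE⟩ := hconv
  set Ω := Metric.thickening δ E₀ with hΩ
  have hP : perimeter E₀ ≠ ∞ := hδE.perimeter_ne_top hbdd Metric.isOpen_thickening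
    (Metric.closure_subset_thickening hδ E₀)
  obtain ⟨R, hR⟩ := (hbdd.thickening (δ := δ)).subset_closedBall 0
  obtain ⟨h₀, hh₀, hstep⟩ := exists_timestep_ae_subset_thickening hn hP hδ
  refine ⟨hP, Ω, hδE.subset, h₀, hh₀, fun h hh hle E hE => ?_⟩
  have hΩR : Ω ≤ᵐ[volume] Metric.closedBall (0 : Eucl n) R := hR.eventuallyLE
  have hnext : ∀ k, IsOutwardMinimizingAE Ω (E k) → E k ≤ᵐ[volume] E₀ →
      perimeter (E k) ≠ ∞ ∧ E (k + 1) ≤ᵐ[volume] E k := by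
    intro k h1 h2
    have hPk : perimeter (E k) ≤ perimeter E₀ :=
      h1.perimeter_le E₀ hδE.measurable h2 hδE.subset.eventuallyLE
    have hPk' := ne_top_of_le_ne_top hP hPk
    exact ⟨hPk', minimizer_ae_subset hn hh hΩR (hE.measurable _) (hE.normalized k) h1 hPk'
      (hE.minimizer k) (hstep h hh hle _ _ (hE.measurable _) (hE.measurable k) (hE.normalized k)
        h2 hPk (hE.minimizer k))⟩
  have hind : ∀ k, IsOutwardMinimizingAE Ω (E k) ∧ E k ≤ᵐ[volume] E₀ := by
    intro k
    induction k with
    | zero =>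
      rw [hE.init]
      exact ⟨hδE.ae Metric.isOpen_thickening.measurableSet, EventuallyLE.rfl⟩
    | succ k ih =>
      obtain ⟨h1, h2⟩ := hnext k ih.1 ih.2
      exact ⟨ih.1.of_minimizer hh hΩR (hE.measurable _) h1 (hE.minimizer k) h2, h2.trans ih.2⟩
  exact fun k => ⟨(hind k).1, (hnext k (hind k).1 (hind k).2).2, (hind k).2⟩

lemma ball_subset_of_disjoint_frontier {F : Set (Eucl n)} {x : Eucl n} {r : ℝ} (hr : 0 < r)
    (hx : x ∈ F) (hF : Disjoint (Metric.ball x r) (frontier F)) : Metric.ball x r ⊆ F := by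
  have hxb : x ∈ Metric.ball x r := Metric.mem_ball_self hr
  have hcover : Metric.ball x r ⊆ interior F ∪ (closure F)ᶜ := by
    intro y hy
    by_cases hyc : y ∈ closure F
    · left
      by_contra hyi
      exact disjoint_left.1 hF hy ⟨hyc, hyi⟩
    · exact Or.inr hyc
  refine (IsPreconnected.subset_left_of_subset_union isOpen_interior
    isClosed_closure.isOpen_compl (disjoint_compl_right.mono_left interior_subset_closure) hcover
    ⟨x, hxb, ?_⟩ (convex_ball x r).isPreconnected).trans interior_subset
  exact (hcover hxb).resolve_right fun h => h (subset_closure hx)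

lemma ae_le_of_le {E : ℕ → Set (Eucl n)} (hE : ∀ k, E (k + 1) ≤ᵐ[volume] E k) {i k : ℕ}
    (h : i ≤ k) : E k ≤ᵐ[volume] E i := by
  induction k, h using Nat.le_induction with
  | base => exact EventuallyLE.rfl
  | succ k _ ih => exact (hE k).trans ih

/-- A point in all `E k` would have infinite arrival time, so the full intersection is empty.
Nesting holds only almost everywhere, so continuity from above is applied to the finite
intersections. -/
lemma tendsto_volume_of_arrivalTime_ne_top {h : ℝ} (hh : 0 < h) {E : ℕ → Set (Eucl n)}
    (hm : ∀ k, NullMeasurableSet (E k)) (hE : ∀ k, E (k + 1) ≤ᵐ[volume] E k)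
    (hfin : volume (E 0) ≠ ∞) (hu : ∀ x, arrivalTime h E x ≠ ∞) :
    Tendsto (fun k => volume (E k)) atTop (𝓝 0) := by
  have hempty : ⋂ k, E k = ∅ := by
    refine eq_empty_of_forall_notMem fun x hx => hu x ?_
    have h1 : ∀ k, (E k).indicator (1 : Eucl n → ℝ≥0∞) x = 1 := fun k =>
      indicator_of_mem (mem_iInter.1 hx k) _
    unfold arrivalTime
    simp_rw [h1]
    rw [ENNReal.tsum_const_eq_top_of_ne_zero one_ne_zero]
    exact ENNReal.mul_top (by simpa using hh)
  have hlim := tendsto_measure_iInter_le (μ := volume) hm ⟨0, hfin⟩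
  rw [hempty, measure_empty] at hlim
  refine hlim.congr fun k => measure_congr ?_
  have : ∀ i ≤ k, E k ≤ᵐ[volume] E i := fun i hi => ae_le_of_le hE hi
  have hall : ∀ᵐ x, ∀ i ≤ k, x ∈ E k → x ∈ E i :=
    ae_all_iff.2 fun i => by
      by_cases hi : i ≤ k
      · filter_upwards [this i hi] with x hx _
        exact hx
      · exact Eventually.of_forall fun x h => absurd h hi
  filter_upwards [hall] with x hx
  refine propext ⟨fun h => ?_, fun h => ?_⟩
  · exact mem_iInter₂.1 h k le_rfl
  · exact mem_iInter₂.2 fun i hi => hx i hi h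

/-- Once `E k` is too small to contain a ball of radius `ρ`, its points are within `ρ` of its
boundary. Comparison of the next set `A` with the empty set then gives `P(A) ≤ (ρ / h) |A|`,
contradicting the isoperimetric inequality in `B_R` unless `A` is null. -/
lemma exists_volume_eq_zero (hn : 2 ≤ n) {h : ℝ} (hh : 0 < h) {E₀ Ω : Set (Eucl n)}
    (hbdd : Bornology.IsBounded E₀) (hP : perimeter E₀ ≠ ∞) (hE₀ : E₀ ⊆ Ω)
    {E : ℕ → Set (Eucl n)} (hE : IsScheme h E₀ E)
    (hEk : ∀ k, IsOutwardMinimizingAE Ω (E k) ∧ E (k + 1) ≤ᵐ[volume] E k ∧ E k ≤ᵐ[volume] E₀)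
    (hu : ∀ x, arrivalTime h E x ≠ ∞) : ∃ N, ∀ k, N ≤ k → volume (E k) = 0 := by
  obtain ⟨R, hR0, hR⟩ := hbdd.subset_ball_lt 0 0
  have hfin : volume E₀ ≠ ∞ := measure_ne_top_of_subset hR measure_ball_lt_top.ne
  have hlim := tendsto_volume_of_arrivalTime_ne_top hh hE.measurable (fun k => (hEk k).2.1)
    (by rwa [hE.init]) hu
  -- This makes `2 R ρ / h = 1`, so the two inequalities combine to `n |A| ≤ |A|`, and `2 ≤ n`
  -- concludes.
  set ρ := h / (2 * R) with hρ
  have hρ0 : 0 < ρ := by positivity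
  have : Nontrivial (Eucl n) := by
    have : Nonempty (Fin n) := ⟨⟨0, by omega⟩⟩
    infer_instance
  have hpos : 0 < volume (Metric.ball (0 : Eucl n) ρ) := Metric.measure_ball_pos _ _ hρ0
  obtain ⟨k, hk⟩ := (hlim.eventually (gt_mem_nhds hpos)).exists
  set F := E k with hF
  have hFm := hE.measurable k
  have hd : ∀ x ∈ F, Metric.infEDist x (frontier F) ≤ ENNReal.ofReal ρ := by
    intro x hx
    by_contra! hcon
    refine hk.not_ge ?_
    rw [← Measure.addHaar_ball_center volume x ρ]
    refine measure_mono (ball_subset_of_disjoint_frontier hρ0 hx ?_)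
    refine disjoint_left.2 fun y hyb hyF => hcon.not_ge ?_
    refine (Metric.infEDist_le_edist_of_mem hyF).trans ?_
    rw [edist_comm, edist_dist]
    exact ENNReal.ofReal_le_ofReal (Metric.mem_ball.1 hyb).le
  have hPF : perimeter F ≠ ∞ := ne_top_of_le_ne_top hP ((hEk k).1.perimeter_le E₀
    (hE.init ▸ hE.measurable 0) (hEk k).2.2 hE₀.eventuallyLE)
  set A := E (k + 1) with hA
  have hAm := hE.measurable (k + 1)
  have hintfin : ∫⁻ x in A ∆ F, Metric.infEDist x (frontier F) ≠ ∞ :=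
    ne_top_of_le_ne_top (ENNReal.mul_ne_top ENNReal.ofReal_ne_top hPF)
      (lintegral_infEDist_le_of_minimizer hh (hE.minimizer k) hFm)
  have hPA : perimeter A ≤ ENNReal.ofReal ρ * volume A / ENNReal.ofReal h := by
    have h1 := perimeter_le_add_of_functional_le hh (S := A ∩ F)
      (hE.minimizer k ∅ nullMeasurableSet_empty) hintfin (Eventually.of_forall fun y hy => by
        change y ∈ A ∆ F ∪ A ∩ F
        have hy' : y ∈ (∅ : Set (Eucl n)) ∆ F := hy
        simp only [mem_symmDiff, mem_inter_iff, mem_union, mem_empty_iff_false] at hy' ⊢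
        tauto)
    rw [perimeter_empty, zero_add] at h1
    refine h1.trans (ENNReal.div_le_div_right ?_ _)
    calc ∫⁻ x in A ∩ F, Metric.infEDist x (frontier F)
        ≤ ∫⁻ x in A ∩ F, ENNReal.ofReal ρ :=
          lintegral_mono_ae ((ae_restrict_mem₀ (hAm.inter hFm)).mono fun y hy => hd y hy.2)
      _ = ENNReal.ofReal ρ * volume (A ∩ F) := by simp
      _ ≤ ENNReal.ofReal ρ * volume A := by gcongr; exact inter_subset_left
  have hAR : A ≤ᵐ[volume] Metric.ball (0 : Eucl n) R := (hEk (k + 1)).2.2.trans hR.eventuallyLE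
  have hA' := inter_ae_eq_left_of_ae_le hAR
  have hAfin : volume A ≠ ∞ :=
    ne_top_of_le_ne_top hfin (measure_mono_ae (hEk (k + 1)).2.2)
  have hvol := volume_le_mul_perimeter (E := A ∩ Metric.ball 0 R) hR0 inter_subset_right
  rw [perimeter_congr_ae hA', measure_congr hA'] at hvol
  have h2 : 2 * volume A ≤ volume A := by
    calc 2 * volume A ≤ n * volume A := by gcongr; exact_mod_cast hn
      _ ≤ ENNReal.ofReal (2 * R) * (ENNReal.ofReal ρ * volume A / ENNReal.ofReal h) :=
          hvol.trans (by gcongr)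
      _ = ENNReal.ofReal (2 * R * ρ / h) * volume A := by
          rw [ENNReal.ofReal_div_of_pos hh, ENNReal.ofReal_mul (q := ρ) (by positivity : 0 ≤ 2 * R),
            div_eq_mul_inv, div_eq_mul_inv]
          ring
      _ = volume A := by
          rw [show 2 * R * ρ / h = 1 by rw [hρ]; field_simp]
          simp
  have hA0 : volume A = 0 := by
    by_contra h0
    rw [two_mul] at h2
    exact (ENNReal.lt_add_right hAfin h0).not_ge h2
  exact ⟨k + 1, fun i hi => le_antisymm
    ((measure_mono_ae (ae_le_of_le (fun k => (hEk k).2.1) hi)).trans hA0.le) zero_le⟩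

/-! ### Total variation of the arrival times -/

lemma arrivalTime_toReal_ae_eq {h : ℝ} (hh : 0 < h) {E : ℕ → Set (Eucl n)} {N : ℕ}
    (hN : ∀ k, N ≤ k → volume (E k) = 0) :
    (fun x => (arrivalTime h E x).toReal) =ᵐ[volume]
      fun x => h * (∑ k ∈ Finset.range N, (E k).indicator (1 : Eucl n → ℝ)) x := by
  have hall : ∀ᵐ x, ∀ k, N ≤ k → x ∉ E k := ae_all_iff.2 fun k => by
    by_cases hk : N ≤ k
    · filter_upwards [measure_eq_zero_iff_ae_notMem.1 (hN k hk)] with x hx _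
      exact hx
    · exact Eventually.of_forall fun x h => absurd h hk
  filter_upwards [hall] with x hx
  unfold arrivalTime
  rw [tsum_eq_sum (s := Finset.range N) fun k hk =>
    indicator_of_notMem (hx k (by simpa using hk)) _, ENNReal.toReal_mul,
    ENNReal.toReal_ofReal hh.le, ENNReal.toReal_sum fun k _ => ?_, Finset.sum_apply]
  · congr 1
    refine Finset.sum_congr rfl fun k _ => ?_
    by_cases hk : x ∈ E k <;> simp [hk]
  · by_cases hk : x ∈ E k <;> simp [hk]

/-- Functions of the type of an arrival time: among the functions above it which vanish off `E₀`
it has the least total variation. -/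
structure IsTvMinimal (E₀ : Set (Eucl n)) (a : Eucl n → ℝ) : Prop where
  integrable : Integrable a
  bounded : ∃ M, ∀ᵐ x, |a x| ≤ M
  eq_zero : ∀ᵐ x, x ∉ E₀ → a x = 0
  tv_ne_top : tv univ a ≠ ∞
  tv_le : ∀ w : Eucl n → ℝ, Integrable w → (∀ x, x ∉ E₀ → w x = 0) → a ≤ᵐ[volume] w →
    tv univ a ≤ tv univ w

lemma sum_setLIntegral_Ico_le {h : ℝ} (hh : 0 < h) (f : ℝ → ℝ≥0∞) (N : ℕ) :
    ∑ k ∈ Finset.range N, ∫⁻ t in Ico (h * k) (h * (k + 1)), f t ≤ ∫⁻ t in Ioi 0, f t := by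
  have hsum : ∑ k ∈ Finset.range N, ∫⁻ t in Ico (h * k) (h * (k + 1)), f t =
      ∫⁻ t in Ico 0 (h * N), f t := by
    induction N with
    | zero => simp
    | succ N ih =>
      rw [Finset.sum_range_succ, ih, ← lintegral_union measurableSet_Ico (by
        rw [disjoint_left]
        intro t h1 h2
        exact absurd h1.2 (not_lt.2 h2.1)), Ico_union_Ico_eq_Ico (by positivity) (by nlinarith)]
      push_cast
      rfl
  rw [hsum, setLIntegral_congr Ioo_ae_eq_Ico.symm]
  exact lintegral_mono_set Ioo_subset_Ioi_self

/-- Subadditivity gives `tv u_h ≤ h ∑ P(E_k)`. For `w ≥ u_h` and each level `t` in `[hk, h(k+1))`,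
the set `{w > t}` is an outward competitor for `E_k`; integrating over the levels and using coarea
bounds the sum by `tv w`. -/
lemma isTvMinimal_arrivalTime {h : ℝ} (hh : 0 < h) {E₀ Ω : Set (Eucl n)}
    (hbdd : Bornology.IsBounded E₀) (hP : perimeter E₀ ≠ ∞) (hE₀ : E₀ ⊆ Ω)
    {E : ℕ → Set (Eucl n)} (hE : IsScheme h E₀ E)
    (hEk : ∀ k, IsOutwardMinimizingAE Ω (E k) ∧ E (k + 1) ≤ᵐ[volume] E k ∧ E k ≤ᵐ[volume] E₀)
    {N : ℕ} (hN : ∀ k, N ≤ k → volume (E k) = 0) :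
    IsTvMinimal E₀ fun x => (arrivalTime h E x).toReal := by
  obtain ⟨R, hR⟩ := hbdd.subset_closedBall 0
  have hae := arrivalTime_toReal_ae_eq hh hN
  have hE₀fin : volume E₀ ≠ ∞ := measure_ne_top_of_subset hR measure_closedBall_lt_top.ne
  have hint : ∀ k, Integrable ((E k).indicator (1 : Eucl n → ℝ)) := fun k =>
    IntegrableOn.integrable_indicator₀ (integrableOn_const (ne_top_of_le_ne_top hE₀fin
      (measure_mono_ae (hEk k).2.2))) (hE.measurable k)
  have hPk : ∀ k, perimeter (E k) ≠ ∞ := fun k => ne_top_of_le_ne_top hP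
    ((hEk k).1.perimeter_le E₀ (hE.init ▸ hE.measurable 0) (hEk k).2.2 hE₀.eventuallyLE)
  have htv : tv univ (fun x => (arrivalTime h E x).toReal) ≤
      ∑ k ∈ Finset.range N, ENNReal.ofReal h * perimeter (E k) := by
    rw [tv_congr_ae hae, ← Finset.mul_sum]
    refine (tv_const_mul_le hh.le _).trans ?_
    gcongr
    refine (tv_sum_le _ _ fun k _ => (hint k).locallyIntegrable).trans (le_of_eq ?_)
    exact Finset.sum_congr rfl fun k _ => (perimeter_eq_tv (hE.measurable k)).symm
  refine ⟨?_, ⟨h * N, ?_⟩, ?_, ?_, fun w hw hw0 hle => htv.trans ?_⟩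
  · refine Integrable.congr ?_ hae.symm
    exact (integrable_finsetSum' _ fun k _ => hint k).const_mul h
  · filter_upwards [hae] with x hx
    rw [hx, Finset.sum_apply, abs_of_nonneg]
    · gcongr
      refine (Finset.sum_le_card_nsmul _ _ 1 fun k _ => ?_).trans (by simp)
      exact indicator_le_self' (by simp) x
    · exact mul_nonneg hh.le (Finset.sum_nonneg fun k _ => indicator_nonneg (by simp) x)
  · filter_upwards [hae, ae_all_iff.2 fun k => (hEk k).2.2] with x hx hxE hx0
    rw [hx, Finset.sum_apply, Finset.sum_eq_zero fun k _ => indicator_of_notMem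
      (fun hxk => hx0 (hxE k hxk)) _, mul_zero]
  · refine ne_top_of_le_ne_top ?_ htv
    exact (ENNReal.sum_lt_top.2 fun k _ => (ENNReal.mul_ne_top ENNReal.ofReal_ne_top
      (hPk k)).lt_top).ne
  · have hcoarea := lintegral_perimeter_superlevel_le hw (R := R) fun x hx =>
      hw0 x fun hx0 => absurd (hR hx0) (by simpa using hx)
    refine le_trans ?_ ((sum_setLIntegral_Ico_le hh _ N).trans hcoarea)
    refine Finset.sum_le_sum fun k hk => ?_
    have hnest : ∀ᵐ x, ∀ i ≤ k, x ∈ E k → x ∈ E i := ae_all_iff.2 fun i => by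
      by_cases hi : i ≤ k
      · filter_upwards [ae_le_of_le (fun k => (hEk k).2.1) hi] with x hx _
        exact hx
      · exact Eventually.of_forall fun x h => absurd h hi
    -- The sum starts at `k = 0`, so `u_h ≥ h (k + 1) > t` on `E k`. Since `t ≥ 0` and `w` vanishes
    -- off `E₀`, the superlevel set stays in `E₀ ⊆ Ω`.
    have hlevel : ∀ t ∈ Ico (h * k) (h * (k + 1)), perimeter (E k) ≤ perimeter {x | t < w x} := by
      intro t ht
      refine (hEk k).1.perimeter_le _
        (nullMeasurableSet_lt aemeasurable_const hw.aestronglyMeasurable.aemeasurable) ?_ ?_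
      · filter_upwards [hnest, hae, hle] with x hx hxa hxw hxk
        change t < w x
        refine ht.2.trans_le (le_trans ?_ hxw)
        rw [hxa, Finset.sum_apply]
        gcongr
        have hsub : Finset.range (k + 1) ⊆ Finset.range N :=
          Finset.range_subset_range.2 (Finset.mem_range.1 hk)
        refine le_trans (le_of_eq ?_) (Finset.sum_le_sum_of_subset_of_nonneg hsub
          fun i _ _ => indicator_nonneg (by simp) x)
        rw [Finset.sum_congr rfl fun i hi => indicator_of_mem
          (hx i (Nat.lt_succ_iff.1 (Finset.mem_range.1 hi)) hxk) _]
        simp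
      · refine Eventually.of_forall fun x hx => hE₀ ?_
        by_contra hx0
        have hx' : t < w x := hx
        rw [hw0 x hx0] at hx'
        have h0 : 0 ≤ h * k := by positivity
        linarith [ht.1]
    calc ENNReal.ofReal h * perimeter (E k)
        = ∫⁻ t in Ico (h * k) (h * (k + 1)), perimeter (E k) := by
          rw [setLIntegral_const, Real.volume_Ico, mul_comm]
          congr 2
          ring
      _ ≤ ∫⁻ t in Ico (h * k) (h * (k + 1)), perimeter {x | t < w x} :=
          setLIntegral_mono' measurableSet_Ico hlevel

/-- The function equal to `z + ε` on `E₀` and to zero elsewhere lies above `a`, and agrees almost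
everywhere with `z + ε χ_{E₀}`. -/
lemma IsTvMinimal.tv_le_add {E₀ : Set (Eucl n)} {a z : Eucl n → ℝ} {ε : ℝ}
    (ha : IsTvMinimal E₀ a) (hE₀ : NullMeasurableSet E₀) (hfin : volume E₀ ≠ ∞)
    (hz : Integrable z) (hz0 : ∀ᵐ x, x ∉ E₀ → z x = 0) (hε : 0 ≤ ε) (hle : ∀ x, a x ≤ z x + ε) :
    tv univ a ≤ tv univ z + ENNReal.ofReal ε * perimeter E₀ := by
  have hχ : Integrable (E₀.indicator (1 : Eucl n → ℝ)) :=
    IntegrableOn.integrable_indicator₀ (integrableOn_const hfin) hE₀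
  have hsum : Integrable (z + fun x => ε * E₀.indicator (1 : Eucl n → ℝ) x) :=
    hz.add (hχ.const_mul ε)
  have hae : E₀.indicator (fun x => z x + ε) =ᵐ[volume]
      z + fun x => ε * E₀.indicator (1 : Eucl n → ℝ) x := by
    filter_upwards [hz0] with x hx
    by_cases hxE : x ∈ E₀
    · simp [hxE]
    · simp [hxE, hx hxE]
  refine (ha.tv_le (E₀.indicator fun x => z x + ε) (hsum.congr hae.symm)
    (fun x hx => indicator_of_notMem hx _) ?_).trans ?_
  · filter_upwards [ha.eq_zero] with x hx
    by_cases hxE : x ∈ E₀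
    · rw [indicator_of_mem hxE]
      exact hle x
    · rw [indicator_of_notMem hxE, hx hxE]
  · rw [tv_congr_ae hae]
    refine (tv_add_le hz.locallyIntegrable (hχ.const_mul ε).locallyIntegrable).trans ?_
    gcongr
    rw [perimeter_eq_tv hE₀]
    exact tv_const_mul_le hε _

lemma IsDistribGradient.congr_ae {v w : Eucl n → ℝ} {D : VectorMeasure (Eucl n) (Eucl n)}
    (h : IsDistribGradient v D) (hvw : v =ᵐ[volume] w) : IsDistribGradient w D := by
  refine ⟨h.locallyIntegrable.congr hvw, h.finite, fun φ h1 h2 => ?_⟩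
  rw [← h.integral_eq φ h1 h2]
  refine integral_congr_ae ?_
  filter_upwards [hvw] with x hx
  rw [hx]

lemma exists_isDistribGradient_of_ae {v : Eucl n → ℝ} (hv : Integrable v) {R M : ℝ}
    (hR : ∀ᵐ x, R < ‖x‖ → v x = 0) (hM : ∀ᵐ x, |v x| ≤ M) (htv : tv univ v ≠ ∞) :
    ∃ D, IsDistribGradient v D := by
  set w : Eucl n → ℝ := (Metric.closedBall (0 : Eucl n) R).indicator
    fun x => max (-|M|) (min (v x) |M|) with hw
  have hwv : w =ᵐ[volume] v := by
    filter_upwards [hR, hM] with x h1 h2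
    by_cases hx : x ∈ Metric.closedBall (0 : Eucl n) R
    · have h3 := abs_le.1 (h2.trans (le_abs_self M))
      rw [hw, indicator_of_mem hx, min_eq_left h3.2, max_eq_right h3.1]
    · rw [hw, indicator_of_notMem hx, h1 (by simpa using hx)]
  have hwM : ∀ x, |w x| ≤ |M| := fun x => by
    by_cases hx : x ∈ Metric.closedBall (0 : Eucl n) R
    · rw [hw, indicator_of_mem hx]
      exact abs_le.2 ⟨le_max_left _ _, max_le (by linarith [abs_nonneg M]) (min_le_right _ _)⟩
    · rw [hw, indicator_of_notMem hx]
      simp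
  obtain ⟨D, hD⟩ := exists_isDistribGradient (v := w) (M := |M|) (hv.congr hwv.symm)
    (fun x hx => indicator_of_notMem (by simpa using hx) _) hwM (by rwa [tv_congr_ae hwv])
  exact ⟨D, hD.congr_ae hwv⟩

/-! ### Weak convergence -/

/-- Lower semicontinuity on open sets passes to integrals of nonnegative functions. Adding the
constant `C` makes the integrand nonnegative and mass convergence removes it again; applying this to
`φ` and `-φ` gives both bounds. -/
lemma tendsto_integral_of_le_liminf_of_tendsto_mass {μ : Measure (Eucl n)} [IsFiniteMeasure μ]
    {μs : ℕ → Measure (Eucl n)} (hfin : ∀ᶠ j in atTop, IsFiniteMeasure (μs j))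
    (hopen : ∀ U, IsOpen U → μ U ≤ liminf (fun j => μs j U) atTop)
    (hmass : Tendsto (fun j => μs j univ) atTop (𝓝 (μ univ)))
    {φ : Eucl n → ℝ} (hφ : Continuous φ) {C : ℝ} (hC : ∀ x, |φ x| ≤ C) :
    Tendsto (fun j => ∫ x, φ x ∂μs j) atTop (𝓝 (∫ x, φ x ∂μ)) := by
  have key : ∀ ψ : Eucl n → ℝ, Continuous ψ → (∀ x, |ψ x| ≤ C) → ∀ b < ∫ x, ψ x ∂μ,
      ∀ᶠ j in atTop, b < ∫ x, ψ x ∂μs j := by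
    intro ψ hψ hψC b hb
    have hnn : ∀ x, 0 ≤ ψ x + C := fun x => by linarith [neg_abs_le (ψ x), hψC x]
    have hint : ∀ (m : Measure (Eucl n)) [IsFiniteMeasure m], Integrable ψ m := fun m _ =>
      Integrable.of_bound hψ.aestronglyMeasurable C (Eventually.of_forall hψC)
    have hI : ∀ (m : Measure (Eucl n)) [IsFiniteMeasure m],
        ∫ x, ψ x + C ∂m = ∫ x, ψ x ∂m + C * m.real univ := fun m _ => by
      rw [integral_add (hint m) (integrable_const C), integral_const, smul_eq_mul, mul_comm]
    have hL : ∀ (m : Measure (Eucl n)) [IsFiniteMeasure m],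
        ∫⁻ x, ENNReal.ofReal (ψ x + C) ∂m = ENNReal.ofReal (∫ x, ψ x ∂m + C * m.real univ) :=
      fun m _ => by
        rw [← hI m]
        exact (ofReal_integral_eq_lintegral_ofReal ((hint m).add (integrable_const C))
          (Eventually.of_forall hnn)).symm
    have hlim := lintegral_le_liminf_lintegral_of_forall_isOpen_measure_le_liminf_measure
      (μ := μ) (μs := μs) (f := fun x => ψ x + C) (hψ.add continuous_const) hnn hopen
    rw [hL μ] at hlim
    have hmass' : Tendsto (fun j => C * (μs j).real univ) atTop (𝓝 (C * μ.real univ)) :=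
      ((ENNReal.tendsto_toReal (measure_ne_top μ univ)).comp hmass).const_mul C
    obtain ⟨b', hb1, hb2⟩ := exists_between hb
    -- `ENNReal.ofReal` loses negative lower bounds; in that case nonnegativity of `∫ (ψ + C)`
    -- already suffices.
    by_cases h0 : b + C * μ.real univ < 0
    · filter_upwards [hfin, (hmass'.const_add b).eventually (gt_mem_nhds h0)] with j hj1 hj2
      have : 0 ≤ ∫ x, ψ x + C ∂μs j := integral_nonneg hnn
      rw [hI] at this
      linarith
    · push Not at h0
      have hlt : ENNReal.ofReal (b' + C * μ.real univ) <
          ENNReal.ofReal (∫ x, ψ x ∂μ + C * μ.real univ) :=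
        (ENNReal.ofReal_lt_ofReal_iff (by linarith)).2 (by linarith)
      filter_upwards [hfin, eventually_lt_of_lt_liminf (hlt.trans_le hlim),
        hmass'.eventually (gt_mem_nhds (show C * μ.real univ < C * μ.real univ + (b' - b) by
          linarith))] with j hj1 hj2 hj3
      rw [hL] at hj2
      have hj4 : b' + C * μ.real univ < ∫ x, ψ x ∂μs j + C * (μs j).real univ := by
        by_contra! hcon
        exact hj2.not_ge (ENNReal.ofReal_le_ofReal hcon)
      linarith
  refine tendsto_order.2 ⟨fun b hb => key φ hφ hC b hb, fun b hb => ?_⟩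
  have := key (fun x => -φ x) hφ.neg (by simpa using hC) (-b) (by rw [integral_neg]; linarith)
  filter_upwards [this] with j hj
  rw [integral_neg] at hj
  linarith

/-! ### Strict convergence -/

lemma tv_le_liminf_of_tendsto_lintegral {a : ℕ → Eucl n → ℝ} {w : Eucl n → ℝ}
    (ha : ∀ᶠ j in atTop, Integrable (a j)) (hw : Integrable w)
    (hlim : Tendsto (fun j => ∫⁻ x, ‖a j x - w x‖ₑ) atTop (𝓝 0)) (V : Set (Eucl n)) :
    tv V w ≤ liminf (fun j => tv V (a j)) atTop := by
  refine tv_le_liminf fun ξ h1 h2 => ?_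
  obtain ⟨C, hC⟩ := exists_bound_divergence h1 h2
  refine tendsto_integral_of_L1 _ (integrable_mul_divergence hw.locallyIntegrable h1 h2).aestronglyMeasurable
    (ha.mono fun j hj => integrable_mul_divergence hj.locallyIntegrable h1 h2) ?_
  refine tendsto_of_tendsto_of_tendsto_of_le_of_le tendsto_const_nhds
    (h := fun j => ENNReal.ofReal C * ∫⁻ x, ‖a j x - w x‖ₑ) ?_ (fun _ => zero_le) fun j => ?_
  · simpa using ENNReal.Tendsto.const_mul hlim (Or.inr ENNReal.ofReal_ne_top)
  · dsimp only
    rw [← lintegral_const_mul' _ _ ENNReal.ofReal_ne_top]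
    refine lintegral_mono fun x => ?_
    rw [← sub_mul, enorm_mul, mul_comm]
    gcongr
    rw [← ofReal_norm]
    exact ENNReal.ofReal_le_ofReal (hC x)

lemma tendsto_lintegral_of_isTvMinimal {E₀ : Set (Eucl n)} (hE₀ : NullMeasurableSet E₀)
    (hfin : volume E₀ ≠ ∞) {a : ℕ → Eucl n → ℝ} {w : Eucl n → ℝ}
    (ha : ∀ᶠ j in atTop, IsTvMinimal E₀ (a j)) (hw0 : ∀ᵐ x, x ∉ E₀ → w x = 0)
    (hclose : ∀ ε : ℝ, 0 < ε → ∀ᶠ j in atTop, ∀ x, |a j x - w x| ≤ ε) :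
    Tendsto (fun j => ∫⁻ x, ‖a j x - w x‖ₑ) atTop (𝓝 0) := by
  have hlim : Tendsto (fun ε : ℝ => ENNReal.ofReal ε * volume E₀) (𝓝[>] 0) (𝓝 0) := by
    have := ENNReal.Tendsto.mul_const (b := volume E₀)
      ((ENNReal.continuous_ofReal.tendsto (0 : ℝ)).mono_left
        (nhdsWithin_le_nhds (s := Ioi 0)))
      (Or.inr hfin)
    simpa using this
  refine ENNReal.tendsto_nhds_zero.2 fun η hη => ?_
  obtain ⟨ε, hε1, hε2⟩ := ((hlim.eventually (gt_mem_nhds hη)).and self_mem_nhdsWithin).exists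
  filter_upwards [ha, hclose ε hε2] with j hj1 hj2
  calc ∫⁻ x, ‖a j x - w x‖ₑ ≤ ∫⁻ x, E₀.indicator (fun _ => ENNReal.ofReal ε) x := by
        refine lintegral_mono_ae ?_
        filter_upwards [hw0, hj1.eq_zero] with x h1 h2
        by_cases hx : x ∈ E₀
        · rw [indicator_of_mem hx, ← ofReal_norm]
          exact ENNReal.ofReal_le_ofReal (hj2 x)
        · simp [h1 hx, h2 hx]
    _ = ENNReal.ofReal ε * volume E₀ := lintegral_indicator_const₀ hE₀ _
    _ ≤ η := hε1.le

theorem strict_convergence_of_isTvMinimal {E₀ : Set (Eucl n)} (hbdd : Bornology.IsBounded E₀)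
    (hE₀ : NullMeasurableSet E₀) (hP : perimeter E₀ ≠ ∞) {a : ℕ → Eucl n → ℝ} {w : Eucl n → ℝ}
    (ha : ∀ᶠ j in atTop, IsTvMinimal E₀ (a j))
    (hclose : ∀ ε : ℝ, 0 < ε → ∀ᶠ j in atTop, ∀ x, |a j x - w x| ≤ ε) :
    (∀ᶠ j in atTop, IsBV (a j)) ∧ IsBV w ∧
    (∀ φ : Eucl n → ℝ, Continuous φ → HasCompactSupport φ →
      Tendsto (fun j => ∫ x, φ x ∂(gradMeasure (a j)).variation) atTop
        (𝓝 (∫ x, φ x ∂(gradMeasure w).variation))) ∧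
    Tendsto (fun j => (gradMeasure (a j)).variation univ) atTop
      (𝓝 ((gradMeasure w).variation univ)) ∧
    Tendsto (fun j => ∫⁻ x, ‖a j x - w x‖ₑ) atTop (𝓝 0) := by
  obtain ⟨R, hR⟩ := hbdd.subset_closedBall 0
  have hfin : volume E₀ ≠ ∞ := measure_ne_top_of_subset hR measure_closedBall_lt_top.ne
  have hRE : ∀ x : Eucl n, R < ‖x‖ → x ∉ E₀ := fun x hx hxE =>
    absurd (hR hxE) (by simpa using hx)
  obtain ⟨J, hJ⟩ := eventually_atTop.1 (ha.and (hclose 1 one_pos))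
  have hJm : ∀ j, J ≤ j → IsTvMinimal E₀ (a j) := fun j hj => (hJ j hj).1
  have hptw : ∀ x, Tendsto (fun j => a (J + j) x) atTop (𝓝 (w x)) := fun x => by
    have h1 : Tendsto (fun j => a j x) atTop (𝓝 (w x)) := Metric.tendsto_nhds.2 fun ε hε => by
      filter_upwards [hclose (ε / 2) (by positivity)] with j hj
      rw [Real.dist_eq]
      linarith [hj x]
    simpa only [add_comm] using (tendsto_add_atTop_iff_nat J).2 h1
  have hw0 : ∀ᵐ x, x ∉ E₀ → w x = 0 := by
    filter_upwards [ae_all_iff.2 fun j : ℕ => (hJm (J + j) (by omega)).eq_zero] with x hx hxE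
    refine tendsto_nhds_unique (hptw x) ?_
    simp_rw [fun j => hx j hxE]
    exact tendsto_const_nhds
  have hwm : AEStronglyMeasurable w := aestronglyMeasurable_of_tendsto_ae atTop
    (fun j : ℕ => (hJm (J + j) (by omega)).integrable.aestronglyMeasurable)
    (Eventually.of_forall hptw)
  have hJJ := hJm J le_rfl
  have hwJ : ∀ x, |w x| ≤ |a J x| + 1 := fun x => by
    have h1 := (hJ J le_rfl).2 x
    have h2 := abs_sub_abs_le_abs_sub (w x) (a J x)
    rw [abs_sub_comm] at h1
    linarith
  obtain ⟨M, hM⟩ := hJJ.bounded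
  have hwM : ∀ᵐ x, |w x| ≤ M + 1 := by
    filter_upwards [hM] with x hx
    linarith [hwJ x]
  have hwi : Integrable w := by
    have hg : Integrable (E₀.indicator fun _ => M + 1) volume :=
      IntegrableOn.integrable_indicator₀ (integrableOn_const hfin) hE₀
    refine hg.mono' hwm ?_
    filter_upwards [hw0, hwM] with x h1 h2
    by_cases hx : x ∈ E₀
    · rwa [indicator_of_mem hx]
    · simp [hx, h1 hx]
  have hai : ∀ᶠ j in atTop, Integrable (a j) := ha.mono fun j hj => hj.integrable
  have hL1 := tendsto_lintegral_of_isTvMinimal hE₀ hfin ha hw0 hclose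
  have hlsc := tv_le_liminf_of_tendsto_lintegral hai hwi hL1
  -- All `a j` with `j ≥ J` are within one of `w`, hence within two of `a J`. This bounds their
  -- variations uniformly, so `w` has finite variation.
  have hbound : ∀ j, J ≤ j → tv univ (a j) ≤ tv univ (a J) + ENNReal.ofReal 2 * perimeter E₀ :=
    fun j hj => (hJm j hj).tv_le_add hE₀ hfin hJJ.integrable hJJ.eq_zero zero_le_two fun x => by
      have h1 := abs_le.1 ((hJ j hj).2 x)
      have h2 := abs_le.1 ((hJ J le_rfl).2 x)
      linarith [h1.2, h2.1]
  have htvw : tv univ w ≠ ∞ := by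
    refine ne_top_of_le_ne_top (b := tv univ (a J) + ENNReal.ofReal 2 * perimeter E₀)
      (ENNReal.add_ne_top.2 ⟨hJJ.tv_ne_top, ENNReal.mul_ne_top ENNReal.ofReal_ne_top hP⟩) ?_
    refine (hlsc univ).trans (liminf_le_of_frequently_le' ?_)
    exact ((eventually_ge_atTop J).mono hbound).frequently
  have hDa : ∀ᶠ j in atTop, IsDistribGradient (a j) (gradMeasure (a j)) := by
    filter_upwards [ha] with j hj
    obtain ⟨M, hM⟩ := hj.bounded
    exact gradMeasure_spec (exists_isDistribGradient_of_ae hj.integrable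
      (hj.eq_zero.mono fun x hx hxR => hx (hRE x hxR)) hM hj.tv_ne_top)
  have hDw : IsDistribGradient w (gradMeasure w) := gradMeasure_spec
    (exists_isDistribGradient_of_ae hwi (hw0.mono fun x hx hxR => hx (hRE x hxR)) hwM htvw)
  -- Here minimality of `a j` is tested with the limit `w` itself, with an error `ε P(E₀)`.
  have hlimsup : limsup (fun j => tv univ (a j)) atTop ≤ tv univ w := by
    have hlim : Tendsto (fun ε : ℝ => tv univ w + ENNReal.ofReal ε * perimeter E₀) (𝓝[>] 0)
        (𝓝 (tv univ w)) := by
      have := (ENNReal.Tendsto.mul_const (b := perimeter E₀)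
        ((ENNReal.continuous_ofReal.tendsto (0 : ℝ)).mono_left
          (nhdsWithin_le_nhds (s := Ioi 0))) (Or.inr hP)).const_add (tv univ w)
      simpa using this
    refine ge_of_tendsto hlim (eventually_mem_nhdsWithin.mono fun ε hε => ?_)
    refine limsup_le_of_le (by isBoundedDefault) ?_
    filter_upwards [ha, hclose ε hε] with j hj1 hj2
    exact hj1.tv_le_add hE₀ hfin hwi hw0 (le_of_lt hε) fun x => by
      linarith [(abs_le.1 (hj2 x)).2]
  have htv : Tendsto (fun j => tv univ (a j)) atTop (𝓝 (tv univ w)) :=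
    tendsto_of_le_liminf_of_limsup_le (hlsc univ) hlimsup
  have hvar : ∀ U, IsOpen U → (fun j => tv U (a j)) =ᶠ[atTop]
      fun j => (gradMeasure (a j)).variation U := fun U hU =>
    hDa.mono fun j hj => (variation_eq_tv hj hU).symm
  have hmass : Tendsto (fun j => (gradMeasure (a j)).variation univ) atTop
      (𝓝 ((gradMeasure w).variation univ)) := by
    rw [variation_eq_tv hDw isOpen_univ]
    exact htv.congr' (hvar univ isOpen_univ)
  have := hDw.finite
  refine ⟨?_, ⟨hwi, _, hDw⟩, fun φ hφ hc => ?_, hmass, hL1⟩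
  · filter_upwards [hai, hDa] with j h1 h2
    exact ⟨h1, _, h2⟩
  · obtain ⟨C, hC⟩ := hφ.bounded_above_of_compact_support hc
    refine tendsto_integral_of_le_liminf_of_tendsto_mass (hDa.mono fun j hj => hj.finite)
      (fun U hU => ?_) hmass hφ hC
    rw [variation_eq_tv hDw hU, ← liminf_congr (hvar U hU)]
    exact hlsc U

lemma UniformlyConverges.abs_sub_le {v : ℕ → Eucl n → ℝ≥0∞} {u : Eucl n → ℝ≥0}
    (h : UniformlyConverges v u) {ε : ℝ} (hε : 0 < ε) :
    ∀ᶠ j in atTop, ∀ x, v j x ≠ ∞ ∧ |(v j x).toReal - u x| ≤ ε := by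
  lift ε to ℝ≥0 using hε.le
  filter_upwards [h ε (by exact_mod_cast hε)] with j hj x
  obtain ⟨h1, h2⟩ := hj x
  have hne : v j x ≠ ∞ := ne_top_of_le_ne_top (by finiteness) h1
  refine ⟨hne, ?_⟩
  lift v j x to ℝ≥0 using hne with y
  have h1' : y ≤ u x + ε := by exact_mod_cast h1
  have h2' : u x ≤ y + ε := by exact_mod_cast h2
  rw [← NNReal.coe_le_coe] at h1' h2'
  push_cast at h1' h2'
  rw [ENNReal.coe_toReal, abs_le]
  constructor <;> linarith

end ATW

end

/-! ### The convergence theorem -/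

theorem proposition5p1 {n : ℕ} (hn : 2 ≤ n) (E₀ : Set (ATW.Eucl n))
    (hbdd : Bornology.IsBounded E₀) (hconv : ATW.IsStrictlyMeanConvex E₀)
    (h : ℕ → ℝ) (hpos : ∀ j, 0 < h j) (hlim : Tendsto h atTop (𝓝 0))
    (E : ℕ → ℕ → Set (ATW.Eucl n)) (hE : ∀ j, ATW.IsScheme (h j) E₀ (E j))
    (uh : ℕ → ATW.Eucl n → ℝ) (huh : ∀ j x, uh j x = (ATW.arrivalTime (h j) (E j) x).toReal)
    (u : ATW.Eucl n → ℝ≥0)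
    (hunif : ATW.UniformlyConverges (fun j => ATW.arrivalTime (h j) (E j)) u)
    (hgrad : ∀ φ : ATW.Eucl n → ℝ, Continuous φ → HasCompactSupport φ →
      Tendsto (fun j => ∫ᵛ x, φ x ∂•(ATW.gradMeasure (uh j))) atTop
        (𝓝 (∫ᵛ x, φ x ∂•(ATW.gradMeasure fun x => (u x : ℝ))))) :
    (∀ᶠ j in atTop, ATW.IsBV (uh j)) ∧ ATW.IsBV (fun x => (u x : ℝ)) ∧
    (∀ φ : ATW.Eucl n → ℝ, Continuous φ → HasCompactSupport φ →
      Tendsto (fun j => ∫ x, φ x ∂(ATW.gradMeasure (uh j)).variation) atTop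
        (𝓝 (∫ x, φ x ∂(ATW.gradMeasure fun x => (u x : ℝ)).variation))) ∧
    Tendsto (fun j => (ATW.gradMeasure (uh j)).variation univ) atTop
      (𝓝 ((ATW.gradMeasure fun x => (u x : ℝ)).variation univ)) ∧
    Tendsto (fun j => ∫⁻ x, ‖uh j x - u x‖ₑ) atTop (𝓝 0) := by
  have huh' : uh = fun j x => (ATW.arrivalTime (h j) (E j) x).toReal :=
    funext fun j => funext (huh j)
  obtain ⟨hP, Ω, hΩ, h₀, hh₀, hstep⟩ := hconv.exists_timestep hn hbdd
  have hE₀ : NullMeasurableSet E₀ := (hE 0).init ▸ (hE 0).measurable 0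
  subst huh'
  refine ATW.strict_convergence_of_isTvMinimal hbdd hE₀ hP ?_ fun ε hε =>
    (hunif.abs_sub_le hε).mono fun j hj x => (hj x).2
  -- Besides `h j < h₀`, uniform closeness to the finite `u` makes the arrival time finite at every
  -- point, as extinction requires.
  filter_upwards [hlim.eventually (gt_mem_nhds hh₀), hunif.abs_sub_le one_pos] with j hj1 hj2
  have hEk := hstep (h j) (hpos j) hj1.le (E j) (hE j)
  obtain ⟨N, hN⟩ := ATW.exists_volume_eq_zero hn (hpos j) hbdd hP hΩ (hE j) hEk
    fun x => (hj2 x).1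
  exact ATW.isTvMinimal_arrivalTime (hpos j) hbdd hP hΩ (hE j) hEk hN
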